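/- **The calculus.** Terms and values of $\lambda_{vker}$, taken up to $\alpha$-equivalence, are given by $t,s,u ::= v \mid v\,s \mid t[x/u]$ and $v ::= x \mid \lambda x.t$, where $x$ is bound in $t$ in $\lambda x.t$ and in $t[x/u]$. Reduction $\to$ is the closure under all contexts (also under $\lambda$) of $(\lambda x.t)\,u \mapsto t[x/u]$ and $t[x/vL] \mapsto t\{x/v\}L$, where $L$ is a possibly empty list $[x_1/u_1]\cdots[x_k/u_k]$ and $t\{x/v\}$ is capture-avoiding substitution. **Nets.** Nets are rooted directed hypergraphs with $e$-nodes and $m$-nodes, and with links: $!$ (from an $e$-node to an $m$-node), $\mathsf d$ (from an $m$-node to an $e$-node), $\mathsf w$ (no source, an $e$-node as target), $\otimes$ (from an $e$-node to an $m$-node and an $e$-node), $\mathsf{par}$ (sources: an $m$-node and an $e$-node, the variable of the link; target: an $e$-node, the root of its box). Each $\mathsf{par}$-link has a box, which is a sub-hypergraph. The free variables of a net are the $e$-nodes without outgoing link and are identified with variable names. Nets are considered up to isomorphism fixing the free variables. **Translation.** The net $[\![t]\!]$ with root $r$ is defined as follows, where nodes with the same variable name are shared. $[\![y]\!]$ is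 a $!$-link from $r$ to an $m$-node $a$ with a $\mathsf d$-link from $a$ to $y$. $[\![\lambda x.t]\!]$ is a $!$-link from $r$ to $a$ with a $\mathsf{par}$-link on $a$ of variable $x$ and box $[\![t]\!]_{\{x\}}$. $[\![v\,s]\!]$ is a $\otimes$-link from $r$ to $a$ and to the root of $[\![s]\!]$, together with $[\![s]\!]$ and, on $a$, the $\mathsf d$-link or the $\mathsf{par}$-link with its box given by $v$ as above. $[\![t[x/u]]\!]$ is $[\![t]\!]_{\{x\}}$ together with $[\![u]\!]$, with $x$ identified with the root of $[\![u]\!]$. For a finite set $X$ of variables, $[\![t]\!]_X$ is $[\![t]\!]$ plus one $\mathsf w$-link on every $y\in X\setminus \mathrm{fv}(t)$. A *proof net* is a net of the form $[\![t]\!]_X$. **Cut elimination**, at any depth. - *Multiplicative:* if an $m$-node $a$ is a target of a $\otimes$-link (source $r$, $e$-target $s$) and the source of a $\mathsf{par}$-link (variable $x$, box root $b$), then the two links and $a$ are removed, the box is opened, $b$ is merged with $r$ and $x$ with $s$. - *Exponential:* let $x$ be the source of a $!$-link of target $a$, and let $H$ be the $\mathsf d$-link on $a$, or the $\mathsf{par}$-link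 on $a$ with its box. If $x$ is the target of $\mathsf d$-links of sources $m_1,\dots,m_k$, $k\ge 1$, then $x$, the $!$-link, these $\mathsf d$-links and $H$ are removed and, for each $i$, a copy of $H$ is put on $m_i$, inside all the boxes that contained the $i$-th $\mathsf d$-link; the targets of $H$ are shared by all the copies. If $x$ is the target of a $\mathsf w$-link, then $x$, the $!$-link, the $\mathsf w$-link and $H$ are removed and each target $y$ of $H$ that is no longer the target of any link gets a $\mathsf w$-link, placed outside all the boxes of which $y$ was a free variable other than the variable of the corresponding $\mathsf{par}$-link. **Statement.** Let $t$ be a term of $\lambda_{vker}$ and $X$ a finite set of variables. Then 1. $t$ is weakly normalizing iff $[\![t]\!]_X$ is; 2. $t$ is strongly normalizing iff $[\![t]\!]_X$ is; 3. $t$ is a normal form iff $[\![t]\!]_X$ is; 4. $t$ is without a normal form iff $[\![t]\!]_X$ is. Moreover, reduction of proof nets is confluent: if $N$ is a proof net, $N\to^*N_1$ and $N\to^*N_2$, then there are $N_3\cong N_4$ with $N_1\to^*N_3$ and $N_2\to^*N_4$. -/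

import Mathlib

namespace VKer

/-! ### Abstract rewriting -/

/-- `a` is a normal form: it has no reduct. -/
def IsNormal {α : Type*} (r : α → α → Prop) (a : α) : Prop := ∀ b, ¬ r a b

/-- `a` is weakly normalizing: some reduction sequence from `a` ends in a normal form. -/
def WeaklyNormalizing {α : Type*} (r : α → α → Prop) (a : α) : Prop :=
  ∃ b, Relation.ReflTransGen r a b ∧ IsNormal r b

/-- `a` is strongly normalizing: there is no infinite reduction sequence from `a`. -/
def StronglyNormalizing {α : Type*} (r : α → α → Prop) (a : α) : Prop :=
  ¬ ∃ f : ℕ → α, f 0 = a ∧ ∀ n, r (f n) (f (n + 1))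

/-- `a` is without a normal form: no reduct of `a` (in any number of steps) is normal. -/
def WithoutNormalForm {α : Type*} (r : α → α → Prop) (a : α) : Prop :=
  ∀ b, Relation.ReflTransGen r a b → ¬ IsNormal r b

/-! ### The value substitution kernel

Terms are taken up to `α`-equivalence, hence they are given in de Bruijn notation. The set of
variable names is `ℕ`: the free variable `i` of a term is the index `i` counted from outside all
binders. In `lam t` and in `es t u`, the index `0` is bound in `t`. -/

mutual
/-- Values `v ::= x | λx.t`. -/
inductive Val : Type
  | var (n : ℕ) : Val
  | lam (t : Term) : Val
/-- Terms `t ::= v | v s | t[x/u]`. The left subterm of an application is a value. -/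
inductive Term : Type
  | val (v : Val) : Term
  | app (v : Val) (s : Term) : Term
  | es (t : Term) (u : Term) : Term
end

/-- Extension of an environment: index `0` is sent to `a`, index `n + 1` to `ρ n`. -/
def scons {α : Type*} (a : α) (ρ : ℕ → α) : ℕ → α
  | 0 => a
  | n + 1 => ρ n

mutual
/-- Free variables of a value. -/
def Val.fv : Val → Set ℕ
  | .var n => {n}
  | .lam t => {n | n + 1 ∈ Term.fv t}
/-- Free variables of a term. -/
def Term.fv : Term → Set ℕ
  | .val v => Val.fv v
  | .app v s => Val.fv v ∪ Term.fv s
  | .es t u => {n | n + 1 ∈ Term.fv t} ∪ Term.fv u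
end

mutual
/-- Renaming of the free variables of a value. -/
def Val.rename (ξ : ℕ → ℕ) : Val → Val
  | .var n => .var (ξ n)
  | .lam t => .lam (Term.rename (scons 0 (fun n => ξ n + 1)) t)
/-- Renaming of the free variables of a term. -/
def Term.rename (ξ : ℕ → ℕ) : Term → Term
  | .val v => .val (Val.rename ξ v)
  | .app v s => .app (Val.rename ξ v) (Term.rename ξ s)
  | .es t u => .es (Term.rename (scons 0 (fun n => ξ n + 1)) t) (Term.rename ξ u)
end

/-- A substitution pushed under one binder. -/
def liftSubst (σ : ℕ → Val) : ℕ → Val :=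
  scons (.var 0) (fun n => Val.rename Nat.succ (σ n))

mutual
/-- Capture-avoiding simultaneous substitution of values for variables, in a value. -/
def Val.subst (σ : ℕ → Val) : Val → Val
  | .var n => σ n
  | .lam t => .lam (Term.subst (liftSubst σ) t)
/-- Capture-avoiding simultaneous substitution of values for variables, in a term. -/
def Term.subst (σ : ℕ → Val) : Term → Term
  | .val v => .val (Val.subst σ v)
  | .app v s => .app (Val.subst σ v) (Term.subst σ s)
  | .es t u => .es (Term.subst (liftSubst σ) t) (Term.subst σ u)
end

/-- `t L`, where `L` is the list `[x₁/u₁]…[xₖ/uₖ]` of explicit substitutions. -/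
def Term.wrap (t : Term) (L : List Term) : Term := L.foldl Term.es t

/-- `t{x/v}` for the step `t[x/v L] ↦ t{x/v} L` with `k = |L|`: the value `v` lies under the `k`
binders of `L`; the index `0` of `t` (that is, `x`) is replaced by `v`, and the other variables of
`t` are shifted past the binders of `L`, so that they are not captured. -/
def Term.substHead (t : Term) (v : Val) (k : ℕ) : Term :=
  Term.subst (scons v (fun n => .var (n + k))) t

mutual
/-- One step of reduction inside a value. -/
inductive Val.Step : Val → Val → Prop
  | lam {t t' : Term} : Term.Step t t' → Val.Step (.lam t) (.lam t')
/-- One step of reduction of a term: the closure under all contexts of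
`(λx.t) u ↦ t[x/u]` and `t[x/v L] ↦ t{x/v} L`. -/
inductive Term.Step : Term → Term → Prop
  | mult (t u : Term) : Term.Step (.app (.lam t) u) (.es t u)
  | expo (t : Term) (v : Val) (L : List Term) :
      Term.Step (.es t ((Term.val v).wrap L)) ((t.substHead v L.length).wrap L)
  | val {v v' : Val} : Val.Step v v' → Term.Step (.val v) (.val v')
  | appLeft {v v' : Val} (s : Term) : Val.Step v v' → Term.Step (.app v s) (.app v' s)
  | appRight (v : Val) {s s' : Term} : Term.Step s s' → Term.Step (.app v s) (.app v s')
  | esLeft {t t' : Term} (u : Term) : Term.Step t t' → Term.Step (.es t u) (.es t' u)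
  | esRight (t : Term) {u u' : Term} : Term.Step u u' → Term.Step (.es t u) (.es t u')
end

/-! ### Nets -/

/-- Exponential nodes: either a variable name (these are the free variables of a net) or an
anonymous node. -/
inductive ENode (E : Type) : Type
  | name (x : ℕ) : ENode E
  | node (a : E) : ENode E

def ENode.map {E E' : Type} (f : E → E') : ENode E → ENode E'
  | .name x => .name x
  | .node a => .node (f a)

/-- Links (directed hyperedges); multiplicative nodes are elements of `M`.
* `bang r a`: source the `e`-node `r`, target the `m`-node `a`;
* `der a x`: source the `m`-node `a`, target the `e`-node `x`;
* `weak x`: no source, target the `e`-node `x`;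
* `par a x b`: sources the `m`-node `a` and the `e`-node `x` (the variable of the link), target the
  `e`-node `b` (the root of its box);
* `tens r a s`: source the `e`-node `r`, targets the `m`-node `a` and the `e`-node `s`. -/
inductive Link (E M : Type) : Type
  | bang (r : ENode E) (a : M) : Link E M
  | der (a : M) (x : ENode E) : Link E M
  | weak (x : ENode E) : Link E M
  | par (a : M) (x : ENode E) (b : ENode E) : Link E M
  | tens (r : ENode E) (a : M) (s : ENode E) : Link E M

namespace Link

variable {E M : Type}

/-- The `e`-nodes that are sources of a link. -/
def eSources : Link E M → Set (ENode E)
  | bang r _ => {r}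
  | der _ _ => ∅
  | weak _ => ∅
  | par _ x _ => {x}
  | tens r _ _ => {r}

/-- The `e`-nodes that are targets of a link. -/
def eTargets : Link E M → Set (ENode E)
  | bang _ _ => ∅
  | der _ x => {x}
  | weak x => {x}
  | par _ _ b => {b}
  | tens _ _ s => {s}

/-- The `m`-nodes that are sources of a link. -/
def mSources : Link E M → Set M
  | bang _ _ => ∅
  | der a _ => {a}
  | weak _ => ∅
  | par a _ _ => {a}
  | tens _ _ _ => ∅

/-- The `m`-nodes that are targets of a link. -/
def mTargets : Link E M → Set M
  | bang _ a => {a}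
  | der _ _ => ∅
  | weak _ => ∅
  | par _ _ _ => ∅
  | tens _ a _ => {a}

/-- Relabelling of the nodes of a link. -/
def map {E' M' : Type} (f : ENode E → ENode E') (g : M → M') : Link E M → Link E' M'
  | bang r a => bang (f r) (g a)
  | der a x => der (g a) (f x)
  | weak x => weak (f x)
  | par a x b => par (g a) (f x) (f b)
  | tens r a s => tens (f r) (g a) (f s)

end Link

/-- Rooted hypergraphs with boxes. An element `(S, l)` of `links` is a link `l` of the graph
together with the set `S` of all the boxes that contain `l`, where a box is given by the `m`-node
that is the source of its `par`-link. So the box of the `par`-link of source `a` consists of the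
links `l` with `(S, l) ∈ links` and `a ∈ S`. The nodes of the graph are those that occur in its
links (there are no isolated nodes); its free variables are the names that occur in its links. -/
structure Net : Type 1 where
  E : Type
  M : Type
  root : ENode E
  links : Set (Set M × Link E M)

namespace Net

/-- The anonymous `e`-nodes of a net. -/
def eNodes (N : Net) : Set N.E :=
  {a | ∃ l ∈ N.links, ENode.node a ∈ l.2.eSources ∨ ENode.node a ∈ l.2.eTargets}

/-- The `m`-nodes of a net. -/
def mNodes (N : Net) : Set N.M :=
  {a | ∃ l ∈ N.links, a ∈ l.2.mSources ∨ a ∈ l.2.mTargets ∨ a ∈ l.1}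

/-- Isomorphism of nets: a renaming of the anonymous `e`-nodes and of the `m`-nodes that preserves
the root, the links and the boxes. The free variables, which are names, are fixed. -/
def Iso (N N' : Net) : Prop :=
  ∃ (f : N.E → N'.E) (g : N.M → N'.M),
    Set.InjOn f N.eNodes ∧ Set.InjOn g N.mNodes ∧
    N.root.map f = N'.root ∧
    N'.links = (fun l => (g '' l.1, l.2.map (ENode.map f) g)) '' N.links

/-- What hangs on the `m`-node `a`: the link of source `a` (a `der`- or a `par`-link) and, when
it is a `par`-link, all the links of its box. -/
def body (N : Net) (a : N.M) : Set (Set N.M × Link N.E N.M) :=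
  {l ∈ N.links | a ∈ l.2.mSources ∨ a ∈ l.1}

/-- The `e`-nodes of `N.body a` that are private to it: all those that are the source of one of
its links. -/
def privateNodes (N : Net) (a : N.M) : Set (ENode N.E) :=
  {v | ∃ l ∈ N.body a, v ∈ l.2.eSources}

/-- The `e`-nodes on which `N.body a` ends: the target of its `der`-link, or the free variables of
its box other than the variable of the `par`-link. -/
def bodyTargets (N : Net) (a : N.M) : Set (ENode N.E) :=
  {v | (∃ l ∈ N.body a, v ∈ l.2.eTargets) ∧ v ∉ N.privateNodes a}

/-- The boxes of which the `e`-node `y` is an internal node, the root or the variable of the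
`par`-link, that is, the boxes that contain `y` not just as one of their auxiliary free
variables. -/
def boxesAround (N : Net) (y : ENode N.E) : Set N.M :=
  {a | (∃ l ∈ N.links, a ∈ l.1 ∧ y ∈ l.2.eSources) ∨ ∃ S b, (S, Link.par a y b) ∈ N.links}

open Classical in
/-- Elimination of the multiplicative cut between `tens r a s` and `par a x b`: the two links and
the node `a` disappear, the box of the `par`-link is opened, `b` is merged with `r` and `x` is
merged with `s`. -/
noncomputable def multReduct (N : Net) (r : ENode N.E) (a : N.M) (s x b : ENode N.E) : Net where
  E := N.E
  M := N.M
  root := if N.root = b then r else if N.root = x then s else N.root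
  links :=
    (fun l => (l.1 \ {a}, l.2.map (fun v => if v = b then r else if v = x then s else v) id)) ''
      {l ∈ N.links | l.2 ≠ .tens r a s ∧ l.2 ≠ .par a x b}

open Classical in
/-- Action on `e`-nodes of the copy number `i` of `N.body a`: private nodes are copied, the others
are shared by all the copies. -/
noncomputable def copyE (N : Net) (a i : N.M) : ENode N.E → ENode (N.E ⊕ N.E × N.M)
  | .name x => .name x
  | .node c => if ENode.node c ∈ N.privateNodes a then .node (.inr (c, i)) else .node (.inl c)

open Classical in
/-- Action on `m`-nodes of the copy number `i` of `N.body a`: the copy is plugged on the `m`-node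
`i` of the graph, and the `m`-nodes other than `a` are copied. -/
noncomputable def copyM (N : Net) (a i : N.M) : N.M → N.M ⊕ N.M × N.M :=
  fun c => if c = a then .inl i else .inr (c, i)

/-- Elimination of the exponential cut on `x` between the link `bang x a`, contained in the boxes
`S`, and all the derelictions of target `x`: these links, `x`, `a` and `N.body a` are removed, and
for every dereliction `der i x`, contained in the boxes `T`, a copy of `N.body a` is plugged on
`i`, inside the boxes `T`. -/
noncomputable def derReduct (N : Net) (S : Set N.M) (x : ENode N.E) (a : N.M) : Net where
  E := N.E ⊕ N.E × N.M
  M := N.M ⊕ N.M × N.M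
  root := N.root.map .inl
  links :=
    (fun l => (Sum.inl '' l.1, l.2.map (ENode.map .inl) .inl)) ''
      {l ∈ N.links | l ∉ N.body a ∧ l.2 ≠ .bang x a ∧ ∀ i, l.2 ≠ .der i x} ∪
    {l | ∃ T i, (T, Link.der i x) ∈ N.links ∧ ∃ h ∈ N.body a,
      l = (Sum.inl '' T ∪ N.copyM a i '' (h.1 \ S), h.2.map (N.copyE a i) (N.copyM a i))}

/-- What is left by the erasure of the links `bang x a`, `weak x` and of `N.body a`. -/
def afterErasure (N : Net) (x : ENode N.E) (a : N.M) : Set (Set N.M × Link N.E N.M) :=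
  {l ∈ N.links | l ∉ N.body a ∧ l.2 ≠ .bang x a ∧ l.2 ≠ .weak x}

/-- Elimination of the exponential cut on `x` between the links `bang x a` and `weak x`: these
links and `N.body a` are erased, and every target `y` of `N.body a` gets a weakening, pushed out of
all the boxes closing on `y`; such a weakening is dropped when it would be contracted with another
link. -/
def weakReduct (N : Net) (x : ENode N.E) (a : N.M) : Net where
  E := N.E
  M := N.M
  root := N.root
  links := N.afterErasure x a ∪
    {l | ∃ y ∈ N.bodyTargets a, (∀ k ∈ N.afterErasure x a, y ∉ k.2.eTargets) ∧
      l = (N.boxesAround y, .weak y)}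

/-- Cut elimination, at any level: `N.Contracts N'` when `N'` is obtained from `N` by eliminating
one cut. -/
inductive Contracts (N : Net) : Net → Prop
  | mult {S : Set N.M} {r s x b : ENode N.E} {a : N.M} :
      (S, Link.tens r a s) ∈ N.links → (S, Link.par a x b) ∈ N.links →
      Contracts N (N.multReduct r a s x b)
  | der {S T : Set N.M} {x : ENode N.E} {a i : N.M} :
      (S, Link.bang x a) ∈ N.links → (T, Link.der i x) ∈ N.links →
      Contracts N (N.derReduct S x a)
  | weak {S : Set N.M} {x : ENode N.E} {a : N.M} :
      (S, Link.bang x a) ∈ N.links → (S, Link.weak x) ∈ N.links →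
      Contracts N (N.weakReduct x a)

/-- One step of reduction of nets, which are considered up to isomorphism. -/
def Step (N N' : Net) : Prop := ∃ N₀, N.Contracts N₀ ∧ N₀.Iso N'

end Net

/-! ### The translation of terms to nets

The anonymous nodes of the translation are named after the positions (addresses) of the subterms. -/

/-- Anonymous `e`-nodes of the translation: the root of the subterm at a position, or the variable
bound by the abstraction at a position. -/
inductive PosNode : Type
  | root (p : List ℕ) : PosNode
  | bound (p : List ℕ) : PosNode

mutual
/-- Links of the translation of a value placed at position `p`, hanging on the `m`-node `p`.
Here `S` is the set of the boxes around it, and `ρ` sends each index to its `e`-node. -/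
def Val.netLinks (ρ : ℕ → ENode PosNode) (S : Set (List ℕ)) (p : List ℕ) :
    Val → Set (Set (List ℕ) × Link PosNode (List ℕ))
  | .var n => {(S, .der p (ρ n))}
  | .lam t =>
      {(S, .par p (.node (.bound p)) (.node (.root (0 :: p))))} ∪
      Term.netLinks (scons (.node (.bound p)) ρ) (insert p S) (.node (.root (0 :: p))) (0 :: p) t ∪
      {l | 0 ∉ t.fv ∧ l = (insert p S, .weak (.node (.bound p)))}
/-- Links of the translation of a term placed at position `p`, with root the `e`-node `r`. -/
def Term.netLinks (ρ : ℕ → ENode PosNode) (S : Set (List ℕ)) (r : ENode PosNode) (p : List ℕ) :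
    Term → Set (Set (List ℕ) × Link PosNode (List ℕ))
  | .val v => {(S, .bang r (0 :: p))} ∪ Val.netLinks ρ S (0 :: p) v
  | .app v s =>
      {(S, .tens r (0 :: p) (.node (.root (1 :: p))))} ∪
      Val.netLinks ρ S (0 :: p) v ∪
      Term.netLinks ρ S (.node (.root (1 :: p))) (1 :: p) s
  | .es t u =>
      Term.netLinks (scons (.node (.root (1 :: p))) ρ) S r (0 :: p) t ∪
      {l | 0 ∉ t.fv ∧ l = (S, .weak (.node (.root (1 :: p))))} ∪
      Term.netLinks ρ S (.node (.root (1 :: p))) (1 :: p) u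
end

/-- The translation `⟦t⟧_X` of a term `t`, for a finite set `X` of variables: the net of `t` with,
in addition, a weakening on each variable of `X` that is not free in `t`. -/
def Term.toNet (t : Term) (X : Finset ℕ) : Net where
  E := PosNode
  M := List ℕ
  root := .node (.root [])
  links := Term.netLinks .name ∅ (.node (.root [])) [] t ∪
    {l | ∃ y ∈ X, y ∉ t.fv ∧ l = (∅, .weak (.name y))}

/-- A proof net is the translation of a term, up to isomorphism. -/
def Net.IsProofNet (N : Net) : Prop := ∃ (t : Term) (X : Finset ℕ), (t.toNet X).Iso N

end VKer

/-!
Terms and proof nets reduce in lockstep: the translation is a strong bisimulation, one step of a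
term being exactly the elimination of one cut. All the claims follow from this and from the
confluence of the reduction of terms.

A net is described by a *named term* (`NTerm`), that is, a term in which every subterm carries the
nodes of its root, of its bound variable and of its `m`-node. The links of the net `netOf A r Y` are
read off the named term `A`: the links of `NTerm.core`, and one weakening for every variable, bound
in `A` or free in `Y`, that does not occur in `A`. A net represents a term `t`
(`Represents`) when it is `netOf A r Y` for an annotation `A` of `t` all of whose nodes are
distinct. Since weakenings are computed from the occurrences, no invariant about them has to be
maintained: it is enough that the links around a variable determine where it would be weakened
(`NTerm.around_of_mem_homes`), as the elimination of a cut against a weakening puts the new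
weakenings in the boxes found in the graph.

On named terms, cut elimination is syntactic. A multiplicative cut is a subterm
`(λx.T) U`, replaced by `T[x/U]` up to the merging of two pairs of nodes (`Mult.multReduct_eq`). An
exponential cut is a subterm `T[x/vL]`; its elimination against derelictions substitutes in `T` a
fresh copy of `v` for every occurrence of `x` (`Cut.derReduct_eq`), and its elimination against a
weakening deletes `v`, as `x` does not occur in `T` (`Cut.weakReduct_eq`). The list `L` remains in
place in both cases, so this is the exponential rule, whose effect on terms is the relation `Graft`.
Conversely every cut is of this form, because its links determine the subterm at which it lies
(`NTerm.WF.exists_mult`, `NTerm.WF.exists_expo`). This yields `Represents.exists_contracts` and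
`Represents.exists_step`, the two halves of the bisimulation.

Being represented is invariant under isomorphism (`Represents.of_iso`), nets representing the same
term are isomorphic (`Represents.iso`), and `t.toNet X` represents `t` (`Term.represents_toNet`).
Hence normal forms and infinite reductions are transported in both directions. Confluence of nets
is confluence of terms (`Term.confluent`), which is proved with a parallel reduction whose
exponential rule fires as soon as the argument *becomes* an answer; every term then has a complete
development.
-/

namespace VKer

/-! ### Substitution in de Bruijn terms -/

/-- A renaming pushed under one binder. -/
def liftRen (ξ : ℕ → ℕ) : ℕ → ℕ := scons 0 (fun n => ξ n + 1)

/-- The renaming that inserts a fresh variable just above the index `0`: it moves the body of an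
explicit substitution past one further binder. -/
def skipOne : ℕ → ℕ := scons 0 (fun n => n + 2)

theorem scons_comp {α β : Type*} (f : α → β) (a : α) (ρ : ℕ → α) :
    (fun n => f (scons a ρ n)) = scons (f a) (fun n => f (ρ n)) := by
  funext n; cases n <;> rfl

@[simp] theorem scons_zero {α : Type*} (a : α) (ρ : ℕ → α) : scons a ρ 0 = a := rfl

@[simp] theorem scons_succ {α : Type*} (a : α) (ρ : ℕ → α) (n : ℕ) : scons a ρ (n + 1) = ρ n := rfl

theorem liftSubst_var (ξ : ℕ → ℕ) :
    liftSubst (fun n => .var (ξ n)) = fun n => .var (liftRen ξ n) := by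
  funext n; cases n <;> rfl

mutual
theorem Val.rename_eq_subst : ∀ (v : Val) (ξ : ℕ → ℕ), v.rename ξ = v.subst (fun n => .var (ξ n))
  | .var _, _ => rfl
  | .lam t, ξ => by
    rw [Val.rename, Val.subst, liftSubst_var, ← Term.rename_eq_subst t]; rfl
theorem Term.rename_eq_subst :
    ∀ (t : Term) (ξ : ℕ → ℕ), t.rename ξ = t.subst (fun n => .var (ξ n))
  | .val v, ξ => by rw [Term.rename, Term.subst, Val.rename_eq_subst v]
  | .app v s, ξ => by
    rw [Term.rename, Term.subst, Val.rename_eq_subst v, Term.rename_eq_subst s]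
  | .es t u, ξ => by
    rw [Term.rename, Term.subst, Term.rename_eq_subst u, liftSubst_var,
      ← Term.rename_eq_subst t]; rfl
end

mutual
theorem Val.subst_rename_comp :
    ∀ (v : Val) (ξ : ℕ → ℕ) (σ : ℕ → Val), (v.rename ξ).subst σ = v.subst (fun n => σ (ξ n))
  | .var _, _, _ => rfl
  | .lam t, ξ, σ => by
    rw [Val.rename, Val.subst, Val.subst, Term.subst_rename_comp t]
    congr 2; funext n; cases n <;> rfl
theorem Term.subst_rename_comp :
    ∀ (t : Term) (ξ : ℕ → ℕ) (σ : ℕ → Val), (t.rename ξ).subst σ = t.subst (fun n => σ (ξ n))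
  | .val v, ξ, σ => by rw [Term.rename, Term.subst, Term.subst, Val.subst_rename_comp v]
  | .app v s, ξ, σ => by
    rw [Term.rename, Term.subst, Term.subst, Val.subst_rename_comp v, Term.subst_rename_comp s]
  | .es t u, ξ, σ => by
    rw [Term.rename, Term.subst, Term.subst, Term.subst_rename_comp u, Term.subst_rename_comp t]
    congr 2; funext n; cases n <;> rfl
end

theorem Val.rename_rename (v : Val) (ξ ζ : ℕ → ℕ) :
    (v.rename ξ).rename ζ = v.rename (fun n => ζ (ξ n)) := by
  rw [Val.rename_eq_subst _ ζ, Val.subst_rename_comp, Val.rename_eq_subst]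

theorem Term.rename_rename (t : Term) (ξ ζ : ℕ → ℕ) :
    (t.rename ξ).rename ζ = t.rename (fun n => ζ (ξ n)) := by
  rw [Term.rename_eq_subst _ ζ, Term.subst_rename_comp, Term.rename_eq_subst]

theorem liftSubst_rename (ξ : ℕ → ℕ) (σ : ℕ → Val) :
    (fun n => (liftSubst σ n).rename (liftRen ξ)) = liftSubst (fun n => (σ n).rename ξ) := by
  funext n
  cases n with
  | zero => rfl
  | succ n => simp only [liftSubst, scons_succ, Val.rename_rename]; rfl

mutual
theorem Val.rename_subst_comp :
    ∀ (v : Val) (σ : ℕ → Val) (ξ : ℕ → ℕ),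
      (v.subst σ).rename ξ = v.subst (fun n => (σ n).rename ξ)
  | .var _, _, _ => rfl
  | .lam t, σ, ξ => by
    rw [Val.subst, Val.rename, Val.subst, ← liftSubst_rename, ← Term.rename_subst_comp t]; rfl
theorem Term.rename_subst_comp :
    ∀ (t : Term) (σ : ℕ → Val) (ξ : ℕ → ℕ),
      (t.subst σ).rename ξ = t.subst (fun n => (σ n).rename ξ)
  | .val v, σ, ξ => by rw [Term.subst, Term.rename, Term.subst, Val.rename_subst_comp v]
  | .app v s, σ, ξ => by
    rw [Term.subst, Term.rename, Term.subst, Val.rename_subst_comp v, Term.rename_subst_comp s]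
  | .es t u, σ, ξ => by
    rw [Term.subst, Term.rename, Term.subst, Term.rename_subst_comp u, ← liftSubst_rename,
      ← Term.rename_subst_comp t]; rfl
end

theorem liftSubst_comp (σ τ : ℕ → Val) :
    (fun n => (liftSubst σ n).subst (liftSubst τ)) = liftSubst (fun n => (σ n).subst τ) := by
  funext n
  cases n with
  | zero => rfl
  | succ n =>
    simp only [liftSubst, scons_succ, Val.subst_rename_comp, Val.rename_subst_comp]

mutual
theorem Val.subst_subst :
    ∀ (v : Val) (σ τ : ℕ → Val), (v.subst σ).subst τ = v.subst (fun n => (σ n).subst τ)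
  | .var _, _, _ => rfl
  | .lam t, σ, τ => by
    rw [Val.subst, Val.subst, Val.subst, Term.subst_subst t, liftSubst_comp]
theorem Term.subst_subst :
    ∀ (t : Term) (σ τ : ℕ → Val), (t.subst σ).subst τ = t.subst (fun n => (σ n).subst τ)
  | .val v, σ, τ => by rw [Term.subst, Term.subst, Term.subst, Val.subst_subst v]
  | .app v s, σ, τ => by
    rw [Term.subst, Term.subst, Term.subst, Val.subst_subst v, Term.subst_subst s]
  | .es t u, σ, τ => by
    rw [Term.subst, Term.subst, Term.subst, Term.subst_subst u, Term.subst_subst t, liftSubst_comp]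
end

theorem liftSubst_id : liftSubst Val.var = Val.var := by
  funext n; cases n <;> rfl

mutual
theorem Val.subst_id : ∀ v : Val, v.subst .var = v
  | .var _ => rfl
  | .lam t => by rw [Val.subst, liftSubst_id, Term.subst_id t]
theorem Term.subst_id : ∀ t : Term, t.subst .var = t
  | .val v => by rw [Term.subst, Val.subst_id v]
  | .app v s => by rw [Term.subst, Val.subst_id v, Term.subst_id s]
  | .es t u => by rw [Term.subst, Term.subst_id u, liftSubst_id, Term.subst_id t]
end

/-! ### Substitution of an answer -/

/-- `Graft t u r` says that `u` is an answer `v L` and that `r` is `t{x/v} L`, the reduct of the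
exponential redex `t[x/u]`. The list `L` is traversed from the outside. -/
inductive Graft : Term → Term → Term → Prop
  | val (t : Term) (v : Val) : Graft t (.val v) (t.subst (scons v .var))
  | es {t u r : Term} (w : Term) :
      Graft (t.rename skipOne) u r → Graft t (.es u w) (.es r w)

theorem Term.wrap_concat (t : Term) (L : List Term) (w : Term) :
    t.wrap (L ++ [w]) = .es (t.wrap L) w := by
  simp [Term.wrap]

theorem Term.substHead_rename (t : Term) (v : Val) (k : ℕ) :
    (t.rename skipOne).substHead v k = t.substHead v (k + 1) := by
  rw [Term.substHead, Term.subst_rename_comp, Term.substHead]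
  congr 1; funext n; cases n with
  | zero => rfl
  | succ n => simp only [skipOne, scons_succ]; congr 1; omega

/-- The right-hand side of the exponential rule is a graft: going under one binder of the list `L`
renames the body by `skipOne`. -/
theorem graft_wrap (v : Val) (L : List Term) :
    ∀ t : Term, Graft t ((Term.val v).wrap L) ((t.substHead v L.length).wrap L) := by
  induction L using List.reverseRecOn with
  | nil => intro t; exact Graft.val t v
  | append_singleton L w ih =>
    intro t
    rw [Term.wrap_concat, Term.wrap_concat, List.length_append, List.length_singleton,
      ← Term.substHead_rename]
    exact Graft.es w (ih _)

theorem Graft.exists_wrap {t u r : Term} (h : Graft t u r) :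
    ∃ (v : Val) (L : List Term),
      u = (Term.val v).wrap L ∧ r = (t.substHead v L.length).wrap L := by
  induction h with
  | val t v => exact ⟨v, [], rfl, rfl⟩
  | @es t u r w _ ih =>
    obtain ⟨v, L, rfl, rfl⟩ := ih
    refine ⟨v, L ++ [w], (Term.wrap_concat ..).symm, ?_⟩
    rw [Term.wrap_concat, List.length_append, List.length_singleton, ← Term.substHead_rename]

theorem Graft.step {t u r : Term} (h : Graft t u r) : Term.Step (.es t u) r := by
  obtain ⟨v, L, rfl, rfl⟩ := h.exists_wrap
  exact Term.Step.expo t v L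

/-- Being an answer does not depend on the term in which it is substituted. -/
theorem Graft.change {t u r : Term} (h : Graft t u r) : ∀ t' : Term, ∃ r', Graft t' u r' := by
  induction h with
  | val t v => exact fun t' => ⟨_, Graft.val t' v⟩
  | es w _ ih =>
    intro t'
    obtain ⟨r', hr⟩ := ih (t'.rename skipOne)
    exact ⟨_, Graft.es w hr⟩

theorem Graft.unique {t u r : Term} (h : Graft t u r) : ∀ {r'}, Graft t u r' → r' = r := by
  induction h with
  | val t v => intro r' h'; cases h'; rfl
  | es w _ ih => intro r' h'; cases h' with | es _ h' => rw [ih h']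

theorem Graft.subst {t u r : Term} (h : Graft t u r) :
    ∀ σ : ℕ → Val, Graft (t.subst (liftSubst σ)) (u.subst σ) (r.subst σ) := by
  induction h with
  | val t v =>
    intro σ
    have : (t.subst (scons v .var)).subst σ
        = (t.subst (liftSubst σ)).subst (scons (v.subst σ) .var) := by
      rw [Term.subst_subst, Term.subst_subst]
      congr 1; funext n
      cases n with
      | zero => rfl
      | succ n =>
        simp only [scons_succ, liftSubst, Val.subst_rename_comp]
        exact (Val.subst_id _).symm
    rw [this]
    exact Graft.val _ _
  | @es t u r w _ ih =>
    intro σ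
    have := ih (liftSubst σ)
    have e : (t.rename skipOne).subst (liftSubst (liftSubst σ))
        = (t.subst (liftSubst σ)).rename skipOne := by
      rw [Term.subst_rename_comp, Term.rename_subst_comp]
      congr 1; funext n
      cases n with
      | zero => rfl
      | succ n =>
        simp only [skipOne, scons_succ, liftSubst, Val.rename_rename]
    rw [e] at this
    exact Graft.es _ this

theorem Graft.rename {t u r : Term} (h : Graft t u r) (ξ : ℕ → ℕ) :
    Graft (t.rename (liftRen ξ)) (u.rename ξ) (r.rename ξ) := by
  have := h.subst (fun n => .var (ξ n))
  rwa [liftSubst_var, ← Term.rename_eq_subst, ← Term.rename_eq_subst, ← Term.rename_eq_subst]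
    at this

/-- Two nested exponential redexes may be fired from the inside or from the outside. -/
theorem Graft.assoc {u₁ w u' : Term} (h : Graft u₁ w u') :
    ∀ {t r₁ r : Term}, Graft (t.rename skipOne) u₁ r₁ → Graft r₁ w r → Graft t u' r := by
  induction h with
  | val u₁ v =>
    intro t r₁ r h₁ h₂
    cases h₂
    have := h₁.subst (scons v .var)
    have e : (t.rename skipOne).subst (liftSubst (scons v .var)) = t := by
      rw [Term.subst_rename_comp]
      conv_rhs => rw [← Term.subst_id t]
      congr 1; funext n; cases n <;> rfl
    rwa [e] at this
  | @es u₁ w u' z _ ih =>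
    intro t r₁ r h₁ h₂
    cases h₂ with
    | es _ h₂ =>
      refine Graft.es _ (ih ?_ h₂)
      have := h₁.rename skipOne
      rw [Term.rename_rename] at this ⊢
      convert this using 2
      funext n; cases n <;> rfl

/-! ### Parallel reduction -/

mutual
/-- Parallel reduction of values. -/
inductive Val.Par : Val → Val → Prop
  | var (n : ℕ) : Val.Par (.var n) (.var n)
  | lam {t t' : Term} : Term.Par t t' → Val.Par (.lam t) (.lam t')
/-- Parallel reduction of terms. In the rule `expo` the argument only has to become an answer
after its own parallel step. -/
inductive Term.Par : Term → Term → Prop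
  | val {v v' : Val} : Val.Par v v' → Term.Par (.val v) (.val v')
  | app {v v' : Val} {s s' : Term} : Val.Par v v' → Term.Par s s' → Term.Par (.app v s) (.app v' s')
  | es {t t' u u' : Term} : Term.Par t t' → Term.Par u u' → Term.Par (.es t u) (.es t' u')
  | mult {t t' u u' : Term} :
      Term.Par t t' → Term.Par u u' → Term.Par (.app (.lam t) u) (.es t' u')
  | expo {t t' u u' r : Term} :
      Term.Par t t' → Term.Par u u' → Graft t' u' r → Term.Par (.es t u) r
end

mutual
theorem Val.Par.refl : ∀ v : Val, v.Par v
  | .var n => .var n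
  | .lam t => .lam (Term.Par.refl t)
theorem Term.Par.refl : ∀ t : Term, t.Par t
  | .val v => .val (Val.Par.refl v)
  | .app v s => .app (Val.Par.refl v) (Term.Par.refl s)
  | .es t u => .es (Term.Par.refl t) (Term.Par.refl u)
end

mutual
theorem Val.Step.par : ∀ {v v' : Val}, v.Step v' → v.Par v'
  | _, _, .lam h => .lam (Term.Step.par h)
theorem Term.Step.par : ∀ {t t' : Term}, t.Step t' → t.Par t'
  | _, _, .mult t u => .mult (.refl t) (.refl u)
  | _, _, .expo t v L => .expo (.refl t) (.refl _) (graft_wrap v L t)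
  | _, _, .val h => .val (Val.Step.par h)
  | _, _, .appLeft s h => .app (Val.Step.par h) (.refl s)
  | _, _, .appRight v h => .app (.refl v) (Term.Step.par h)
  | _, _, .esLeft u h => .es (Term.Step.par h) (.refl u)
  | _, _, .esRight t h => .es (.refl t) (Term.Step.par h)
end

open Relation in
mutual
theorem Val.Par.steps : ∀ {v v' : Val}, v.Par v' → ReflTransGen Val.Step v v'
  | _, _, .var _ => .refl
  | _, _, .lam h => (Term.Par.steps h).lift _ fun _ _ => .lam
theorem Term.Par.steps : ∀ {t t' : Term}, t.Par t' → ReflTransGen Term.Step t t'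
  | _, _, .val h => (Val.Par.steps h).lift _ fun _ _ => .val
  | _, _, .app h₁ h₂ =>
    ((Val.Par.steps h₁).lift (Term.app · _) fun _ _ => .appLeft _).trans
      ((Term.Par.steps h₂).lift _ fun _ _ => .appRight _)
  | _, _, .es h₁ h₂ =>
    ((Term.Par.steps h₁).lift (Term.es · _) fun _ _ => .esLeft _).trans
      ((Term.Par.steps h₂).lift _ fun _ _ => .esRight _)
  | _, _, .mult h₁ h₂ =>
    .head (.mult _ _) (((Term.Par.steps h₁).lift (Term.es · _) fun _ _ => .esLeft _).trans
      ((Term.Par.steps h₂).lift _ fun _ _ => .esRight _))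
  | _, _, .expo h₁ h₂ h =>
    (((Term.Par.steps h₁).lift (Term.es · _) fun _ _ => .esLeft _).trans
      ((Term.Par.steps h₂).lift _ fun _ _ => .esRight _)).tail h.step
end

mutual
theorem Val.Par.rename : ∀ {v v' : Val}, v.Par v' → ∀ ξ, (v.rename ξ).Par (v'.rename ξ)
  | _, _, .var _, _ => .refl _
  | _, _, .lam h, _ => .lam (Term.Par.rename h _)
theorem Term.Par.rename : ∀ {t t' : Term}, t.Par t' → ∀ ξ, (t.rename ξ).Par (t'.rename ξ)
  | _, _, .val h, _ => .val (Val.Par.rename h _)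
  | _, _, .app h₁ h₂, _ => .app (Val.Par.rename h₁ _) (Term.Par.rename h₂ _)
  | _, _, .es h₁ h₂, _ => .es (Term.Par.rename h₁ _) (Term.Par.rename h₂ _)
  | _, _, .mult h₁ h₂, _ => .mult (Term.Par.rename h₁ _) (Term.Par.rename h₂ _)
  | _, _, .expo h₁ h₂ h, _ => .expo (Term.Par.rename h₁ _) (Term.Par.rename h₂ _) (h.rename _)
end

theorem liftSubst_par {σ τ : ℕ → Val} (h : ∀ n, (σ n).Par (τ n)) :
    ∀ n, (liftSubst σ n).Par (liftSubst τ n)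
  | 0 => .var 0
  | n + 1 => (h n).rename _

mutual
theorem Val.Par.subst : ∀ {v v' : Val}, v.Par v' → ∀ {σ τ : ℕ → Val}, (∀ n, (σ n).Par (τ n)) →
    (v.subst σ).Par (v'.subst τ)
  | _, _, .var n, _, _, hσ => hσ n
  | _, _, .lam h, _, _, hσ => .lam (Term.Par.subst h (liftSubst_par hσ))
theorem Term.Par.subst : ∀ {t t' : Term}, t.Par t' → ∀ {σ τ : ℕ → Val}, (∀ n, (σ n).Par (τ n)) →
    (t.subst σ).Par (t'.subst τ)
  | _, _, .val h, _, _, hσ => .val (Val.Par.subst h hσ)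
  | _, _, .app h₁ h₂, _, _, hσ => .app (Val.Par.subst h₁ hσ) (Term.Par.subst h₂ hσ)
  | _, _, .es h₁ h₂, _, _, hσ =>
    .es (Term.Par.subst h₁ (liftSubst_par hσ)) (Term.Par.subst h₂ hσ)
  | _, _, .mult h₁ h₂, _, _, hσ =>
    .mult (Term.Par.subst h₁ (liftSubst_par hσ)) (Term.Par.subst h₂ hσ)
  | _, _, .expo h₁ h₂ h, _, _, hσ =>
    .expo (Term.Par.subst h₁ (liftSubst_par hσ)) (Term.Par.subst h₂ hσ) (h.subst _)
end

/-- Substitution of answers is compatible with parallel reduction; in particular answers are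
stable under reduction. -/
theorem Graft.par {t u r : Term} (h : Graft t u r) :
    ∀ {t' u' : Term}, t.Par t' → u.Par u' → ∃ r', Graft t' u' r' ∧ r.Par r' := by
  induction h with
  | val t v =>
    intro t' u' ht hu
    cases hu with
    | val hv =>
      refine ⟨_, Graft.val _ _, ht.subst fun n => ?_⟩
      cases n with
      | zero => exact hv
      | succ n => exact .var n
  | @es t u r w _ ih =>
    intro t' u' ht hu
    cases hu with
    | es h₁ h₂ =>
      obtain ⟨r', hr, hp⟩ := ih (ht.rename _) h₁
      exact ⟨_, Graft.es _ hr, .es hp h₂⟩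
    | expo h₁ h₂ hg =>
      obtain ⟨r', hr, hp⟩ := ih (ht.rename _) h₁
      obtain ⟨r'', hr''⟩ := hg.change r'
      exact ⟨r'', hg.assoc hr hr'', .expo hp h₂ hr''⟩

mutual
/-- Every value has a complete development, a common parallel reduct of all its parallel
reducts. -/
theorem Val.exists_development : ∀ v : Val, ∃ d : Val, ∀ v', v.Par v' → v'.Par d
  | .var n => ⟨.var n, fun _ h => by cases h; exact .var n⟩
  | .lam t => by
    obtain ⟨d, hd⟩ := Term.exists_development t
    exact ⟨.lam d, fun _ h => by cases h with | lam h => exact .lam (hd _ h)⟩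
/-- Every term has a complete development, a common parallel reduct of all its parallel
reducts. -/
theorem Term.exists_development : ∀ t : Term, ∃ d : Term, ∀ t', t.Par t' → t'.Par d
  | .val v => by
    obtain ⟨d, hd⟩ := Val.exists_development v
    exact ⟨.val d, fun _ h => by cases h with | val h => exact .val (hd _ h)⟩
  | .app (.var n) s => by
    obtain ⟨d, hd⟩ := Term.exists_development s
    refine ⟨.app (.var n) d, fun _ h => ?_⟩
    cases h with
    | app h₁ h₂ => cases h₁; exact .app (.var n) (hd _ h₂)
  | .app (.lam t) s => by
    obtain ⟨d, hd⟩ := Term.exists_development s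
    obtain ⟨e, he⟩ := Term.exists_development t
    refine ⟨.es e d, fun _ h => ?_⟩
    cases h with
    | app h₁ h₂ => cases h₁ with | lam h₁ => exact .mult (he _ h₁) (hd _ h₂)
    | mult h₁ h₂ => exact .es (he _ h₁) (hd _ h₂)
  | .es t u => by
    obtain ⟨d, hd⟩ := Term.exists_development t
    obtain ⟨e, he⟩ := Term.exists_development u
    -- The exponential redex is fired exactly when the developed argument is an answer.
    by_cases hr : ∃ r, Graft d e r
    · obtain ⟨r, hr⟩ := hr
      refine ⟨r, fun _ h => ?_⟩
      cases h with
      | es h₁ h₂ => exact .expo (hd _ h₁) (he _ h₂) hr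
      | expo h₁ h₂ hg =>
        obtain ⟨r', hr', hp⟩ := hg.par (hd _ h₁) (he _ h₂)
        exact hr'.unique hr ▸ hp
    · refine ⟨.es d e, fun _ h => ?_⟩
      cases h with
      | es h₁ h₂ => exact .es (hd _ h₁) (he _ h₂)
      | expo h₁ h₂ hg =>
        obtain ⟨r', hr', _⟩ := hg.par (hd _ h₁) (he _ h₂)
        exact absurd ⟨r', hr'⟩ hr
end

/-- Reduction of terms is confluent. -/
theorem Term.confluent {t t₁ t₂ : Term} (h₁ : Relation.ReflTransGen Term.Step t t₁)
    (h₂ : Relation.ReflTransGen Term.Step t t₂) :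
    ∃ t₃, Relation.ReflTransGen Term.Step t₁ t₃ ∧ Relation.ReflTransGen Term.Step t₂ t₃ := by
  have key : ∀ {a b}, Relation.ReflTransGen Term.Step a b → Relation.ReflTransGen Term.Par a b :=
    fun h => Relation.ReflTransGen.mono (r := Term.Step) (p := Term.Par)
      (fun _ _ => Term.Step.par) _ _ h
  have back : ∀ {a b}, Relation.ReflTransGen Term.Par a b → Relation.ReflTransGen Term.Step a b :=
    fun h => by
      induction h with
      | refl => exact .refl
      | tail _ h ih => exact ih.trans h.steps
  obtain ⟨t₃, h₃, h₄⟩ := Relation.church_rosser (r := Term.Par) (fun a b c hb hc => by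
    obtain ⟨d, hd⟩ := a.exists_development
    exact ⟨d, .single (hd _ hb), .single (hd _ hc)⟩) (key h₁) (key h₂)
  exact ⟨t₃, back h₃, back h₄⟩

/-! ### Named terms -/

/-- Named terms: terms whose subterms carry the nodes of the net that they describe. The `m`-node
`m` of a value is the node on which it hangs, `x` is the `e`-node of a bound variable, `b` is the
root of the box of an abstraction and `s` is the root of the argument of an application. Values and
terms are the named terms that are sorted in the sense of `NTerm.Sorted`. -/
inductive NTerm (E M : Type) : Type
  | var (m : M) (x : ENode E)
  | lam (m : M) (x b : E) (t : NTerm E M)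
  | val (v : NTerm E M)
  | app (s : E) (v u : NTerm E M)
  | es (x : E) (t u : NTerm E M)

/-- The action of node maps on a link together with its boxes. -/
def relabel {E M E' M' : Type} (f : E → E') (g : M → M') (l : Set M × Link E M) :
    Set M' × Link E' M' :=
  (g '' l.1, l.2.map (ENode.map f) g)

variable {E M E' M' : Type}

namespace NTerm

/-- `Sorted true` selects the values, `Sorted false` the terms. -/
def Sorted : Bool → NTerm E M → Prop
  | true, var _ _ => True
  | true, lam _ _ _ t => t.Sorted false
  | false, val v => v.Sorted true
  | false, app _ v u => v.Sorted true ∧ u.Sorted false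
  | false, es _ t u => t.Sorted false ∧ u.Sorted false
  | _, _ => False

/-- The `m`-node on which a value hangs (the other cases are never used). -/
def lab : NTerm E M → M
  | var m _ => m
  | lam m _ _ _ => m
  | val v => v.lab
  | app _ v _ => v.lab
  | es _ t _ => t.lab

/-- The links of a named term of root `r` inside the boxes `S`, without the weakenings. -/
def core (S : Set M) (r : E) : NTerm E M → Set (Set M × Link E M)
  | var m x => {(S, .der m x)}
  | lam m x b t => {(S, .par m (.node x) (.node b))} ∪ core (insert m S) b t
  | val v => {(S, .bang (.node r) v.lab)} ∪ core S r v
  | app s v u => {(S, .tens (.node r) v.lab (.node s))} ∪ core S r v ∪ core S s u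
  | es x t u => core S r t ∪ core S x u

/-- The bound variables, each with the boxes in which it would be weakened. -/
def homes (S : Set M) : NTerm E M → Set (Set M × ENode E)
  | var _ _ => ∅
  | lam m x _ t => {(insert m S, .node x)} ∪ homes (insert m S) t
  | val v => homes S v
  | app _ v u => homes S v ∪ homes S u
  | es x t u => {(S, .node x)} ∪ homes S t ∪ homes S u

/-- The variables that occur, free or bound. -/
def occ : NTerm E M → Set (ENode E)
  | var _ x => {x}
  | lam _ _ _ t => occ t
  | val v => occ v
  | app _ v u => occ v ∪ occ u
  | es _ t u => occ t ∪ occ u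

/-- The bound variables. -/
def vars : NTerm E M → Multiset E
  | var _ _ => 0
  | lam _ x _ t => x ::ₘ vars t
  | val v => vars v
  | app _ v u => vars v + vars u
  | es x t u => x ::ₘ (vars t + vars u)

/-- The `e`-nodes that are roots of a box or of an argument. -/
def roots : NTerm E M → Multiset E
  | var _ _ => 0
  | lam _ _ b t => b ::ₘ roots t
  | val v => roots v
  | app s v u => s ::ₘ (roots v + roots u)
  | es _ t u => roots t + roots u

/-- The `e`-nodes introduced by a named term, all but its root and its free variables. -/
def nodes (A : NTerm E M) : Multiset E := A.vars + A.roots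

/-- The `m`-nodes. -/
def labels : NTerm E M → Multiset M
  | var m _ => {m}
  | lam m _ _ t => m ::ₘ labels t
  | val v => labels v
  | app _ v u => labels v + labels u
  | es _ t u => labels t + labels u

/-- All variables are bound or belong to `P`. -/
def Closed (P : Set (ENode E)) : NTerm E M → Prop
  | var _ x => x ∈ P
  | lam _ x _ t => t.Closed (insert (.node x) P)
  | val v => v.Closed P
  | app _ v u => v.Closed P ∧ u.Closed P
  | es x t u => t.Closed (insert (.node x) P) ∧ u.Closed P

/-- Relabelling of the nodes. -/
def map (f : E → E') (g : M → M') : NTerm E M → NTerm E' M'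
  | var m x => var (g m) (x.map f)
  | lam m x b t => lam (g m) (f x) (f b) (map f g t)
  | val v => val (map f g v)
  | app s v u => app (f s) (map f g v) (map f g u)
  | es x t u => es (f x) (map f g t) (map f g u)

theorem lab_map (f : E → E') (g : M → M') (A : NTerm E M) : (A.map f g).lab = g A.lab := by
  induction A <;> simp_all [map, lab]

/-- The links of a relabelled named term; the relabelling need not be injective. -/
theorem core_map (f : E → E') (g : M → M') (A : NTerm E M) :
    ∀ S r, core (g '' S) (f r) (A.map f g) = relabel f g '' core S r A := by
  induction A with
  | var m x => intro S r; simp [map, core, relabel, Link.map]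
  | lam m x b t ih =>
    intro S r
    simp only [map, core, Set.image_union, Set.image_singleton, ← ih, Set.image_insert_eq]
    simp [relabel, Link.map, ENode.map]
  | val v ih =>
    intro S r
    simp only [map, core, Set.image_union, Set.image_singleton, ← ih, lab_map]
    simp [relabel, Link.map, ENode.map]
  | app s v u ih₁ ih₂ =>
    intro S r
    simp only [map, core, Set.image_union, Set.image_singleton, ← ih₁, ← ih₂, lab_map]
    simp [relabel, Link.map, ENode.map]
  | es x t u ih₁ ih₂ =>
    intro S r
    simp only [map, core, Set.image_union, ← ih₁, ← ih₂]

theorem homes_map (f : E → E') (g : M → M') (A : NTerm E M) :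
    ∀ S, homes (g '' S) (A.map f g) = Prod.map (g '' ·) (ENode.map f) '' homes S A := by
  induction A with
  | var m x => intro S; simp [map, homes]
  | lam m x b t ih =>
    intro S
    simp only [map, homes, Set.image_union, Set.image_singleton, ← ih, Set.image_insert_eq]
    simp [ENode.map, Set.image_insert_eq]
  | val v ih => intro S; simp only [map, homes, ih]
  | app s v u ih₁ ih₂ => intro S; simp only [map, homes, Set.image_union, ← ih₁, ← ih₂]
  | es x t u ih₁ ih₂ =>
    intro S
    simp only [map, homes, Set.image_union, Set.image_singleton, ← ih₁, ← ih₂]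
    simp [ENode.map]

theorem occ_map (f : E → E') (g : M → M') (A : NTerm E M) :
    (A.map f g).occ = ENode.map f '' A.occ := by
  induction A <;> simp_all [map, occ, Set.image_union]

theorem vars_map (f : E → E') (g : M → M') (A : NTerm E M) :
    (A.map f g).vars = A.vars.map f := by
  induction A <;> simp_all [map, vars]

theorem roots_map (f : E → E') (g : M → M') (A : NTerm E M) :
    (A.map f g).roots = A.roots.map f := by
  induction A <;> simp_all [map, roots]

theorem nodes_map (f : E → E') (g : M → M') (A : NTerm E M) :
    (A.map f g).nodes = A.nodes.map f := by
  simp [nodes, vars_map, roots_map]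

theorem labels_map (f : E → E') (g : M → M') (A : NTerm E M) :
    (A.map f g).labels = A.labels.map g := by
  induction A <;> simp_all [map, labels]

theorem sorted_map (f : E → E') (g : M → M') (A : NTerm E M) :
    ∀ b, (A.map f g).Sorted b ↔ A.Sorted b := by
  induction A <;> intro b <;> cases b <;> simp_all [map, Sorted]

theorem Closed.mono {A : NTerm E M} : ∀ {P Q : Set (ENode E)}, A.Closed P → P ⊆ Q → A.Closed Q := by
  induction A with
  | var m x => intro P Q h hPQ; exact hPQ h
  | lam m x b t ih => intro P Q h hPQ; exact ih h (Set.insert_subset_insert hPQ)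
  | val v ih => intro P Q h hPQ; exact ih h hPQ
  | app s v u ih₁ ih₂ => intro P Q h hPQ; exact ⟨ih₁ h.1 hPQ, ih₂ h.2 hPQ⟩
  | es x t u ih₁ ih₂ =>
    intro P Q h hPQ; exact ⟨ih₁ h.1 (Set.insert_subset_insert hPQ), ih₂ h.2 hPQ⟩

theorem Closed.map {A : NTerm E M} (f : E → E') (g : M → M') :
    ∀ {P : Set (ENode E)}, A.Closed P → (A.map f g).Closed (ENode.map f '' P) := by
  induction A with
  | var m x => intro P h; exact ⟨_, h, rfl⟩
  | lam m x b t ih => intro P h; have := ih h; rwa [Set.image_insert_eq] at this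
  | val v ih => intro P h; exact ih h
  | app s v u ih₁ ih₂ => intro P h; exact ⟨ih₁ h.1, ih₂ h.2⟩
  | es x t u ih₁ ih₂ =>
    intro P h; have := ih₁ h.1; rw [Set.image_insert_eq] at this; exact ⟨this, ih₂ h.2⟩

theorem Closed.occ_subset {A : NTerm E M} :
    ∀ {P : Set (ENode E)}, A.Closed P → ∀ y ∈ A.occ, y ∈ P ∨ ∃ e ∈ A.vars, y = .node e := by
  induction A with
  | var m x => rintro P h y rfl; exact .inl h
  | lam m x b t ih =>
    intro P h y hy
    rcases ih h y hy with (rfl | h) | ⟨e, he, rfl⟩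
    · exact .inr ⟨x, by simp [vars], rfl⟩
    · exact .inl h
    · exact .inr ⟨e, by simp [vars, he], rfl⟩
  | val v ih => intro P h y hy; exact ih h y hy
  | app s v u ih₁ ih₂ =>
    rintro P h y (hy | hy)
    · rcases ih₁ h.1 y hy with h | ⟨e, he, rfl⟩
      · exact .inl h
      · exact .inr ⟨e, by simp [vars, he], rfl⟩
    · rcases ih₂ h.2 y hy with h | ⟨e, he, rfl⟩
      · exact .inl h
      · exact .inr ⟨e, by simp [vars, he], rfl⟩
  | es x t u ih₁ ih₂ =>
    rintro P h y (hy | hy)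
    · rcases ih₁ h.1 y hy with (rfl | h) | ⟨e, he, rfl⟩
      · exact .inr ⟨x, by simp [vars], rfl⟩
      · exact .inl h
      · exact .inr ⟨e, by simp [vars, he], rfl⟩
    · rcases ih₂ h.2 y hy with h | ⟨e, he, rfl⟩
      · exact .inl h
      · exact .inr ⟨e, by simp [vars, he], rfl⟩

/-! ### The links of a named term -/

/-- Enclosing a named term in further boxes. -/
theorem core_union (S : Set M) (A : NTerm E M) :
    ∀ T r, core (S ∪ T) r A = (fun l => (S ∪ l.1, l.2)) '' core T r A := by
  induction A with
  | var m x => intro T r; simp [core]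
  | lam m x b t ih =>
    intro T r
    simp only [core, Set.image_union, Set.image_singleton, ← ih, Set.union_insert]
  | val v ih => intro T r; simp only [core, Set.image_union, Set.image_singleton, ← ih]
  | app s v u ih₁ ih₂ =>
    intro T r; simp only [core, Set.image_union, Set.image_singleton, ← ih₁, ← ih₂]
  | es x t u ih₁ ih₂ => intro T r; simp only [core, Set.image_union, ← ih₁, ← ih₂]

theorem homes_union (S : Set M) (A : NTerm E M) :
    ∀ T, homes (S ∪ T) A = (fun l => (S ∪ l.1, l.2)) '' homes T A := by
  induction A with
  | var m x => intro T; simp [homes]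
  | lam m x b t ih =>
    intro T
    simp only [homes, Set.image_union, Set.image_singleton, ← ih, Set.union_insert]
  | val v ih => intro T; simp only [homes, ← ih]
  | app s v u ih₁ ih₂ => intro T; simp only [homes, Set.image_union, ← ih₁, ← ih₂]
  | es x t u ih₁ ih₂ =>
    intro T; simp only [homes, Set.image_union, Set.image_singleton, ← ih₁, ← ih₂]

theorem boxes_of_mem_core {A : NTerm E M} :
    ∀ {S r l}, l ∈ core S r A → ∀ m ∈ l.1, m ∈ S ∨ m ∈ A.labels := by
  induction A with
  | var m x => rintro S r l rfl m hm; exact .inl hm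
  | lam m x b t ih =>
    rintro S r l (rfl | hl) k hk
    · exact .inl hk
    · rcases ih hl k hk with (rfl | h) | h <;> simp [labels, *]
  | val v ih =>
    rintro S r l (rfl | hl) k hk
    · exact .inl hk
    · exact ih hl k hk
  | app s v u ih₁ ih₂ =>
    rintro S r l ((rfl | hl) | hl) k hk
    · exact .inl hk
    · rcases ih₁ hl k hk with h | h <;> simp [labels, *]
    · rcases ih₂ hl k hk with h | h <;> simp [labels, *]
  | es x t u ih₁ ih₂ =>
    rintro S r l (hl | hl) k hk
    · rcases ih₁ hl k hk with h | h <;> simp [labels, *]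
    · rcases ih₂ hl k hk with h | h <;> simp [labels, *]

theorem boxes_of_mem_homes {A : NTerm E M} :
    ∀ {S p}, p ∈ homes S A → ∀ m ∈ p.1, m ∈ S ∨ m ∈ A.labels := by
  induction A with
  | var m x => rintro S p ⟨⟩
  | lam m x b t ih =>
    rintro S l (rfl | hl) k hk
    · rcases hk with rfl | hk <;> simp [labels, *]
    · rcases ih hl k hk with (rfl | h) | h <;> simp [labels, *]
  | val v ih => intro S l hl k hk; exact ih hl k hk
  | app s v u ih₁ ih₂ =>
    rintro S l (hl | hl) k hk
    · rcases ih₁ hl k hk with h | h <;> simp [labels, *]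
    · rcases ih₂ hl k hk with h | h <;> simp [labels, *]
  | es x t u ih₁ ih₂ =>
    rintro S l ((rfl | hl) | hl) k hk
    · exact .inl hk
    · rcases ih₁ hl k hk with h | h <;> simp [labels, *]
    · rcases ih₂ hl k hk with h | h <;> simp [labels, *]

theorem vars_of_mem_homes {A : NTerm E M} :
    ∀ {S p}, p ∈ homes S A → ∃ e ∈ A.vars, p.2 = .node e := by
  induction A with
  | var m x => rintro S p ⟨⟩
  | lam m x b t ih =>
    rintro S l (rfl | hl)
    · exact ⟨x, by simp [vars], rfl⟩
    · obtain ⟨e, he, h⟩ := ih hl; exact ⟨e, by simp [vars, he], h⟩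
  | val v ih => intro S l hl; exact ih hl
  | app s v u ih₁ ih₂ =>
    rintro S l (hl | hl)
    · obtain ⟨e, he, h⟩ := ih₁ hl; exact ⟨e, by simp [vars, he], h⟩
    · obtain ⟨e, he, h⟩ := ih₂ hl; exact ⟨e, by simp [vars, he], h⟩
  | es x t u ih₁ ih₂ =>
    rintro S l ((rfl | hl) | hl)
    · exact ⟨x, by simp [vars], rfl⟩
    · obtain ⟨e, he, h⟩ := ih₁ hl; exact ⟨e, by simp [vars, he], h⟩
    · obtain ⟨e, he, h⟩ := ih₂ hl; exact ⟨e, by simp [vars, he], h⟩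

theorem exists_mem_homes {A : NTerm E M} {e : E} :
    ∀ (S), e ∈ A.vars → ∃ T, (T, .node e) ∈ homes S A := by
  induction A with
  | var m x => intro S h; simp [vars] at h
  | lam m x b t ih =>
    intro S h
    rcases Multiset.mem_cons.1 h with rfl | h
    · exact ⟨_, .inl rfl⟩
    · obtain ⟨T, hT⟩ := ih (insert m S) h; exact ⟨T, .inr hT⟩
  | val v ih => exact fun S h => ih S h
  | app s v u ih₁ ih₂ =>
    intro S h
    rcases Multiset.mem_add.1 h with h | h
    · obtain ⟨T, hT⟩ := ih₁ S h; exact ⟨T, .inl hT⟩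
    · obtain ⟨T, hT⟩ := ih₂ S h; exact ⟨T, .inr hT⟩
  | es x t u ih₁ ih₂ =>
    intro S h
    rcases Multiset.mem_cons.1 h with rfl | h
    · exact ⟨_, .inl (.inl rfl)⟩
    rcases Multiset.mem_add.1 h with h | h
    · obtain ⟨T, hT⟩ := ih₁ S h; exact ⟨T, .inl (.inr hT)⟩
    · obtain ⟨T, hT⟩ := ih₂ S h; exact ⟨T, .inr hT⟩

theorem labels_of_mem_core {A : NTerm E M} :
    ∀ {S r l}, l ∈ core S r A → ∀ m ∈ l.2.mSources, m ∈ A.labels := by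
  induction A with
  | var m x => rintro S r l rfl k rfl; simp [labels]
  | lam m x b t ih =>
    rintro S r l (rfl | hl) k hk
    · rcases hk with rfl; simp [labels]
    · simp [labels, ih hl k hk]
  | val v ih =>
    rintro S r l (rfl | hl) k hk
    · cases hk
    · exact ih hl k hk
  | app s v u ih₁ ih₂ =>
    rintro S r l ((rfl | hl) | hl) k hk
    · cases hk
    · simp [labels, ih₁ hl k hk]
    · simp [labels, ih₂ hl k hk]
  | es x t u ih₁ ih₂ =>
    rintro S r l (hl | hl) k hk
    · simp [labels, ih₁ hl k hk]
    · simp [labels, ih₂ hl k hk]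

/-- The links of a named term other than its weakenings are determined by the `m`-node that is
their source, if any. -/
theorem core_unique {A : NTerm E M} (hA : A.labels.Nodup) :
    ∀ {S r l l'} {m : M}, l ∈ core S r A → l' ∈ core S r A → m ∈ l.2.mSources →
      m ∈ l'.2.mSources → l = l' := by
  induction A with
  | var m x => rintro S r l l' m rfl rfl _ _; rfl
  | lam m x b t ih =>
    simp only [labels, Multiset.nodup_cons] at hA
    rintro S r l l' k (rfl | hl) (rfl | hl') hk hk'
    · rfl
    · rcases hk with rfl; exact absurd (labels_of_mem_core hl' _ hk') hA.1
    · rcases hk' with rfl; exact absurd (labels_of_mem_core hl _ hk) hA.1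
    · exact ih hA.2 hl hl' hk hk'
  | val v ih =>
    rintro S r l l' k (rfl | hl) (rfl | hl') hk hk'
    · rfl
    · cases hk
    · cases hk'
    · exact ih hA hl hl' hk hk'
  | app s v u ih₁ ih₂ =>
    simp only [labels, Multiset.nodup_add, Multiset.disjoint_left] at hA
    rintro S r l l' k ((rfl | hl) | hl) ((rfl | hl') | hl') hk hk'
    · rfl
    · cases hk
    · cases hk
    · cases hk'
    · exact ih₁ hA.1 hl hl' hk hk'
    · exact absurd (labels_of_mem_core hl' _ hk') (hA.2.2 (labels_of_mem_core hl _ hk))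
    · cases hk'
    · exact absurd (labels_of_mem_core hl _ hk) (hA.2.2 (labels_of_mem_core hl' _ hk'))
    · exact ih₂ hA.2.1 hl hl' hk hk'
  | es x t u ih₁ ih₂ =>
    simp only [labels, Multiset.nodup_add, Multiset.disjoint_left] at hA
    rintro S r l l' k (hl | hl) (hl' | hl') hk hk'
    · exact ih₁ hA.1 hl hl' hk hk'
    · exact absurd (labels_of_mem_core hl' _ hk') (hA.2.2 (labels_of_mem_core hl _ hk))
    · exact absurd (labels_of_mem_core hl _ hk) (hA.2.2 (labels_of_mem_core hl' _ hk'))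
    · exact ih₂ hA.2.1 hl hl' hk hk'

/-- A variable occurs when it is the target of a dereliction; this is why the weakened variables
are exactly those that do not occur. -/
theorem mem_occ {A : NTerm E M} {y : ENode E} :
    ∀ {S r}, y ∈ A.occ ↔ ∃ T i, (T, Link.der i y) ∈ core S r A := by
  induction A with
  | var m x => intro S r; simp [occ, core]
  | lam m x b t ih => intro S r; simp [occ, core, ih (S := insert m S) (r := b)]
  | val v ih => intro S r; simp [occ, core, ih (S := S) (r := r)]
  | app s v u ih₁ ih₂ =>
    intro S r; simp [occ, core, ih₁ (S := S) (r := r), ih₂ (S := S) (r := s), exists_or]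
  | es x t u ih₁ ih₂ =>
    intro S r; simp [occ, core, ih₁ (S := S) (r := r), ih₂ (S := S) (r := x), exists_or]

theorem not_weak_mem_core {A : NTerm E M} {T : Set M} {y : ENode E} :
    ∀ {S r}, (T, Link.weak y) ∉ core S r A := by
  induction A <;> simp_all [core]

/-- Apart from derelictions, the links end on the roots of boxes and of arguments of applications,
which are never bound variables. -/
theorem roots_of_mem_core {A : NTerm E M} :
    ∀ {S r l}, l ∈ core S r A → ∀ y ∈ l.2.eTargets,
      (∃ i, l.2 = .der i y) ∨ ∃ e ∈ A.roots, y = .node e := by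
  induction A with
  | var m x => rintro S r l rfl y rfl; exact .inl ⟨m, rfl⟩
  | lam m x b t ih =>
    rintro S r l (rfl | hl) y hy
    · exact .inr ⟨b, by simp [roots], hy⟩
    · rcases ih hl y hy with h | ⟨e, he, h⟩
      · exact .inl h
      · exact .inr ⟨e, by simp [roots, he], h⟩
  | val v ih =>
    rintro S r l (rfl | hl) y hy
    · cases hy
    · exact ih hl y hy
  | app s v u ih₁ ih₂ =>
    rintro S r l ((rfl | hl) | hl) y hy
    · exact .inr ⟨s, by simp [roots], hy⟩
    · rcases ih₁ hl y hy with h | ⟨e, he, h⟩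
      · exact .inl h
      · exact .inr ⟨e, by simp [roots, he], h⟩
    · rcases ih₂ hl y hy with h | ⟨e, he, h⟩
      · exact .inl h
      · exact .inr ⟨e, by simp [roots, he], h⟩
  | es x t u ih₁ ih₂ =>
    rintro S r l (hl | hl) y hy
    · rcases ih₁ hl y hy with h | ⟨e, he, h⟩
      · exact .inl h
      · exact .inr ⟨e, by simp [roots, he], h⟩
    · rcases ih₂ hl y hy with h | ⟨e, he, h⟩
      · exact .inl h
      · exact .inr ⟨e, by simp [roots, he], h⟩

/-- The `e`-nodes that are sources of links: the root, whose link lies outside of all boxes of the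
term and is not a `par`-link, and the nodes introduced by the term. -/
theorem source_of_mem_core {A : NTerm E M} :
    ∀ {b S r l}, A.Sorted b → l ∈ core S r A → ∀ y ∈ l.2.eSources,
      (b = false ∧ y = .node r ∧ l.1 = S ∧ ∀ a x c, l.2 ≠ .par a x c) ∨
        ∃ e ∈ A.nodes, y = .node e := by
  induction A with
  | var m x => rintro b S r l - rfl y ⟨⟩
  | lam m x b t ih =>
    rintro ⟨⟩ S r l h (rfl | hl) y hy
    · cases h
    · cases h
    · exact .inr ⟨x, by simp [nodes, vars], hy⟩
    · rcases ih h hl y hy with h | ⟨e, he, h⟩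
      · exact .inr ⟨b, by simp [nodes, roots], h.2.1⟩
      · refine .inr ⟨e, ?_, h⟩
        simp only [nodes, vars, roots, Multiset.mem_add, Multiset.mem_cons] at he ⊢
        tauto
  | val v ih =>
    rintro ⟨⟩ S r l h (rfl | hl) y hy
    · exact .inl ⟨rfl, hy, rfl, fun _ _ _ h => by cases h⟩
    · rcases ih h hl y hy with h | h
      · cases h.1
      · exact .inr h
    · cases h
    · cases h
  | app s v u ih₁ ih₂ =>
    rintro ⟨⟩ S r l h hl y hy
    · rcases hl with (rfl | hl) | hl
      · exact .inl ⟨rfl, hy, rfl, fun _ _ _ h => by cases h⟩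
      · rcases ih₁ h.1 hl y hy with h | ⟨e, he, h⟩
        · cases h.1
        · refine .inr ⟨e, ?_, h⟩
          simp only [nodes, vars, roots, Multiset.mem_add, Multiset.mem_cons] at he ⊢
          tauto
      · rcases ih₂ h.2 hl y hy with h | ⟨e, he, h⟩
        · exact .inr ⟨s, by simp [nodes, roots], h.2.1⟩
        · refine .inr ⟨e, ?_, h⟩
          simp only [nodes, vars, roots, Multiset.mem_add, Multiset.mem_cons] at he ⊢
          tauto
    · cases h
  | es x t u ih₁ ih₂ =>
    rintro ⟨⟩ S r l h hl y hy
    · rcases hl with hl | hl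
      · rcases ih₁ h.1 hl y hy with h | ⟨e, he, h⟩
        · exact .inl h
        · refine .inr ⟨e, ?_, h⟩
          simp only [nodes, vars, roots, Multiset.mem_add, Multiset.mem_cons] at he ⊢
          tauto
      · rcases ih₂ h.2 hl y hy with h | ⟨e, he, h⟩
        · exact .inr ⟨x, by simp [nodes, vars], h.2.1⟩
        · refine .inr ⟨e, ?_, h⟩
          simp only [nodes, vars, roots, Multiset.mem_add, Multiset.mem_cons] at he ⊢
          tauto
    · cases h

theorem exists_root_source {A : NTerm E M} :
    ∀ {S r}, A.Sorted false → ∃ l ∈ core S r A, l.1 = S ∧ ENode.node r ∈ l.2.eSources := by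
  induction A with
  | var m x => intro S r h; cases h
  | lam m x b t ih => intro S r h; cases h
  | val v ih => intro S r h; exact ⟨_, .inl rfl, rfl, rfl⟩
  | app s v u ih₁ ih₂ => intro S r h; exact ⟨_, .inl (.inl rfl), rfl, rfl⟩
  | es x t u ih₁ ih₂ =>
    intro S r h
    obtain ⟨l, hl, h⟩ := ih₁ (S := S) (r := r) h.1
    exact ⟨l, .inl hl, h⟩

/-- Every introduced node is a source; so it is a node of the net, and it is private to the value
that introduces it. -/
theorem exists_source {A : NTerm E M} {e : E} (he : e ∈ A.nodes) :
    ∀ {b S r}, A.Sorted b → ∃ l ∈ core S r A, ENode.node e ∈ l.2.eSources := by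
  induction A with
  | var m x => simp [nodes, vars, roots] at he
  | lam m x b t ih =>
    rintro ⟨⟩ S r h
    · cases h
    have : e = x ∨ e = b ∨ e ∈ t.nodes := by
      simp only [nodes, vars, roots, Multiset.mem_add, Multiset.mem_cons] at he ⊢; tauto
    rcases this with rfl | rfl | he
    · exact ⟨_, .inl rfl, rfl⟩
    · obtain ⟨l, hl, -, h⟩ := exists_root_source (S := insert m S) (r := e) h
      exact ⟨l, .inr hl, h⟩
    · obtain ⟨l, hl, h⟩ := ih he (S := insert m S) (r := b) h
      exact ⟨l, .inr hl, h⟩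
  | val v ih =>
    rintro ⟨⟩ S r h
    · obtain ⟨l, hl, h⟩ := ih he (S := S) (r := r) h
      exact ⟨l, .inr hl, h⟩
    · cases h
  | app s v u ih₁ ih₂ =>
    rintro ⟨⟩ S r h
    · have : e = s ∨ e ∈ v.nodes ∨ e ∈ u.nodes := by
        simp only [nodes, vars, roots, Multiset.mem_add, Multiset.mem_cons] at he ⊢; tauto
      rcases this with rfl | he | he
      · obtain ⟨l, hl, -, h⟩ := exists_root_source (S := S) (r := e) h.2
        exact ⟨l, .inr hl, h⟩
      · obtain ⟨l, hl, h⟩ := ih₁ he (S := S) (r := r) h.1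
        exact ⟨l, .inl (.inr hl), h⟩
      · obtain ⟨l, hl, h⟩ := ih₂ he (S := S) (r := s) h.2
        exact ⟨l, .inr hl, h⟩
    · cases h
  | es x t u ih₁ ih₂ =>
    rintro ⟨⟩ S r h
    · have : e = x ∨ e ∈ t.nodes ∨ e ∈ u.nodes := by
        simp only [nodes, vars, roots, Multiset.mem_add, Multiset.mem_cons] at he ⊢; tauto
      rcases this with rfl | he | he
      · obtain ⟨l, hl, -, h⟩ := exists_root_source (S := S) (r := e) h.2
        exact ⟨l, .inr hl, h⟩
      · obtain ⟨l, hl, h⟩ := ih₁ he (S := S) (r := r) h.1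
        exact ⟨l, .inl hl, h⟩
      · obtain ⟨l, hl, h⟩ := ih₂ he (S := S) (r := x) h.2
        exact ⟨l, .inr hl, h⟩
    · cases h

end NTerm

/-- The boxes around an `e`-node, computed from a set of links: those of `Net.boxesAround`. -/
def around (K : Set (Set M × Link E M)) (y : ENode E) : Set M :=
  {a | ∃ l ∈ K, (a ∈ l.1 ∧ y ∈ l.2.eSources) ∨ ∃ b, l.2 = .par a y b}

theorem around_union (K L : Set (Set M × Link E M)) (y : ENode E) :
    around (K ∪ L) y = around K y ∪ around L y := by
  ext a
  simp only [around, Set.mem_union, or_and_right, exists_or, Set.mem_ofPred_eq]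

theorem around_eq_empty {K : Set (Set M × Link E M)} {y : ENode E}
    (h : ∀ l ∈ K, y ∉ l.2.eSources) : around K y = ∅ := by
  ext a
  simp only [around, Set.mem_ofPred_eq, Set.mem_empty_iff_false, iff_false]
  rintro ⟨l, hl, ⟨-, h'⟩ | ⟨b, h'⟩⟩
  · exact h l hl h'
  · refine h l hl ?_
    rw [h']; rfl

namespace NTerm

theorem not_source {A : NTerm E M} {b S r} {e : E} (hA : A.Sorted b) (he : e ∉ A.nodes)
    (hr : b = false → e ≠ r) : ∀ l ∈ core S r A, ENode.node e ∉ l.2.eSources := by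
  intro l hl h
  rcases source_of_mem_core hA hl _ h with ⟨hb, h, -⟩ | ⟨e', he', h⟩
  · exact hr hb (by injection h)
  · injection h with h; exact he (h ▸ he')

theorem around_root {A : NTerm E M} {S r} (hA : A.Sorted false) (he : r ∉ A.nodes) :
    around (core S r A) (.node r) = S := by
  ext a
  constructor
  · rintro ⟨l, hl, h⟩
    have hr : ENode.node r ∈ l.2.eSources := by
      rcases h with h | ⟨b, h⟩
      · exact h.2
      · rw [h]; rfl
    rcases source_of_mem_core hA hl _ hr with ⟨-, -, h1, h2⟩ | ⟨e', he', h'⟩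
    · rcases h with h | ⟨b, h⟩
      · exact h1 ▸ h.1
      · exact absurd h (h2 _ _ _)
    · injection h' with h'; exact absurd (h' ▸ he') he
  · intro ha
    obtain ⟨l, hl, h1, h2⟩ := exists_root_source (S := S) (r := r) hA
    exact ⟨l, hl, .inl ⟨h1 ▸ ha, h2⟩⟩

/-- The links of a named term determine where each of its variables is weakened. -/
theorem around_of_mem_homes {A : NTerm E M} :
    ∀ {b S r}, A.Sorted b → A.nodes.Nodup → (b = false → r ∉ A.nodes) →
      ∀ {T y}, (T, y) ∈ homes S A → around (core S r A) y = T := by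
  induction A with
  | var m x => rintro b S r - - - T y ⟨⟩
  | lam m x b t ih =>
    rintro ⟨⟩ S r h hn hr T y hy
    · cases h
    replace h : t.Sorted false := h
    have hn' : x ≠ b ∧ x ∉ t.nodes ∧ b ∉ t.nodes ∧ t.nodes.Nodup := by
      simp only [nodes, vars, roots, Multiset.cons_add, Multiset.add_cons, Multiset.nodup_cons,
        Multiset.mem_cons] at hn ⊢
      tauto
    rw [core, around_union]
    rcases hy with hy | hy
    · cases hy
      rw [around_eq_empty (not_source h hn'.2.1 fun _ => hn'.1), Set.union_empty]
      ext a
      simp only [around, Set.mem_singleton_iff, exists_eq_left, Link.eSources, Set.mem_ofPred_eq,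
        Link.par.injEq, Set.mem_insert_iff]
      simp [eq_comm, or_comm]
    · rw [ih h hn'.2.2.2 (fun _ => hn'.2.2.1) hy, around_eq_empty, Set.empty_union]
      rintro l rfl hl
      obtain ⟨e, he, h⟩ := vars_of_mem_homes hy
      have h2 := h.symm.trans hl
      injection h2 with h2
      exact hn'.2.1 (by simp [nodes, ← h2, he])
  | val v ih =>
    rintro ⟨⟩ S r h hn hr T y hy
    · rw [core, around_union, ih h hn (fun h => by cases h) hy, around_eq_empty, Set.empty_union]
      rintro l rfl hl
      obtain ⟨e, he, h⟩ := vars_of_mem_homes hy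
      have h2 := h.symm.trans hl
      injection h2 with h2
      exact hr rfl (Multiset.mem_add.2 (.inl (h2 ▸ he)))
    · cases h
  | app s v u ih₁ ih₂ =>
    rintro ⟨⟩ S r h hn hr T y hy
    · have hn' : v.nodes.Nodup ∧ u.nodes.Nodup ∧ s ∉ v.nodes ∧ s ∉ u.nodes ∧
          ∀ e ∈ v.nodes, e ∉ u.nodes := by
        have e : (app s v u).nodes = s ::ₘ (v.nodes + u.nodes) := by
          simp only [nodes, vars, roots, Multiset.add_cons]; congr 1; abel
        rw [e] at hn
        simp only [Multiset.nodup_cons, Multiset.nodup_add, Multiset.disjoint_left,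
          Multiset.mem_add, not_or] at hn
        tauto
      have hr' : r ≠ s ∧ r ∉ v.nodes ∧ r ∉ u.nodes := by
        have := hr rfl
        simp only [nodes, vars, roots, Multiset.mem_add, Multiset.mem_cons, not_or] at this ⊢
        tauto
      obtain ⟨e, he, h'⟩ : ∃ e, (e ∈ v.vars ∨ e ∈ u.vars) ∧ y = .node e := by
        rcases hy with hy | hy
        · obtain ⟨e, he, h⟩ := vars_of_mem_homes hy; exact ⟨e, .inl he, h⟩
        · obtain ⟨e, he, h⟩ := vars_of_mem_homes hy; exact ⟨e, .inr he, h⟩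
      subst h'
      have hvn : ∀ w : NTerm E M, e ∈ w.vars → e ∈ w.nodes := fun w hw =>
        Multiset.mem_add.2 (.inl hw)
      have h0 : around {(S, Link.tens (.node r) v.lab (.node s))} (.node e) = ∅ := by
        refine around_eq_empty ?_
        rintro l rfl hl
        injection hl with h2
        rcases he with he | he
        · exact hr'.2.1 (h2 ▸ hvn v he)
        · exact hr'.2.2 (h2 ▸ hvn u he)
      rw [core, around_union, around_union, h0]
      rcases hy with hy | hy
      · have he' := vars_of_mem_homes hy
        simp only [ENode.node.injEq, exists_eq_right'] at he'
        rw [ih₁ h.1 hn'.1 (fun h => by cases h) hy,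
          around_eq_empty (not_source h.2 (hn'.2.2.2.2 e (hvn v he')) fun _ (h : e = s) =>
            hn'.2.2.1 (h ▸ hvn v he'))]
        simp
      · have he' := vars_of_mem_homes hy
        simp only [ENode.node.injEq, exists_eq_right'] at he'
        rw [ih₂ h.2 hn'.2.1 (fun _ => hn'.2.2.2.1) hy,
          around_eq_empty (not_source h.1 (fun h => hn'.2.2.2.2 e h (hvn u he'))
            (fun h => by cases h))]
        simp
    · cases h
  | es x t u ih₁ ih₂ =>
    rintro ⟨⟩ S r h hn hr T y hy
    · have hn' : t.nodes.Nodup ∧ u.nodes.Nodup ∧ x ∉ t.nodes ∧ x ∉ u.nodes ∧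
          ∀ e ∈ t.nodes, e ∉ u.nodes := by
        have e : (es x t u).nodes = x ::ₘ (t.nodes + u.nodes) := by
          simp only [nodes, vars, roots, Multiset.cons_add]; congr 1; abel
        rw [e] at hn
        simp only [Multiset.nodup_cons, Multiset.nodup_add, Multiset.disjoint_left,
          Multiset.mem_add, not_or] at hn
        tauto
      have hr' : r ≠ x ∧ r ∉ t.nodes ∧ r ∉ u.nodes := by
        have := hr rfl
        simp only [nodes, vars, roots, Multiset.mem_add, Multiset.mem_cons, not_or] at this ⊢
        tauto
      have hvn : ∀ (w : NTerm E M) e, e ∈ w.vars → e ∈ w.nodes := fun w e hw =>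
        Multiset.mem_add.2 (.inl hw)
      rw [core, around_union]
      rcases hy with (hy | hy) | hy
      · cases hy
        rw [around_root h.2 hn'.2.2.2.1,
          around_eq_empty (not_source h.1 hn'.2.2.1 fun _ => hr'.1.symm), Set.empty_union]
      · obtain ⟨e, he, h'⟩ := vars_of_mem_homes hy
        cases h'
        rw [ih₁ h.1 hn'.1 (fun _ => hr'.2.1) hy,
          around_eq_empty (not_source h.2 (hn'.2.2.2.2 e (hvn t e he)) fun _ (h : e = x) =>
            hn'.2.2.1 (h ▸ hvn t e he)), Set.union_empty]
      · obtain ⟨e, he, h'⟩ := vars_of_mem_homes hy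
        cases h'
        rw [ih₂ h.2 hn'.2.1 (fun _ => hn'.2.2.2.1) hy,
          around_eq_empty (not_source h.1 (fun h => hn'.2.2.2.2 e h (hvn u e he))
            fun _ (h : e = r) => hr'.2.2 (h ▸ hvn u e he)), Set.empty_union]
    · cases h

theorem nodes_lam (m : M) (x b : E) (t : NTerm E M) :
    (lam m x b t).nodes = x ::ₘ b ::ₘ t.nodes := by
  simp only [nodes, vars, roots, Multiset.add_cons, Multiset.cons_add]
  rw [Multiset.cons_swap]

theorem nodes_val (v : NTerm E M) : (val v).nodes = v.nodes := rfl

theorem nodes_app (s : E) (v u : NTerm E M) :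
    (app s v u).nodes = s ::ₘ (v.nodes + u.nodes) := by
  simp only [nodes, vars, roots, Multiset.add_cons]; congr 1; abel

theorem nodes_es (x : E) (t u : NTerm E M) :
    (es x t u).nodes = x ::ₘ (t.nodes + u.nodes) := by
  simp only [nodes, vars, roots, Multiset.cons_add]; congr 1; abel

theorem lab_mem_labels {v : NTerm E M} (h : v.Sorted true) : v.lab ∈ v.labels := by
  cases v <;> simp_all [Sorted, lab, labels]

/-- The links of a value are its upper link and the links of its box. -/
theorem mem_body_of_mem_core {v : NTerm E M} (hv : v.Sorted true) {S r l} (hl : l ∈ core S r v) :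
    v.lab ∈ l.2.mSources ∨ v.lab ∈ l.1 := by
  cases v with
  | var m x => cases hl; exact .inl rfl
  | lam m x b t =>
    rcases hl with rfl | hl
    · exact .inl rfl
    · rw [← Set.union_empty (insert m S), core_union] at hl
      obtain ⟨l, _, rfl⟩ := hl
      exact .inr (.inl (.inl rfl))
  | _ => cases hv

/-- The variables bound in a value are weakened inside its box. -/
theorem lab_mem_of_mem_homes {v : NTerm E M} (hv : v.Sorted true) {S p} (hp : p ∈ homes S v) :
    v.lab ∈ p.1 := by
  cases v with
  | var m x => cases hp
  | lam m x b t =>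
    rcases hp with rfl | hp
    · exact .inl rfl
    · rw [← Set.union_empty (insert m S), homes_union] at hp
      obtain ⟨l, _, rfl⟩ := hp
      exact .inl (.inl rfl)
  | _ => cases hv

/-- The links of a value do not depend on the root. -/
theorem core_value {v : NTerm E M} (hv : v.Sorted true) (S : Set M) (r r' : E) :
    core S r v = core S r' v := by
  cases v <;> first | rfl | cases hv

end NTerm

/-! ### Contexts -/

/-- One-hole contexts of named terms, with the hole in the position of a term. -/
inductive Ctx (E M : Type) : Type
  | hole
  | lam (m : M) (x b : E) (C : Ctx E M)
  | appFun (s : E) (m : M) (x b : E) (C : Ctx E M) (u : NTerm E M)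
  | appArg (s : E) (v : NTerm E M) (C : Ctx E M)
  | esBody (x : E) (C : Ctx E M) (u : NTerm E M)
  | esArg (x : E) (t : NTerm E M) (C : Ctx E M)

namespace Ctx

/-- The named term obtained by filling the hole. -/
def fill : Ctx E M → NTerm E M → NTerm E M
  | hole, A => A
  | lam m x b C, A => .val (.lam m x b (C.fill A))
  | appFun s m x b C u, A => .app s (.lam m x b (C.fill A)) u
  | appArg s v C, A => .app s v (C.fill A)
  | esBody x C u, A => .es x (C.fill A) u
  | esArg x t C, A => .es x t (C.fill A)

/-- The boxes around the hole. -/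
def boxes (S : Set M) : Ctx E M → Set M
  | hole => S
  | lam m _ _ C => C.boxes (insert m S)
  | appFun _ m _ _ C _ => C.boxes (insert m S)
  | appArg _ _ C => C.boxes S
  | esBody _ C _ => C.boxes S
  | esArg _ _ C => C.boxes S

/-- The root of the hole. -/
def root (r : E) : Ctx E M → E
  | hole => r
  | lam _ _ b C => C.root b
  | appFun _ _ _ b C _ => C.root b
  | appArg s _ C => C.root s
  | esBody _ C _ => C.root r
  | esArg x _ C => C.root x

/-- The links of a context. -/
def core (S : Set M) (r : E) : Ctx E M → Set (Set M × Link E M)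
  | hole => ∅
  | lam m x b C => {(S, .bang (.node r) m)} ∪
      ({(S, .par m (.node x) (.node b))} ∪ C.core (insert m S) b)
  | appFun s m x b C u => {(S, .tens (.node r) m (.node s))} ∪
      ({(S, .par m (.node x) (.node b))} ∪ C.core (insert m S) b) ∪ u.core S s
  | appArg s v C => {(S, .tens (.node r) v.lab (.node s))} ∪ v.core S r ∪ C.core S s
  | esBody x C u => C.core S r ∪ u.core S x
  | esArg x t C => t.core S r ∪ C.core S x

/-- The bound variables of a context, with their boxes. -/
def homes (S : Set M) : Ctx E M → Set (Set M × ENode E)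
  | hole => ∅
  | lam m x _ C => {(insert m S, .node x)} ∪ C.homes (insert m S)
  | appFun _ m x _ C u => {(insert m S, .node x)} ∪ C.homes (insert m S) ∪ u.homes S
  | appArg _ v C => v.homes S ∪ C.homes S
  | esBody x C u => {(S, .node x)} ∪ C.homes S ∪ u.homes S
  | esArg x t C => {(S, .node x)} ∪ t.homes S ∪ C.homes S

/-- The variables that occur in a context. -/
def occ : Ctx E M → Set (ENode E)
  | hole => ∅
  | lam _ _ _ C => C.occ
  | appFun _ _ _ _ C u => C.occ ∪ u.occ
  | appArg _ v C => v.occ ∪ C.occ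
  | esBody _ C u => C.occ ∪ u.occ
  | esArg _ t C => t.occ ∪ C.occ

/-- The variables bound by a context, above the hole or not. -/
def vars : Ctx E M → Multiset E
  | hole => 0
  | lam _ x _ C => x ::ₘ C.vars
  | appFun _ _ x _ C u => x ::ₘ (C.vars + u.vars)
  | appArg _ v C => v.vars + C.vars
  | esBody x C u => x ::ₘ (C.vars + u.vars)
  | esArg x t C => x ::ₘ (t.vars + C.vars)

/-- The roots of the boxes and of the arguments of a context. -/
def roots : Ctx E M → Multiset E
  | hole => 0
  | lam _ _ b C => b ::ₘ C.roots
  | appFun s _ _ b C u => s ::ₘ b ::ₘ (C.roots + u.roots)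
  | appArg s v C => s ::ₘ (v.roots + C.roots)
  | esBody _ C u => C.roots + u.roots
  | esArg _ t C => t.roots + C.roots

/-- The `e`-nodes introduced by a context. -/
def nodes (C : Ctx E M) : Multiset E := C.vars + C.roots

/-- The `m`-nodes of a context. -/
def labels : Ctx E M → Multiset M
  | hole => 0
  | lam m _ _ C => m ::ₘ C.labels
  | appFun _ m _ _ C u => m ::ₘ (C.labels + u.labels)
  | appArg _ v C => v.labels + C.labels
  | esBody _ C u => C.labels + u.labels
  | esArg _ t C => t.labels + C.labels

/-- Relabelling of the nodes of a context. -/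
def map (f : E → E') (g : M → M') : Ctx E M → Ctx E' M'
  | hole => hole
  | lam m x b C => lam (g m) (f x) (f b) (C.map f g)
  | appFun s m x b C u => appFun (f s) (g m) (f x) (f b) (C.map f g) (u.map f g)
  | appArg s v C => appArg (f s) (v.map f g) (C.map f g)
  | esBody x C u => esBody (f x) (C.map f g) (u.map f g)
  | esArg x t C => esArg (f x) (t.map f g) (C.map f g)

/-- The contexts `⟨·⟩ L`, where `L` is a list of explicit substitutions. -/
def IsSpine : Ctx E M → Prop
  | hole => True
  | esBody _ C _ => C.IsSpine
  | _ => False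

theorem core_fill (B : NTerm E M) (C : Ctx E M) :
    ∀ S r, (C.fill B).core S r = C.core S r ∪ B.core (C.boxes S) (C.root r) := by
  induction C <;> intro S r <;>
    simp only [fill, core, boxes, root, NTerm.core, NTerm.lab, Set.empty_union, *] <;>
    ac_rfl

theorem homes_fill (B : NTerm E M) (C : Ctx E M) :
    ∀ S, (C.fill B).homes S = C.homes S ∪ B.homes (C.boxes S) := by
  induction C <;> intro S <;>
    simp only [fill, homes, boxes, NTerm.homes, Set.empty_union, *] <;>
    ac_rfl

theorem occ_fill (B : NTerm E M) (C : Ctx E M) : (C.fill B).occ = C.occ ∪ B.occ := by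
  induction C <;> simp only [fill, occ, NTerm.occ, Set.empty_union, *] <;> ac_rfl

theorem vars_fill (B : NTerm E M) (C : Ctx E M) : (C.fill B).vars = C.vars + B.vars := by
  induction C <;> simp_all [fill, vars, NTerm.vars] <;> abel

theorem roots_fill (B : NTerm E M) (C : Ctx E M) : (C.fill B).roots = C.roots + B.roots := by
  induction C <;> simp_all [fill, roots, NTerm.roots] <;> abel

theorem nodes_fill (B : NTerm E M) (C : Ctx E M) : (C.fill B).nodes = C.nodes + B.nodes := by
  simp only [NTerm.nodes, nodes, vars_fill, roots_fill]; abel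

theorem labels_fill (B : NTerm E M) (C : Ctx E M) : (C.fill B).labels = C.labels + B.labels := by
  induction C <;> simp_all [fill, labels, NTerm.labels] <;> abel

theorem fill_map (f : E → E') (g : M → M') (B : NTerm E M) (C : Ctx E M) :
    (C.fill B).map f g = (C.map f g).fill (B.map f g) := by
  induction C <;> simp_all [fill, map, NTerm.map]

theorem IsSpine.boxes {C : Ctx E M} (h : C.IsSpine) (S : Set M) : C.boxes S = S := by
  induction C <;> simp_all [Ctx.boxes, IsSpine]

theorem IsSpine.root {C : Ctx E M} (h : C.IsSpine) (r : E) : C.root r = r := by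
  induction C <;> simp_all [Ctx.root, IsSpine]

theorem IsSpine.core {C : Ctx E M} (h : C.IsSpine) (S : Set M) (r r' : E) :
    C.core S r = C.core S r' := by
  induction C <;> simp_all [Ctx.core, IsSpine]

/-- The filling of the hole of a sorted term is a term, and it can be exchanged for another one. -/
theorem sorted_fill {B : NTerm E M} {C : Ctx E M} (h : (C.fill B).Sorted false) :
    B.Sorted false ∧ ∀ {E' M' : Type} (f : E → E') (g : M → M') (B' : NTerm E' M'),
      B'.Sorted false → ((C.map f g).fill B').Sorted false := by
  induction C <;> simp_all [fill, map, NTerm.Sorted, NTerm.sorted_map]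

/-- The free variables of the filling of a hole are those of the whole and variables bound by the
context; conversely the filling can be exchanged for another one with the same free variables. -/
theorem closed_fill {B : NTerm E M} {C : Ctx E M} :
    ∀ {P : Set (ENode E)}, (C.fill B).Closed P →
      ∃ Q : Set (ENode E), P ⊆ Q ∧ (∀ y ∈ Q, y ∈ P ∨ ∃ e ∈ C.vars, y = .node e) ∧ B.Closed Q ∧
        ∀ {E' M' : Type} (f : E → E') (g : M → M') (B' : NTerm E' M'),
          B'.Closed (ENode.map f '' Q) → ((C.map f g).fill B').Closed (ENode.map f '' P) := by
  induction C with
  | hole =>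
    intro P h
    exact ⟨P, subset_rfl, fun y hy => .inl hy, h, fun f g B' h => h⟩
  | lam m x b C ih =>
    intro P h
    obtain ⟨Q, hPQ, hQ, hB, hf⟩ := ih h
    refine ⟨Q, (Set.subset_insert _ _).trans hPQ, fun y hy => ?_, hB, fun f g B' h => ?_⟩
    · rcases hQ y hy with (rfl | h) | ⟨e, he, rfl⟩
      · exact .inr ⟨x, by simp [vars], rfl⟩
      · exact .inl h
      · exact .inr ⟨e, by simp [vars, he], rfl⟩
    · have := hf f g B' h
      rwa [Set.image_insert_eq] at this
  | appFun s m x b C u ih =>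
    intro P h
    obtain ⟨Q, hPQ, hQ, hB, hf⟩ := ih h.1
    refine ⟨Q, (Set.subset_insert _ _).trans hPQ, fun y hy => ?_, hB, fun f g B' h' => ?_⟩
    · rcases hQ y hy with (rfl | h) | ⟨e, he, rfl⟩
      · exact .inr ⟨x, by simp [vars], rfl⟩
      · exact .inl h
      · exact .inr ⟨e, by simp [vars, he], rfl⟩
    · have := hf f g B' h'
      rw [Set.image_insert_eq] at this
      exact ⟨this, h.2.map f g⟩
  | appArg s v C ih =>
    intro P h
    obtain ⟨Q, hPQ, hQ, hB, hf⟩ := ih h.2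
    refine ⟨Q, hPQ, fun y hy => ?_, hB, fun f g B' h' => ⟨h.1.map f g, hf f g B' h'⟩⟩
    rcases hQ y hy with h | ⟨e, he, rfl⟩
    · exact .inl h
    · exact .inr ⟨e, by simp [vars, he], rfl⟩
  | esBody x C u ih =>
    intro P h
    obtain ⟨Q, hPQ, hQ, hB, hf⟩ := ih h.1
    refine ⟨Q, (Set.subset_insert _ _).trans hPQ, fun y hy => ?_, hB, fun f g B' h' => ?_⟩
    · rcases hQ y hy with (rfl | h) | ⟨e, he, rfl⟩
      · exact .inr ⟨x, by simp [vars], rfl⟩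
      · exact .inl h
      · exact .inr ⟨e, by simp [vars, he], rfl⟩
    · have := hf f g B' h'
      rw [Set.image_insert_eq] at this
      exact ⟨this, h.2.map f g⟩
  | esArg x t C ih =>
    intro P h
    obtain ⟨Q, hPQ, hQ, hB, hf⟩ := ih h.2
    refine ⟨Q, hPQ, fun y hy => ?_, hB, fun f g B' h' => ⟨?_, hf f g B' h'⟩⟩
    · rcases hQ y hy with h | ⟨e, he, rfl⟩
      · exact .inl h
      · exact .inr ⟨e, by simp [vars, he], rfl⟩
    · have := h.1.map f g
      rwa [Set.image_insert_eq] at this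

theorem occ_subset {B : NTerm E M} {C : Ctx E M} :
    ∀ {P : Set (ENode E)}, (C.fill B).Closed P →
      ∀ y ∈ C.occ, y ∈ P ∨ ∃ e ∈ C.vars, y = .node e := by
  induction C with
  | hole => rintro P h y ⟨⟩
  | lam m x b C ih =>
    intro P h y hy
    rcases ih h y hy with (rfl | h) | ⟨e, he, rfl⟩
    · exact .inr ⟨x, by simp [vars], rfl⟩
    · exact .inl h
    · exact .inr ⟨e, by simp [vars, he], rfl⟩
  | appFun s m x b C u ih =>
    rintro P h y (hy | hy)
    · rcases ih h.1 y hy with (rfl | h) | ⟨e, he, rfl⟩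
      · exact .inr ⟨x, by simp [vars], rfl⟩
      · exact .inl h
      · exact .inr ⟨e, by simp [vars, he], rfl⟩
    · rcases h.2.occ_subset y hy with h | ⟨e, he, rfl⟩
      · exact .inl h
      · exact .inr ⟨e, by simp [vars, he], rfl⟩
  | appArg s v C ih =>
    rintro P h y (hy | hy)
    · rcases h.1.occ_subset y hy with h | ⟨e, he, rfl⟩
      · exact .inl h
      · exact .inr ⟨e, by simp [vars, he], rfl⟩
    · rcases ih h.2 y hy with h | ⟨e, he, rfl⟩
      · exact .inl h
      · exact .inr ⟨e, by simp [vars, he], rfl⟩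
  | esBody x C u ih =>
    rintro P h y (hy | hy)
    · rcases ih h.1 y hy with (rfl | h) | ⟨e, he, rfl⟩
      · exact .inr ⟨x, by simp [vars], rfl⟩
      · exact .inl h
      · exact .inr ⟨e, by simp [vars, he], rfl⟩
    · rcases h.2.occ_subset y hy with h | ⟨e, he, rfl⟩
      · exact .inl h
      · exact .inr ⟨e, by simp [vars, he], rfl⟩
  | esArg x t C ih =>
    rintro P h y (hy | hy)
    · rcases h.1.occ_subset y hy with (rfl | h) | ⟨e, he, rfl⟩
      · exact .inr ⟨x, by simp [vars], rfl⟩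
      · exact .inl h
      · exact .inr ⟨e, by simp [vars, he], rfl⟩
    · rcases ih h.2 y hy with h | ⟨e, he, rfl⟩
      · exact .inl h
      · exact .inr ⟨e, by simp [vars, he], rfl⟩

theorem boxes_subset (C : Ctx E M) : ∀ S, ∀ m ∈ C.boxes S, m ∈ S ∨ m ∈ C.labels := by
  induction C <;> intro S m hm <;> simp only [boxes, labels, Multiset.mem_add, Multiset.mem_cons,
    Multiset.notMem_zero] at hm ⊢
  case hole => exact .inl hm
  case lam ih => have := ih _ _ hm; simp only [Set.mem_insert_iff] at this; tauto
  case appFun ih => have := ih _ _ hm; simp only [Set.mem_insert_iff] at this; tauto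
  case appArg ih => have := ih _ _ hm; tauto
  case esBody ih => have := ih _ _ hm; tauto
  case esArg ih => have := ih _ _ hm; tauto

end Ctx

/-! ### Substitution in named terms -/

namespace NTerm

open Classical in
/-- Substitution in a named term: the nodes are relabelled, and every occurrence of the variable
`x`, hanging on an `m`-node `i`, is replaced by `w i`. -/
noncomputable def sub (x : E) (f : E → E') (g : M → M') (w : M → NTerm E' M') :
    NTerm E M → NTerm E' M'
  | var m y => if y = .node x then w m else var (g m) (y.map f)
  | lam m y b t => lam (g m) (f y) (f b) (sub x f g w t)
  | val v => val (sub x f g w v)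
  | app s v u => app (f s) (sub x f g w v) (sub x f g w u)
  | es y t u => es (f y) (sub x f g w t) (sub x f g w u)

open Classical in
/-- The `m`-nodes on which the occurrences of the variable `x` hang. -/
noncomputable def occs (x : E) : NTerm E M → Multiset M
  | var m y => if y = .node x then {m} else 0
  | lam _ _ _ t => occs x t
  | val v => occs x v
  | app _ v u => occs x v + occs x u
  | es _ t u => occs x t + occs x u

variable {x : E} {f : E → E'} {g : M → M'} {w : M → NTerm E' M'}

theorem occs_le_labels (x : E) (A : NTerm E M) : A.occs x ≤ A.labels := by
  induction A with
  | var m y => unfold occs labels; split_ifs <;> simp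
  | lam m y b t ih => exact ih.trans (Multiset.le_cons_self _ _)
  | val v ih => exact ih
  | app s v u ih₁ ih₂ => exact add_le_add ih₁ ih₂
  | es y t u ih₁ ih₂ => exact add_le_add ih₁ ih₂

theorem mem_occs {A : NTerm E M} {i : M} :
    ∀ {S r}, i ∈ A.occs x ↔ ∃ T, (T, Link.der i (.node x)) ∈ core S r A := by
  induction A with
  | var m y =>
    intro S r
    unfold occs core
    split_ifs with h <;> simp [h]
    exact fun _ h' => h h'.symm
  | lam m y b t ih => intro S r; simp [occs, core, ih (S := insert m S) (r := b)]
  | val v ih => intro S r; simp [occs, core, ih (S := S) (r := r)]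
  | app s v u ih₁ ih₂ =>
    intro S r; simp [occs, core, ih₁ (S := S) (r := r), ih₂ (S := S) (r := s), exists_or]
  | es y t u ih₁ ih₂ =>
    intro S r; simp [occs, core, ih₁ (S := S) (r := r), ih₂ (S := S) (r := y), exists_or]

theorem mem_occ_iff_occs {A : NTerm E M} : ENode.node x ∈ A.occ ↔ ∃ i, i ∈ A.occs x := by
  induction A with
  | var m y => unfold occ occs; split_ifs with h <;> simp [h, eq_comm]
  | lam m y b t ih => exact ih
  | val v ih => exact ih
  | app s v u ih₁ ih₂ => simp [occ, occs, ih₁, ih₂, exists_or]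
  | es y t u ih₁ ih₂ => simp [occ, occs, ih₁, ih₂, exists_or]

theorem map_id (A : NTerm E M) : A.map id id = A := by
  have : ∀ y : ENode E, y.map id = y := by rintro (_ | _) <;> rfl
  induction A <;> simp_all [map]

theorem sub_eq_map {A : NTerm E M} (h : ENode.node x ∉ A.occ) : A.sub x f g w = A.map f g := by
  induction A with
  | var m y => unfold sub; rw [if_neg (fun h' => h h'.symm)]; rfl
  | lam m y b t ih => rw [sub, ih h]; rfl
  | val v ih => rw [sub, ih h]; rfl
  | app s v u ih₁ ih₂ =>
    rw [sub, ih₁ fun h' => h (.inl h'), ih₂ fun h' => h (.inr h')]; rfl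
  | es y t u ih₁ ih₂ =>
    rw [sub, ih₁ fun h' => h (.inl h'), ih₂ fun h' => h (.inr h')]; rfl

theorem sorted_sub (hw : ∀ i, (w i).Sorted true) {A : NTerm E M} :
    ∀ {b}, A.Sorted b → (A.sub x f g w).Sorted b := by
  induction A with
  | var m y =>
    intro b h
    cases b
    · cases h
    · unfold sub; split_ifs
      · exact hw m
      · trivial
  | lam m y b t ih => intro b h; cases b <;> simp_all [sub, Sorted]
  | val v ih => intro b h; cases b <;> simp_all [sub, Sorted]
  | app s v u ih₁ ih₂ => intro b h; cases b <;> simp_all [sub, Sorted]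
  | es y t u ih₁ ih₂ => intro b h; cases b <;> simp_all [sub, Sorted]

theorem lab_sub (hl : ∀ i, (w i).lab = g i) (A : NTerm E M) : (A.sub x f g w).lab = g A.lab := by
  induction A with
  | var m y => unfold sub; split_ifs <;> simp [lab, hl]
  | _ => simp_all [sub, lab]

theorem closed_sub {A : NTerm E M} :
    ∀ {P : Set (ENode E)} {Q : Set (ENode E')}, A.Closed P → (∀ i, (w i).Closed Q) →
      (∀ y ∈ P, y ≠ .node x → y.map f ∈ Q) → (A.sub x f g w).Closed Q := by
  induction A with
  | var m y =>
    intro P Q h hw hP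
    unfold sub; split_ifs with hy
    · exact hw m
    · exact hP y h hy
  | lam m z b t ih =>
    intro P Q h hw hP
    refine ih h (fun i => (hw i).mono (Set.subset_insert _ _)) fun y hy hx => ?_
    rcases hy with rfl | hy
    · exact .inl rfl
    · exact .inr (hP y hy hx)
  | val v ih => intro P Q h hw hP; exact ih h hw hP
  | app s v u ih₁ ih₂ => intro P Q h hw hP; exact ⟨ih₁ h.1 hw hP, ih₂ h.2 hw hP⟩
  | es z t u ih₁ ih₂ =>
    intro P Q h hw hP
    refine ⟨ih₁ h.1 (fun i => (hw i).mono (Set.subset_insert _ _)) fun y hy hx => ?_,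
      ih₂ h.2 hw hP⟩
    rcases hy with rfl | hy
    · exact .inl rfl
    · exact .inr (hP y hy hx)

theorem nodes_sub (F : M → Multiset E') (hw : ∀ i, (w i).nodes = F i) (A : NTerm E M) :
    (A.sub x f g w).nodes = A.nodes.map f + (A.occs x).bind F := by
  induction A with
  | var m y =>
    unfold sub occs; split_ifs
    · rw [hw]; simp [nodes, vars, roots]
    · simp [nodes, vars, roots]
  | lam m y b t ih => simp only [sub, nodes_lam, ih, Multiset.map_cons, occs, Multiset.cons_add]
  | val v ih => simp only [sub, nodes_val, ih, occs]
  | app s v u ih₁ ih₂ =>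
    simp only [sub, nodes_app, ih₁, ih₂, Multiset.map_cons, Multiset.map_add, occs,
      Multiset.add_bind, Multiset.cons_add]
    congr 1; abel
  | es y t u ih₁ ih₂ =>
    simp only [sub, nodes_es, ih₁, ih₂, Multiset.map_cons, Multiset.map_add, occs,
      Multiset.add_bind, Multiset.cons_add]
    congr 1; abel

theorem labels_sub (G : M → Multiset M') (hw : ∀ i, (w i).labels = g i ::ₘ G i) (A : NTerm E M) :
    (A.sub x f g w).labels = A.labels.map g + (A.occs x).bind G := by
  induction A with
  | var m y =>
    unfold sub occs; split_ifs
    · simp [hw, labels]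
    · simp [labels]
  | lam m y b t ih => simp only [sub, labels, ih, Multiset.map_cons, occs, Multiset.cons_add]
  | val v ih => simp only [sub, labels, ih, occs]
  | app s v u ih₁ ih₂ =>
    simp only [sub, labels, ih₁, ih₂, Multiset.map_add, occs, Multiset.add_bind]
    abel
  | es y t u ih₁ ih₂ =>
    simp only [sub, labels, ih₁, ih₂, Multiset.map_add, occs, Multiset.add_bind]
    abel

/-- The vars of a substituted term: those of the term and of the copies. -/
theorem occ_sub {A : NTerm E M} {y : ENode E'} :
    y ∈ (A.sub x f g w).occ ↔
      (∃ z ∈ A.occ, z ≠ .node x ∧ z.map f = y) ∨ ∃ i ∈ A.occs x, y ∈ (w i).occ := by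
  induction A with
  | var m z =>
    unfold sub occs; split_ifs with h
    · simp [occ, h]
    · simp [occ, h, eq_comm]
  | lam m z b t ih => exact ih
  | val v ih => exact ih
  | app s v u ih₁ ih₂ =>
    simp only [sub, occ, occs, Set.mem_union, ih₁, ih₂, Multiset.mem_add, or_and_right, exists_or]
    exact or_or_or_comm
  | es z t u ih₁ ih₂ =>
    simp only [sub, occ, occs, Set.mem_union, ih₁, ih₂, Multiset.mem_add, or_and_right, exists_or]
    exact or_or_or_comm

/-- The effect of a substitution on a set of links: the derelictions on `x` are replaced by the
links of the terms `w i`, the other links are relabelled. -/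
def subLinks (x : E) (f : E → E') (g : M → M') (w : M → NTerm E' M') (r' : E')
    (K : Set (Set M × Link E M)) : Set (Set M' × Link E' M') :=
  relabel f g '' {l ∈ K | ∀ i, l.2 ≠ .der i (.node x)} ∪
    {l | ∃ T i, (T, Link.der i (.node x)) ∈ K ∧ l ∈ core (g '' T) r' (w i)}

theorem subLinks_union (r' : E') (K L : Set (Set M × Link E M)) :
    subLinks x f g w r' (K ∪ L) = subLinks x f g w r' K ∪ subLinks x f g w r' L := by
  have h₁ : {l ∈ K ∪ L | ∀ i, l.2 ≠ Link.der i (.node x)} =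
      {l ∈ K | ∀ i, l.2 ≠ Link.der i (.node x)} ∪ {l ∈ L | ∀ i, l.2 ≠ Link.der i (.node x)} :=
    Set.sep_union ..
  have h₂ : {l | ∃ T i, (T, Link.der i (.node x)) ∈ K ∪ L ∧ l ∈ core (g '' T) r' (w i)} =
      {l | ∃ T i, (T, Link.der i (.node x)) ∈ K ∧ l ∈ core (g '' T) r' (w i)} ∪
      {l | ∃ T i, (T, Link.der i (.node x)) ∈ L ∧ l ∈ core (g '' T) r' (w i)} := by
    ext l
    simp only [Set.mem_union, Set.mem_ofPred_eq, or_and_right, exists_or]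
  unfold subLinks
  rw [h₁, h₂, Set.image_union]
  ac_rfl

theorem subLinks_of_no_der (r' : E') {K : Set (Set M × Link E M)}
    (h : ∀ l ∈ K, ∀ i, l.2 ≠ .der i (.node x)) : subLinks x f g w r' K = relabel f g '' K := by
  have h₁ : {l ∈ K | ∀ i, l.2 ≠ Link.der i (.node x)} = K := by
    ext l; exact ⟨fun h => h.1, fun hl => ⟨hl, h l hl⟩⟩
  have h₂ : {l | ∃ T i, (T, Link.der i (.node x)) ∈ K ∧ l ∈ core (g '' T) r' (w i)} = ∅ := by
    ext l
    simp only [Set.mem_ofPred_eq, Set.mem_empty_iff_false, iff_false]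
    rintro ⟨T, i, hK, -⟩
    exact h _ hK i rfl
  rw [subLinks, h₁, h₂, Set.union_empty]

/-- Substitution in a named term is what the elimination of an exponential cut does to the links. -/
theorem core_sub (hw : ∀ i, (w i).Sorted true) (hl : ∀ i, (w i).lab = g i) (r' : E')
    (A : NTerm E M) : ∀ S r,
      core (g '' S) (f r) (A.sub x f g w) = subLinks x f g w r' (core S r A) := by
  induction A with
  | var m y =>
    intro S r
    unfold sub; split_ifs with h
    · subst h
      rw [core_value (hw m) _ _ r']
      ext l
      simp [subLinks, core]
    · rw [core, core, subLinks_of_no_der]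
      · simp [relabel, Link.map]
      · rintro l rfl i hi
        injection hi with _ hi
        exact h hi
  | lam m y b t ih =>
    intro S r
    simp only [sub, core, subLinks_union, ← ih, Set.image_insert_eq]
    rw [subLinks_of_no_der]
    · simp [relabel, Link.map, ENode.map]
    · rintro l rfl i hi; cases hi
  | val v ih =>
    intro S r
    simp only [sub, core, subLinks_union, ← ih, lab_sub hl]
    rw [subLinks_of_no_der]
    · simp [relabel, Link.map, ENode.map]
    · rintro l rfl i hi; cases hi
  | app s v u ih₁ ih₂ =>
    intro S r
    simp only [sub, core, subLinks_union, ← ih₁, ← ih₂, lab_sub hl]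
    rw [subLinks_of_no_der]
    · simp [relabel, Link.map, ENode.map]
    · rintro l rfl i hi; cases hi
  | es y t u ih₁ ih₂ =>
    intro S r
    simp only [sub, core, subLinks_union, ← ih₁, ← ih₂]

theorem homes_sub {A : NTerm E M} {p : Set M' × ENode E'} : ∀ {S r},
    p ∈ homes (g '' S) (A.sub x f g w) ↔ p ∈ Prod.map (g '' ·) (ENode.map f) '' homes S A ∨
      ∃ T i, (T, Link.der i (.node x)) ∈ core S r A ∧ p ∈ homes (g '' T) (w i) := by
  induction A with
  | var m y =>
    intro S r
    unfold sub; split_ifs with h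
    · subst h; simp [core, homes]
    · simp only [homes, core, Set.image_empty, Set.mem_empty_iff_false, false_or,
        Set.mem_singleton_iff, Prod.mk.injEq, Link.der.injEq, false_iff, not_exists, not_and]
      exact fun _ _ h' => absurd h'.2.2.symm h
  | lam m y b t ih =>
    intro S r
    simp only [sub, homes, core, Set.mem_union, Set.image_union, Set.image_singleton,
      ← Set.image_insert_eq, ih (S := insert m S) (r := b)]
    simp [ENode.map, or_assoc]
  | val v ih =>
    intro S r
    simp only [sub, homes, core, ih (S := S) (r := r)]
    simp
  | app s v u ih₁ ih₂ =>
    intro S r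
    simp only [sub, homes, core, Set.mem_union, Set.image_union, ih₁ (S := S) (r := r),
      ih₂ (S := S) (r := s), or_and_right, exists_or]
    simp only [Set.mem_singleton_iff, Prod.mk.injEq, reduceCtorEq, and_false, false_and,
      exists_false,
      false_or]
    exact or_or_or_comm
  | es y t u ih₁ ih₂ =>
    intro S r
    simp only [sub, homes, core, Set.mem_union, Set.image_union, ih₁ (S := S) (r := r),
      ih₂ (S := S) (r := y), or_and_right, exists_or, Set.image_singleton]
    exact (or_congr_left or_assoc.symm).trans or_or_or_comm

end NTerm

/-! ### Named terms representing terms -/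

mutual
/-- `v.Rep ρ A`: the named term `A` is an annotation of the value `v`, where the environment `ρ`
sends each index to its `e`-node. -/
inductive Val.Rep {E M : Type} : (ℕ → ENode E) → Val → NTerm E M → Prop
  | var (ρ : ℕ → ENode E) (n : ℕ) (m : M) : Val.Rep ρ (.var n) (.var m (ρ n))
  | lam {ρ : ℕ → ENode E} {t : Term} {m : M} {x b : E} {A : NTerm E M} :
      Term.Rep (scons (.node x) ρ) t A → Val.Rep ρ (.lam t) (.lam m x b A)
/-- `t.Rep ρ A`: the named term `A` is an annotation of the term `t`, where the environment `ρ`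
sends each index to its `e`-node. -/
inductive Term.Rep {E M : Type} : (ℕ → ENode E) → Term → NTerm E M → Prop
  | val {ρ : ℕ → ENode E} {v : Val} {A : NTerm E M} : Val.Rep ρ v A → Term.Rep ρ (.val v) (.val A)
  | app {ρ : ℕ → ENode E} {v : Val} {u : Term} {s : E} {A B : NTerm E M} :
      Val.Rep ρ v A → Term.Rep ρ u B → Term.Rep ρ (.app v u) (.app s A B)
  | es {ρ : ℕ → ENode E} {t u : Term} {x : E} {A B : NTerm E M} :
      Term.Rep (scons (.node x) ρ) t A → Term.Rep ρ u B → Term.Rep ρ (.es t u) (.es x A B)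
end

mutual
theorem Val.Rep.sorted {ρ : ℕ → ENode E} : ∀ {v : Val} {A : NTerm E M}, v.Rep ρ A → A.Sorted true
  | _, _, .var _ _ _ => trivial
  | _, _, .lam h => Term.Rep.sorted h
theorem Term.Rep.sorted {ρ : ℕ → ENode E} :
    ∀ {t : Term} {A : NTerm E M}, t.Rep ρ A → A.Sorted false
  | _, _, .val h => Val.Rep.sorted h
  | _, _, .app h₁ h₂ => ⟨Val.Rep.sorted h₁, Term.Rep.sorted h₂⟩
  | _, _, .es h₁ h₂ => ⟨Term.Rep.sorted h₁, Term.Rep.sorted h₂⟩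
end

mutual
theorem Val.Rep.map (f : E → E') (g : M → M') {ρ : ℕ → ENode E} : ∀ {v : Val} {A : NTerm E M},
    v.Rep ρ A → v.Rep (fun n => (ρ n).map f) (A.map f g)
  | _, _, .var ρ n m => .var _ n _
  | _, _, .lam h => .lam (by have := Term.Rep.map f g h; rwa [scons_comp] at this)
theorem Term.Rep.map (f : E → E') (g : M → M') {ρ : ℕ → ENode E} : ∀ {t : Term} {A : NTerm E M},
    t.Rep ρ A → t.Rep (fun n => (ρ n).map f) (A.map f g)
  | _, _, .val h => .val (Val.Rep.map f g h)
  | _, _, .app h₁ h₂ => .app (Val.Rep.map f g h₁) (Term.Rep.map f g h₂)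
  | _, _, .es h₁ h₂ =>
    .es (by have := Term.Rep.map f g h₁; rwa [scons_comp] at this) (Term.Rep.map f g h₂)
end

theorem scons_liftRen {α : Type*} (a : α) (ρ : ℕ → α) (ξ : ℕ → ℕ) :
    scons a (fun n => ρ (ξ n)) = fun n => scons a ρ (scons 0 (fun n => ξ n + 1) n) := by
  funext n; cases n <;> rfl

mutual
theorem Val.Rep.rename {ρ : ℕ → ENode E} {ξ : ℕ → ℕ} : ∀ {v : Val} {A : NTerm E M},
    v.Rep (fun n => ρ (ξ n)) A → (v.rename ξ).Rep ρ A
  | _, _, .var _ n m => .var _ (ξ n) _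
  | _, _, .lam h => .lam (Term.Rep.rename (by rwa [scons_liftRen] at h))
/-- Renaming the indices amounts to changing the environment; the named term is unchanged. -/
theorem Term.Rep.rename {ρ : ℕ → ENode E} {ξ : ℕ → ℕ} : ∀ {t : Term} {A : NTerm E M},
    t.Rep (fun n => ρ (ξ n)) A → (t.rename ξ).Rep ρ A
  | _, _, .val h => .val (Val.Rep.rename h)
  | _, _, .app h₁ h₂ => .app (Val.Rep.rename h₁) (Term.Rep.rename h₂)
  | _, _, .es h₁ h₂ => .es (Term.Rep.rename (by rwa [scons_liftRen] at h₁)) (Term.Rep.rename h₂)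
end

/-- The substitution `σ` in terms corresponds to the substitution of `w` for `x` in named terms,
with respect to the environments `ρ` and `ρ'`. -/
def SubstRep (x : E) (f : E → E') (w : M → NTerm E' M') (ρ : ℕ → ENode E) (ρ' : ℕ → ENode E')
    (σ : ℕ → Val) : Prop :=
  ∀ n, (ρ n = .node x → ∀ i, (σ n).Rep ρ' (w i)) ∧
    (ρ n ≠ .node x → ∃ k, σ n = .var k ∧ ρ' k = (ρ n).map f)

theorem SubstRep.lift {x y : E} {f : E → E'} {w : M → NTerm E' M'} {ρ : ℕ → ENode E}
    {ρ' : ℕ → ENode E'} {σ : ℕ → Val} (h : SubstRep x f w ρ ρ' σ) (hy : x ≠ y) :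
    SubstRep x f w (scons (.node y) ρ) (scons (.node (f y)) ρ') (liftSubst σ) := by
  intro n
  cases n with
  | zero => exact ⟨fun h => by injection h with h; exact absurd h.symm hy, fun _ => ⟨0, rfl, rfl⟩⟩
  | succ n =>
    refine ⟨fun hn i => Val.Rep.rename (ξ := Nat.succ) ((h n).1 hn i), fun hn => ?_⟩
    obtain ⟨k, hk, hk'⟩ := (h n).2 hn
    refine ⟨k + 1, ?_, hk'⟩
    simp only [liftSubst, scons_succ, hk]; rfl

mutual
theorem Val.Rep.sub {x : E} {f : E → E'} {g : M → M'} {w : M → NTerm E' M'} {ρ : ℕ → ENode E} :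
    ∀ {v : Val} {A : NTerm E M}, v.Rep ρ A → ∀ {ρ' σ}, x ∉ A.vars → SubstRep x f w ρ ρ' σ →
      (v.subst σ).Rep ρ' (A.sub x f g w)
  | _, _, .var _ n m, ρ', σ, _, hσ => by
    unfold NTerm.sub Val.subst
    split_ifs with h
    · exact (hσ n).1 h m
    · obtain ⟨k, hk, hk'⟩ := (hσ n).2 h
      rw [hk, ← hk']
      exact .var _ _ _
  | _, _, .lam h, ρ', σ, hx, hσ => by
    simp only [NTerm.vars, Multiset.mem_cons, not_or] at hx
    exact .lam (Term.Rep.sub h hx.2 (hσ.lift hx.1))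
/-- Substitution in a term is represented by substitution in the named term. -/
theorem Term.Rep.sub {x : E} {f : E → E'} {g : M → M'} {w : M → NTerm E' M'} {ρ : ℕ → ENode E} :
    ∀ {t : Term} {A : NTerm E M}, t.Rep ρ A → ∀ {ρ' σ}, x ∉ A.vars → SubstRep x f w ρ ρ' σ →
      (t.subst σ).Rep ρ' (A.sub x f g w)
  | _, _, .val h, ρ', σ, hx, hσ => .val (Val.Rep.sub h hx hσ)
  | _, _, .app h₁ h₂, ρ', σ, hx, hσ => by
    simp only [NTerm.vars, Multiset.mem_add, not_or] at hx
    exact .app (Val.Rep.sub h₁ hx.1 hσ) (Term.Rep.sub h₂ hx.2 hσ)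
  | _, _, .es h₁ h₂, ρ', σ, hx, hσ => by
    simp only [NTerm.vars, Multiset.mem_add, Multiset.mem_cons, not_or] at hx
    exact .es (Term.Rep.sub h₁ hx.2.1 (hσ.lift hx.1)) (Term.Rep.sub h₂ hx.2.2 hσ)
end

theorem scons_image_subset {α : Type*} (a : α) (ρ : ℕ → α) (F : Set ℕ) :
    scons a ρ '' F ⊆ insert a (ρ '' {n | n + 1 ∈ F}) := by
  rintro _ ⟨_ | n, hn, rfl⟩
  · exact .inl rfl
  · exact .inr ⟨n, hn, rfl⟩

mutual
theorem Val.Rep.closed : ∀ {ρ : ℕ → ENode E} {v : Val} {A : NTerm E M},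
    v.Rep ρ A → A.Closed (ρ '' v.fv)
  | _, _, _, .var _ n m => ⟨n, rfl, rfl⟩
  | _, _, _, .lam h => (Term.Rep.closed h).mono (scons_image_subset _ _ _)
theorem Term.Rep.closed : ∀ {ρ : ℕ → ENode E} {t : Term} {A : NTerm E M},
    t.Rep ρ A → A.Closed (ρ '' t.fv)
  | _, _, _, .val h => (Val.Rep.closed h :)
  | _, _, _, .app h₁ h₂ => ⟨(Val.Rep.closed h₁).mono (Set.image_mono Set.subset_union_left),
    (Term.Rep.closed h₂).mono (Set.image_mono Set.subset_union_right)⟩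
  | _, _, _, .es h₁ h₂ => ⟨(Term.Rep.closed h₁).mono ((scons_image_subset _ _ _).trans
      (Set.insert_subset_insert (Set.image_mono Set.subset_union_left))),
    (Term.Rep.closed h₂).mono (Set.image_mono Set.subset_union_right)⟩
end

/-! ### Redexes in context -/

/-- Contraction of a redex at the root of a term. -/
inductive RootStep : Term → Term → Prop
  | mult (t u : Term) : RootStep (.app (.lam t) u) (.es t u)
  | expo {t u r : Term} : Graft t u r → RootStep (.es t u) r

theorem RootStep.step {t t' : Term} : RootStep t t' → t.Step t'
  | .mult t u => .mult t u
  | .expo h => h.step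

/-- The environment `ρ'` extends `ρ` by variables bound by the context `C`. -/
def EnvExtends (ρ ρ' : ℕ → ENode E) (C : Ctx E M) : Prop :=
  ∀ n, (∃ k, ρ' n = ρ k) ∨ ∃ e ∈ C.vars, ρ' n = .node e

/-- Whatever represents `t₀` in the environment `ρ'`, plugged in the context `C`, represents `t` in
the environment `ρ`; here the nodes may be relabelled before plugging. -/
def Plugs (ρ : ℕ → ENode E) (t : Term) (C : Ctx E M) (ρ' : ℕ → ENode E) (t₀ : Term) : Prop :=
  ∀ {E' M' : Type} (f : E → E') (g : M → M') (B : NTerm E' M'),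
    t₀.Rep (fun n => (ρ' n).map f) B → t.Rep (fun n => (ρ n).map f) ((C.map f g).fill B)

theorem EnvExtends.cons {ρ ρ' : ℕ → ENode E} {C C' : Ctx E M} {x : E}
    (h : EnvExtends (scons (.node x) ρ) ρ' C) (hx : x ∈ C'.vars) (hC : ∀ e ∈ C.vars, e ∈ C'.vars) :
    EnvExtends ρ ρ' C' := by
  intro n
  rcases h n with ⟨_ | k, hk⟩ | ⟨e, he, hn⟩
  · exact .inr ⟨x, hx, hk⟩
  · exact .inl ⟨k, hk⟩
  · exact .inr ⟨e, hC e he, hn⟩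

theorem EnvExtends.mono {ρ ρ' : ℕ → ENode E} {C C' : Ctx E M}
    (h : EnvExtends ρ ρ' C) (hC : ∀ e ∈ C.vars, e ∈ C'.vars) : EnvExtends ρ ρ' C' := by
  intro n
  rcases h n with hk | ⟨e, he, hn⟩
  · exact .inl hk
  · exact .inr ⟨e, hC e he, hn⟩

theorem Plugs.under {ρ ρ' : ℕ → ENode E} {t t₀ : Term} {C : Ctx E M} {x : E}
    (h : Plugs (scons (.node x) ρ) t C ρ' t₀) {E' M' : Type} (f : E → E') (g : M → M')
    (B : NTerm E' M') (hB : t₀.Rep (fun n => (ρ' n).map f) B) :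
    t.Rep (scons (.node (f x)) (fun n => (ρ n).map f)) ((C.map f g).fill B) := by
  have := h f g B hB
  rwa [scons_comp] at this

/-- A redex of a filled context represents a redex of the represented term. -/
theorem Term.Rep.of_fill {B : NTerm E M} {C : Ctx E M} :
    ∀ {ρ : ℕ → ENode E} {t : Term}, t.Rep ρ (C.fill B) →
      ∃ ρ' t₀, t₀.Rep ρ' B ∧ EnvExtends ρ ρ' C ∧
        ∀ t₀', RootStep t₀ t₀' → ∃ t', t.Step t' ∧ Plugs ρ t' C ρ' t₀' := by
  induction C with
  | hole =>
    intro ρ t h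
    exact ⟨ρ, t, h, fun n => .inl ⟨n, rfl⟩, fun t₀' h' => ⟨t₀', h'.step, fun f g B hB => hB⟩⟩
  | lam m x b C ih =>
    rintro ρ _ (_ | _)
    rename_i h
    cases h with | lam h =>
    obtain ⟨ρ', t₀, h₀, he, hs⟩ := ih h
    refine ⟨ρ', t₀, h₀, he.cons (by simp [Ctx.vars]) (by simp +contextual [Ctx.vars]),
      fun t₀' h' => ?_⟩
    obtain ⟨t', ht', hp⟩ := hs t₀' h'
    exact ⟨_, .val (.lam ht'), fun f g B hB => .val (.lam (hp.under f g B hB))⟩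
  | appFun s m x b C u ih =>
    rintro ρ _ (_ | ⟨h, hu⟩)
    cases h with | lam h =>
    obtain ⟨ρ', t₀, h₀, he, hs⟩ := ih h
    refine ⟨ρ', t₀, h₀, he.cons (by simp [Ctx.vars]) (by simp +contextual [Ctx.vars]),
      fun t₀' h' => ?_⟩
    obtain ⟨t', ht', hp⟩ := hs t₀' h'
    exact ⟨_, .appLeft _ (.lam ht'), fun f g B hB => .app (.lam (hp.under f g B hB)) (hu.map f g)⟩
  | appArg s v C ih =>
    rintro ρ _ (_ | ⟨hv, h⟩)
    obtain ⟨ρ', t₀, h₀, he, hs⟩ := ih h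
    refine ⟨ρ', t₀, h₀, he.mono (by simp +contextual [Ctx.vars]), fun t₀' h' => ?_⟩
    obtain ⟨t', ht', hp⟩ := hs t₀' h'
    exact ⟨_, .appRight _ ht', fun f g B hB => .app (hv.map f g) (hp f g B hB)⟩
  | esBody x C u ih =>
    rintro ρ _ (_ | _ | ⟨h, hu⟩)
    obtain ⟨ρ', t₀, h₀, he, hs⟩ := ih h
    refine ⟨ρ', t₀, h₀, he.cons (by simp [Ctx.vars]) (by simp +contextual [Ctx.vars]),
      fun t₀' h' => ?_⟩
    obtain ⟨t', ht', hp⟩ := hs t₀' h'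
    exact ⟨_, .esLeft _ ht', fun f g B hB => .es (hp.under f g B hB) (hu.map f g)⟩
  | esArg x t C ih =>
    rintro ρ _ (_ | _ | ⟨ht, h⟩)
    obtain ⟨ρ', t₀, h₀, he, hs⟩ := ih h
    refine ⟨ρ', t₀, h₀, he.mono (by simp +contextual [Ctx.vars]), fun t₀' h' => ?_⟩
    obtain ⟨t', ht', hp⟩ := hs t₀' h'
    refine ⟨_, .esRight _ ht', fun f g B hB => .es ?_ (hp f g B hB)⟩
    have := ht.map f g
    rwa [scons_comp] at this

mutual
theorem Val.Step.locate {ρ : ℕ → ENode E} : ∀ {v v' : Val}, v.Step v' → ∀ {A : NTerm E M},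
    v.Rep ρ A → ∃ m x b t t' B, v' = .lam t' ∧ A = .lam m x b B ∧
      ∃ C B₀ ρ' t₀ t₀', B = C.fill B₀ ∧ RootStep t₀ t₀' ∧ t₀.Rep ρ' B₀ ∧
        EnvExtends (scons (.node x) ρ) ρ' C ∧ Plugs (scons (.node x) ρ) t' C ρ' t₀' ∧ v = .lam t
  | _, _, .lam hs, _, .lam h => by
    obtain ⟨C, B₀, ρ', t₀, t₀', hB, hr, h₀, he, hp⟩ := Term.Step.locate hs h
    exact ⟨_, _, _, _, _, _, rfl, rfl, C, B₀, ρ', t₀, t₀', hB, hr, h₀, he, hp, rfl⟩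
/-- A step of a term contracts a redex in some context of its representation. -/
theorem Term.Step.locate {ρ : ℕ → ENode E} : ∀ {t t' : Term}, t.Step t' → ∀ {A : NTerm E M},
    t.Rep ρ A → ∃ C B₀ ρ' t₀ t₀', A = C.fill B₀ ∧ RootStep t₀ t₀' ∧ t₀.Rep ρ' B₀ ∧
      EnvExtends ρ ρ' C ∧ Plugs ρ t' C ρ' t₀'
  | _, _, .mult t u, A, h =>
    ⟨.hole, A, ρ, _, _, rfl, .mult t u, h, fun n => .inl ⟨n, rfl⟩, fun _ _ _ hB => hB⟩
  | _, _, .expo t v L, A, h =>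
    ⟨.hole, A, ρ, _, _, rfl, .expo (graft_wrap v L t), h, fun n => .inl ⟨n, rfl⟩,
      fun _ _ _ hB => hB⟩
  | _, _, .val hs, _, .val h => by
    obtain ⟨m, x, b, t, t', B, rfl, rfl, C, B₀, ρ', t₀, t₀', rfl, hr, h₀, he, hp, rfl⟩ :=
      Val.Step.locate hs h
    exact ⟨.lam m x b C, B₀, ρ', t₀, t₀', rfl, hr, h₀,
      he.cons (by simp [Ctx.vars]) (by simp +contextual [Ctx.vars]),
      fun f g B hB => .val (.lam (hp.under f g B hB))⟩
  | _, _, .appLeft s hs, _, .app (s := s') h hu => by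
    obtain ⟨m, x, b, t, t', B, rfl, rfl, C, B₀, ρ', t₀, t₀', rfl, hr, h₀, he, hp, rfl⟩ :=
      Val.Step.locate hs h
    exact ⟨.appFun s' m x b C _, B₀, ρ', t₀, t₀', rfl, hr, h₀,
      he.cons (by simp [Ctx.vars]) (by simp +contextual [Ctx.vars]),
      fun f g B hB => .app (.lam (hp.under f g B hB)) (hu.map f g)⟩
  | _, _, .appRight v hs, _, .app (s := s') hv h => by
    obtain ⟨C, B₀, ρ', t₀, t₀', rfl, hr, h₀, he, hp⟩ := Term.Step.locate hs h
    exact ⟨.appArg s' _ C, B₀, ρ', t₀, t₀', rfl, hr, h₀,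
      he.mono (by simp +contextual [Ctx.vars]),
      fun f g B hB => .app (hv.map f g) (hp f g B hB)⟩
  | _, _, .esLeft u hs, _, .es (x := x) h hu => by
    obtain ⟨C, B₀, ρ', t₀, t₀', rfl, hr, h₀, he, hp⟩ := Term.Step.locate hs h
    exact ⟨.esBody x C _, B₀, ρ', t₀, t₀', rfl, hr, h₀,
      he.cons (by simp [Ctx.vars]) (by simp +contextual [Ctx.vars]),
      fun f g B hB => .es (hp.under f g B hB) (hu.map f g)⟩
  | _, _, .esRight t hs, _, .es (x := x) ht h => by
    obtain ⟨C, B₀, ρ', t₀, t₀', rfl, hr, h₀, he, hp⟩ := Term.Step.locate hs h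
    refine ⟨.esArg x _ C, B₀, ρ', t₀, t₀', rfl, hr, h₀,
      he.mono (by simp +contextual [Ctx.vars]), fun f g B hB => .es ?_ (hp f g B hB)⟩
    have := ht.map f g
    rwa [scons_comp] at this
end

/-- The argument of an exponential redex is represented by an answer. -/
theorem Graft.exists_spine {t u r : Term} (h : Graft t u r) :
    ∀ {ρ : ℕ → ENode E} {U : NTerm E M}, u.Rep ρ U →
      ∃ (L : Ctx E M) (v : NTerm E M), L.IsSpine ∧ U = L.fill (.val v) := by
  induction h with
  | val t v => rintro ρ _ (⟨h⟩); exact ⟨.hole, _, trivial, rfl⟩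
  | es w _ ih =>
    rintro ρ _ (_ | _ | ⟨h, hu⟩)
    obtain ⟨L, v, hL, rfl⟩ := ih h
    exact ⟨.esBody _ L _, v, hL, rfl⟩

/-- A term represented by an answer is an answer, so that the exponential redex can be fired. -/
theorem exists_graft {v : NTerm E M} {L : Ctx E M} (hL : L.IsSpine) :
    ∀ {ρ : ℕ → ENode E} {u t : Term}, u.Rep ρ (L.fill (.val v)) → ∃ r, Graft t u r := by
  induction L with
  | hole => rintro ρ _ t (⟨h⟩); exact ⟨_, Graft.val _ _⟩
  | esBody x L w ih =>
    rintro ρ _ t (_ | _ | ⟨h, hu⟩)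
    obtain ⟨r, hr⟩ := ih hL h
    exact ⟨_, Graft.es _ hr⟩
  | _ => cases hL

/-- The contractum of an exponential redex is represented by the named term obtained by
substituting, in the body, the value of the answer. -/
theorem Graft.rep {x : E} {f : E → E'} {g : M → M'} {w : M → NTerm E' M'} {v T : NTerm E M}
    {L : Ctx E M} (hL : L.IsSpine) (hT : x ∉ T.vars) (hxL : x ∉ L.vars) :
    ∀ {ρ : ℕ → ENode E} {t u r : Term}, Graft t u r → t.Rep (scons (.node x) ρ) T →
      u.Rep ρ (L.fill (.val v)) → (∀ n, ρ n ≠ .node x) →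
      (∀ (ρ' : ℕ → ENode E) (v' : Val), EnvExtends ρ ρ' L → v'.Rep ρ' v →
        ∀ i, v'.Rep (fun n => (ρ' n).map f) (w i)) →
      r.Rep (fun n => (ρ n).map f) ((L.map f g).fill (T.sub x f g w)) := by
  induction L with
  | hole =>
    rintro ρ t _ r h ht ⟨hv⟩ hx hw
    cases h with
    | val _ v' =>
      refine ht.sub hT fun n => ?_
      cases n with
      | zero => exact ⟨fun _ => hw ρ _ (fun n => .inl ⟨n, rfl⟩) hv, fun h => absurd rfl h⟩
      | succ n => exact ⟨fun h => absurd h (hx n), fun _ => ⟨n, rfl, rfl⟩⟩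
  | esBody y L W ih =>
    rintro ρ t _ r h ht (_ | _ | ⟨hu, hW⟩) hx hw
    simp only [Ctx.vars, Multiset.mem_cons, Multiset.mem_add, not_or] at hxL
    cases h with
    | @es _ u r _ h =>
      refine .es ?_ (hW.map f g)
      have := ih hL hxL.2.1 h (Term.Rep.rename ?_) hu ?_ ?_
      · rwa [scons_comp] at this
      · convert ht using 1
        funext n; cases n <;> rfl
      · rintro (_ | n)
        · intro h'; injection h' with h'; exact hxL.1 h'.symm
        · exact hx n
      · exact fun ρ' v' he => hw ρ' v'
          (he.cons (by simp [Ctx.vars]) (by simp +contextual [Ctx.vars]))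
  | _ => cases hL

/-! ### The net of a named term -/

/-- The weakenings on the variables in `H`, given with their boxes, that do not belong to `O`. -/
def weakenings (H : Set (Set M × ENode E)) (O : Set (ENode E)) : Set (Set M × Link E M) :=
  {l | ∃ p ∈ H, p.2 ∉ O ∧ l = (p.1, .weak p.2)}

/-- The names in `Y`, outside all boxes. -/
def nameHomes (E M : Type) (Y : Set ℕ) : Set (Set M × ENode E) := (fun y => (∅, .name y)) '' Y

/-- The net of a named term of root `r`, with `Y` as set of free variables. -/
abbrev netOf (A : NTerm E M) (r : E) (Y : Set ℕ) : Net where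
  E := E
  M := M
  root := .node r
  links := A.core ∅ r ∪ weakenings (A.homes ∅ ∪ nameHomes E M Y) A.occ

/-- Well-formed named terms: they are sorted, their free variables are names in `Y`, and all the
nodes that they introduce are distinct. -/
structure NTerm.WF (A : NTerm E M) (r : E) (Y : Set ℕ) : Prop where
  sorted : A.Sorted false
  closed : A.Closed (ENode.name '' Y)
  nodup : (r ::ₘ A.nodes).Nodup
  labels_nodup : A.labels.Nodup

/-- Relabelling commutes with the choice of the weakenings when it does not identify a variable
that occurs with one that does not. -/
theorem weakenings_relabel {f : E → E'} {g : M → M'} {H : Set (Set M × ENode E)}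
    {O : Set (ENode E)} (h : ∀ p ∈ H, ∀ y ∈ O, y.map f = p.2.map f → p.2 ∈ O) :
    relabel f g '' weakenings H O =
      weakenings (Prod.map (g '' ·) (ENode.map f) '' H) (ENode.map f '' O) := by
  ext l
  constructor
  · rintro ⟨_, ⟨p, hp, hO, rfl⟩, rfl⟩
    refine ⟨_, ⟨p, hp, rfl⟩, ?_, rfl⟩
    rintro ⟨y, hy, hyp⟩
    exact hO (h p hp y hy hyp)
  · rintro ⟨_, ⟨p, hp, rfl⟩, hO, rfl⟩
    exact ⟨_, ⟨p, hp, fun h' => hO ⟨_, h', rfl⟩, rfl⟩, rfl⟩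

theorem weakenings_union (H H' : Set (Set M × ENode E)) (O : Set (ENode E)) :
    weakenings (H ∪ H') O = weakenings H O ∪ weakenings H' O := by
  ext l
  simp only [weakenings, Set.mem_union, Set.mem_ofPred_eq, or_and_right, exists_or]

theorem nameHomes_map (f : E → E') (g : M → M') (Y : Set ℕ) :
    Prod.map (g '' ·) (ENode.map f) '' nameHomes E M Y = nameHomes E' M' Y := by
  rw [nameHomes, Set.image_image, nameHomes]
  refine Set.image_congr fun y _ => ?_
  simp [ENode.map]

theorem weakenings_map {A : NTerm E M} {Y : Set ℕ} {f : E → E'} (g : M → M')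
    (h : ∀ y ∈ A.occ, y ∈ ENode.name '' Y ∨ ∃ e ∈ A.vars, y = .node e)
    (hf : ∀ e ∈ A.vars, ∀ e' ∈ A.vars, f e = f e' → e = e') :
    relabel f g '' weakenings (A.homes ∅ ∪ nameHomes E M Y) A.occ =
      weakenings ((A.map f g).homes ∅ ∪ nameHomes E' M' Y) (A.map f g).occ := by
  rw [weakenings_relabel, Set.image_union, nameHomes_map, ← NTerm.homes_map, Set.image_empty,
    NTerm.occ_map]
  intro p hp y hy hyp
  rcases hp with hp | ⟨n, -, rfl⟩
  · obtain ⟨e, he, hpe⟩ := NTerm.vars_of_mem_homes hp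
    rcases h y hy with ⟨m, -, rfl⟩ | ⟨e', he', rfl⟩
    · rw [hpe] at hyp; cases hyp
    · rw [hpe] at hyp ⊢
      injection hyp with hyp
      rwa [← hf e' he' e he hyp]
  · rcases h y hy with ⟨m, -, rfl⟩ | ⟨e', he', rfl⟩
    · cases hyp; exact hy
    · cases hyp

theorem name_map (f : E → E') (Y : Set ℕ) : ENode.map f '' (ENode.name '' Y) = ENode.name '' Y := by
  rw [Set.image_image]; rfl

theorem Net.mk_congr {r r' : ENode E} {L L' : Set (Set M × Link E M)} (hr : r = r') (hL : L = L') :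
    Net.mk E M r L = Net.mk E M r' L' := by rw [hr, hL]

theorem mem_netOf_links {A : NTerm E M} {r : E} {Y : Set ℕ} {l : Set M × Link E M} :
    l ∈ (netOf A r Y).links ↔
      l ∈ A.core ∅ r ∨ l ∈ weakenings (A.homes ∅ ∪ nameHomes E M Y) A.occ := Iff.rfl

theorem core_mem_netOf {A : NTerm E M} {r : E} {Y : Set ℕ} {T : Set M} {l : Link E M}
    (hl : ∀ y, l ≠ .weak y) : (T, l) ∈ (netOf A r Y).links ↔ (T, l) ∈ A.core ∅ r := by
  rw [mem_netOf_links]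
  refine or_iff_left ?_
  rintro ⟨p, -, -, h⟩
  exact hl _ (Prod.ext_iff.1 h).2

/-- The boxes from which a weakening is pushed out of the net are those prescribed by the term. -/
theorem NTerm.WF.around {A : NTerm E M} {r : E} {Y : Set ℕ} (h : A.WF r Y) {T : Set M}
    {y : ENode E} (hy : (T, y) ∈ A.homes ∅ ∪ nameHomes E M Y) :
    (netOf A r Y).boxesAround y = T := by
  have e : (netOf A r Y).boxesAround y = VKer.around (A.core ∅ r) y := by
    ext a
    constructor
    · rintro (⟨l, hl, ha, hs⟩ | ⟨S, b, hl⟩)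
      · rcases hl with hl | ⟨p, -, -, rfl⟩
        · exact ⟨l, hl, .inl ⟨ha, hs⟩⟩
        · cases hs
      · rw [core_mem_netOf (by simp)] at hl
        exact ⟨_, hl, .inr ⟨b, rfl⟩⟩
    · rintro ⟨⟨S, l⟩, hl, h | ⟨b, hb⟩⟩
      · exact .inl ⟨_, .inl hl, h⟩
      · obtain rfl : l = .par a y b := hb
        exact .inr ⟨S, b, .inl hl⟩
  rw [e]
  have hn := Multiset.nodup_cons.1 h.nodup
  rcases hy with hy | ⟨z, -, hz⟩
  · exact NTerm.around_of_mem_homes h.sorted hn.2 (fun _ => hn.1) hy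
  · cases hz
    refine around_eq_empty fun l hl hs => ?_
    rcases NTerm.source_of_mem_core h.sorted hl _ hs with ⟨-, h, -⟩ | ⟨e, -, h⟩ <;> cases h

/-- An exponential cut in a named term `A` on the variable `x`, whose value `v` lies in the boxes
`S`; what remains of `A` outside of the cut and of `v` is `A₁`. -/
structure Cut (A A₁ v : NTerm E M) (r x : E) (S : Set M) (Y : Set ℕ) : Prop where
  wf : A.WF r Y
  sorted_rest : A₁.Sorted false
  sorted_val : v.Sorted true
  core_eq : A.core ∅ r = A₁.core ∅ r ∪ ({(S, .bang (.node x) v.lab)} ∪ v.core S x)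
  homes_eq : A.homes ∅ = A₁.homes ∅ ∪ ({(S, .node x)} ∪ v.homes S)
  occ_eq : A.occ = A₁.occ ∪ v.occ
  nodes_eq : A.nodes = A₁.nodes + x ::ₘ v.nodes
  labels_eq : A.labels = A₁.labels + v.labels
  boxes_labels : ∀ m ∈ S, m ∈ A₁.labels
  occ_rest : ∀ y ∈ A₁.occ, y = .node x ∨ y ∈ ENode.name '' Y ∨ ∃ e ∈ A₁.vars, y = .node e
  occ_val : ∀ y ∈ v.occ, y ∈ ENode.name '' Y ∨ ∃ e, (e ∈ A₁.vars ∨ e ∈ v.vars) ∧ y = .node e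

namespace Cut

variable {A A₁ v : NTerm E M} {r x : E} {S : Set M} {Y : Set ℕ}

theorem disjoint (c : Cut A A₁ v r x S Y) :
    r ∉ A₁.nodes ∧ r ≠ x ∧ r ∉ v.nodes ∧ A₁.nodes.Nodup ∧ x ∉ A₁.nodes ∧ x ∉ v.nodes ∧
      v.nodes.Nodup ∧ ∀ e ∈ A₁.nodes, e ∉ v.nodes := by
  have h := c.wf.nodup
  rw [c.nodes_eq] at h
  simp only [Multiset.nodup_cons, Multiset.mem_add, Multiset.mem_cons, not_or, Multiset.nodup_add,
    Multiset.disjoint_left] at h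
  exact ⟨h.1.1, h.1.2.1, h.1.2.2, h.2.1, fun hx => (h.2.2.2 hx).1 rfl, h.2.2.1.1, h.2.2.1.2,
    fun e he => (h.2.2.2 he).2⟩

theorem mem_nodes_of_mem_vars {B : NTerm E M} {e : E} (h : e ∈ B.vars) : e ∈ B.nodes :=
  Multiset.mem_add.2 (.inl h)

theorem lab_notMem (c : Cut A A₁ v r x S Y) : ∀ m ∈ v.labels, m ∉ A₁.labels := by
  have h := c.wf.labels_nodup
  rw [c.labels_eq, Multiset.nodup_add, Multiset.disjoint_left] at h
  exact fun m hm hm' => h.2.2 hm' hm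

theorem val_labels_notMem (c : Cut A A₁ v r x S Y) : ∀ m ∈ v.labels, m ∉ S :=
  fun m hm hS => c.lab_notMem m hm (c.boxes_labels m hS)

theorem x_notMem_occ_val (c : Cut A A₁ v r x S Y) : ENode.node x ∉ v.occ := by
  intro h
  rcases c.occ_val _ h with ⟨_, _, h⟩ | ⟨e, he, h⟩
  · cases h
  · cases h
    rcases he with he | he
    · exact c.disjoint.2.2.2.2.1 (mem_nodes_of_mem_vars he)
    · exact c.disjoint.2.2.2.2.2.1 (mem_nodes_of_mem_vars he)

theorem val_nodes_notMem_occ (c : Cut A A₁ v r x S Y) {e : E} (he : e ∈ v.nodes) :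
    ENode.node e ∉ A₁.occ := by
  intro h
  rcases c.occ_rest _ h with h | ⟨_, _, h⟩ | ⟨e', he', h⟩
  · cases h; exact c.disjoint.2.2.2.2.2.1 he
  · cases h
  · cases h; exact c.disjoint.2.2.2.2.2.2.2 _ (mem_nodes_of_mem_vars he') he

/-- The variables of the rest, bound or free, with their boxes. -/
theorem notMem_of_mem_homes (c : Cut A A₁ v r x S Y) {p : Set M × ENode E}
    (hp : p ∈ A₁.homes ∅ ∪ nameHomes E M Y) :
    p.2 ≠ .node x ∧ (∀ e ∈ v.nodes, p.2 ≠ .node e) ∧ (∀ e ∈ A₁.roots, p.2 ≠ .node e) ∧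
      v.lab ∉ p.1 := by
  have hd := c.disjoint
  rcases hp with hp | ⟨y, -, rfl⟩
  · obtain ⟨e, he, h⟩ := NTerm.vars_of_mem_homes hp
    have he' := mem_nodes_of_mem_vars he
    rw [h]
    refine ⟨fun h => ?_, fun e' h' h => ?_, fun e' h' h => ?_, fun h => ?_⟩
    · cases h; exact hd.2.2.2.2.1 he'
    · cases h; exact hd.2.2.2.2.2.2.2 _ he' h'
    · cases h
      have := hd.2.2.2.1
      rw [NTerm.nodes, Multiset.nodup_add, Multiset.disjoint_left] at this
      exact this.2.2 he h'
    · rcases NTerm.boxes_of_mem_homes hp _ h with h | h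
      · cases h
      · exact c.lab_notMem _ (NTerm.lab_mem_labels c.sorted_val) h
  · exact ⟨by simp, by simp, by simp, by simp⟩

/-- What hangs on the cut is the value, with the weakenings of its own bound variables. -/
theorem body_eq (c : Cut A A₁ v r x S Y) :
    (netOf A r Y).body v.lab = v.core S x ∪ weakenings (v.homes S) A.occ := by
  have ha := c.lab_notMem _ (NTerm.lab_mem_labels c.sorted_val)
  have hS := c.val_labels_notMem _ (NTerm.lab_mem_labels c.sorted_val)
  ext l
  constructor
  · rintro ⟨hl, h⟩
    rw [mem_netOf_links, c.core_eq, c.homes_eq] at hl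
    rcases hl with (hl | rfl | hl) | ⟨p, hp, hO, rfl⟩
    · exfalso
      rcases h with h | h
      · exact ha (NTerm.labels_of_mem_core hl _ h)
      · rcases NTerm.boxes_of_mem_core hl _ h with h | h
        · cases h
        · exact ha h
    · rcases h with h | h
      · cases h
      · exact absurd h hS
    · exact .inl hl
    · right
      have h : v.lab ∈ p.1 := h.resolve_left (fun h => by cases h)
      rcases hp with (hp | rfl | hp) | hp
      · exact absurd h (c.notMem_of_mem_homes (.inl hp)).2.2.2
      · exact absurd h hS
      · exact ⟨p, hp, hO, rfl⟩
      · exact absurd h (c.notMem_of_mem_homes (.inr hp)).2.2.2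
  · rintro (hl | ⟨p, hp, hO, rfl⟩)
    · refine ⟨.inl ?_, NTerm.mem_body_of_mem_core c.sorted_val hl⟩
      rw [c.core_eq]; exact .inr (.inr hl)
    · refine ⟨.inr ⟨p, .inl ?_, hO, rfl⟩, .inr (NTerm.lab_mem_of_mem_homes c.sorted_val hp)⟩
      rw [c.homes_eq]; exact .inr (.inr hp)

theorem mem_privateNodes (c : Cut A A₁ v r x S Y) {y : ENode E} :
    y ∈ (netOf A r Y).privateNodes v.lab ↔ ∃ e ∈ v.nodes, y = .node e := by
  constructor
  · rintro ⟨l, hl, hs⟩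
    rw [c.body_eq] at hl
    rcases hl with hl | ⟨p, -, -, rfl⟩
    · rcases NTerm.source_of_mem_core c.sorted_val hl _ hs with ⟨h, -⟩ | h
      · cases h
      · exact h
    · cases hs
  · rintro ⟨e, he, rfl⟩
    obtain ⟨l, hl, hs⟩ := NTerm.exists_source he (S := S) (r := x) c.sorted_val
    exact ⟨l, by rw [c.body_eq]; exact .inl hl, hs⟩

theorem ne_bang (c : Cut A A₁ v r x S Y) {l : Set M × Link E M} (hl : l ∈ A₁.core ∅ r) :
    l.2 ≠ .bang (.node x) v.lab := by
  intro h
  have hs : ENode.node x ∈ l.2.eSources := by rw [h]; rfl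
  rcases NTerm.source_of_mem_core c.sorted_rest hl _ hs with ⟨-, h, -⟩ | ⟨e, he, h⟩
  · cases h; exact c.disjoint.2.1 rfl
  · cases h; exact c.disjoint.2.2.2.2.1 he

/-- The links outside of the cut and of what hangs on it. -/
theorem rest_eq (c : Cut A A₁ v r x S Y) :
    {l ∈ (netOf A r Y).links |
        l ∉ (netOf A r Y).body v.lab ∧ l.2 ≠ .bang (.node x) v.lab ∧ l.2 ≠ .weak (.node x)} =
      A₁.core ∅ r ∪ weakenings (A₁.homes ∅ ∪ nameHomes E M Y) A.occ := by
  have ha := c.lab_notMem _ (NTerm.lab_mem_labels c.sorted_val)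
  ext l
  constructor
  · rintro ⟨hl, hb, hbang, hw⟩
    rw [c.body_eq] at hb
    rw [mem_netOf_links, c.core_eq, c.homes_eq] at hl
    rcases hl with (hl | rfl | hl) | ⟨p, (hp | rfl | hp) | hp, hO, rfl⟩
    · exact .inl hl
    · exact absurd rfl hbang
    · exact absurd (.inl hl) hb
    · exact .inr ⟨p, .inl hp, hO, rfl⟩
    · exact absurd rfl hw
    · exact absurd (.inr ⟨p, hp, hO, rfl⟩) hb
    · exact .inr ⟨p, .inr hp, hO, rfl⟩
  · rintro (hl | ⟨p, hp, hO, rfl⟩)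
    · refine ⟨.inl (by rw [c.core_eq]; exact .inl hl), ?_, c.ne_bang hl, fun h => ?_⟩
      · rintro ⟨-, h | h⟩
        · exact ha (NTerm.labels_of_mem_core hl _ h)
        · rcases NTerm.boxes_of_mem_core hl _ h with h | h
          · cases h
          · exact ha h
      · exact NTerm.not_weak_mem_core
          (show (l.1, Link.weak (ENode.node x)) ∈ _ by rw [← h]; exact hl)
    · have h := c.notMem_of_mem_homes hp
      refine ⟨.inr ⟨p, ?_, hO, rfl⟩, ?_, by simp, ?_⟩
      · rw [c.homes_eq]
        rcases hp with hp | hp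
        · exact .inl (.inl hp)
        · exact .inr hp
      · rintro ⟨-, h' | h'⟩
        · cases h'
        · exact h.2.2.2 h'
      · intro h'; injection h' with h'; exact h.1 h'

/-- Elimination of a cut against a weakening. -/
theorem weakReduct_eq (c : Cut A A₁ v r x S Y) :
    (netOf A r Y).weakReduct (.node x) v.lab = netOf A₁ r Y := by
  have hrest : (netOf A r Y).afterErasure (.node x) v.lab = _ := c.rest_eq
  refine Net.mk_congr (E := E) (M := M) rfl ?_
  rw [hrest]
  ext l
  constructor
  · rintro ((hl | ⟨p, hp, hO, rfl⟩) | ⟨y, ⟨⟨k, hk, hky⟩, hpriv⟩, hy, rfl⟩)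
    · exact .inl hl
    · exact .inr ⟨p, hp, fun h => hO (by rw [c.occ_eq]; exact .inl h), rfl⟩
    · -- The targets of the erased body are the variables of `v` that are not bound in `v`.
      rw [c.mem_privateNodes] at hpriv
      have hocc : y ∈ v.occ := by
        rw [c.body_eq] at hk
        rcases hk with hk | ⟨p, hp, -, rfl⟩
        · rcases NTerm.roots_of_mem_core hk y hky with ⟨i, h⟩ | ⟨e, he, rfl⟩
          · rw [NTerm.mem_occ (S := S) (r := x)]
            exact ⟨k.1, i, by rw [← h]; exact hk⟩
          · exact absurd ⟨e, Multiset.mem_add.2 (.inr he), rfl⟩ hpriv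
        · obtain ⟨e, he, h⟩ := NTerm.vars_of_mem_homes hp
          have : y = p.2 := hky
          exact absurd ⟨e, mem_nodes_of_mem_vars he, this.trans h⟩ hpriv
      obtain ⟨T, hT⟩ : ∃ T, (T, y) ∈ A₁.homes ∅ ∪ nameHomes E M Y := by
        rcases c.occ_val y hocc with ⟨n, hn, rfl⟩ | ⟨e, he | he, rfl⟩
        · exact ⟨∅, .inr ⟨n, hn, rfl⟩⟩
        · obtain ⟨T, hT⟩ := NTerm.exists_mem_homes ∅ he; exact ⟨T, .inl hT⟩
        · exact absurd ⟨e, mem_nodes_of_mem_vars he, rfl⟩ hpriv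
      refine .inr ⟨(T, y), hT, fun h => ?_, ?_⟩
      · obtain ⟨T', i, hl⟩ := (NTerm.mem_occ (S := ∅) (r := r)).1 h
        exact hy _ (.inl hl) rfl
      · rw [c.wf.around (T := T)]
        rw [c.homes_eq]
        rcases hT with hT | hT
        · exact .inl (.inl hT)
        · exact .inr hT
  · rintro (hl | ⟨p, hp, hO, rfl⟩)
    · exact .inl (.inl hl)
    · -- A variable weakened in the result was weakened before, or all its occurrences were in `v`.
      by_cases hocc : p.2 ∈ A.occ
      · right
        have hv : p.2 ∈ v.occ := by rw [c.occ_eq] at hocc; exact hocc.resolve_left hO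
        have h := c.notMem_of_mem_homes hp
        refine ⟨p.2, ⟨?_, ?_⟩, ?_, ?_⟩
        · obtain ⟨T, i, hl⟩ := (NTerm.mem_occ (S := S) (r := x)).1 hv
          exact ⟨(T, .der i p.2), by rw [c.body_eq]; exact .inl hl, rfl⟩
        · rw [c.mem_privateNodes]
          rintro ⟨e, he, h'⟩
          exact h.2.1 e he h'
        · rintro k (hk | ⟨q, -, hq, rfl⟩) hky
          · rcases NTerm.roots_of_mem_core hk _ hky with ⟨i, h'⟩ | ⟨e, he, h'⟩
            · refine hO ((NTerm.mem_occ (S := ∅) (r := r)).2 ⟨k.1, i, ?_⟩)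
              rw [← h']; exact hk
            · exact h.2.2.1 e he h'
          · have : p.2 = q.2 := hky
            exact hq (this ▸ hocc)
        · rw [c.wf.around (T := p.1)]
          rw [c.homes_eq]
          rcases hp with hp | hp
          · exact .inl (.inl hp)
          · exact .inr hp
      · exact .inl (.inr ⟨p, hp, hocc, rfl⟩)

open Classical in
/-- The copy number `i` of an `e`-node of the value `v`. -/
noncomputable def copyNode (v : NTerm E M) (i : M) (e : E) : E ⊕ E × M :=
  if e ∈ v.nodes then .inr (e, i) else .inl e

open Classical in
/-- The copy number `i` of an `m`-node of the value `v`. -/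
noncomputable def copyLabel (v : NTerm E M) (i : M) (m : M) : M ⊕ M × M :=
  if m = v.lab then .inl i else .inr (m, i)

/-- The copy number `i` of the value `v`. -/
noncomputable def copy (v : NTerm E M) (i : M) : NTerm (E ⊕ E × M) (M ⊕ M × M) :=
  v.map (copyNode v i) (copyLabel v i)

theorem copyE_eq (c : Cut A A₁ v r x S Y) (i : M) :
    (netOf A r Y).copyE v.lab i = ENode.map (copyNode v i) := by
  funext y
  cases y with
  | name n => rfl
  | node e =>
    have := c.mem_privateNodes (y := .node e)
    simp only [ENode.node.injEq, exists_eq_right'] at this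
    unfold Net.copyE
    simp only [ENode.map, copyNode, this]
    split_ifs <;> first | rfl | tauto

theorem copy_sorted (c : Cut A A₁ v r x S Y) (i : M) : (copy v i).Sorted true :=
  (NTerm.sorted_map _ _ _ _).2 c.sorted_val

theorem copy_lab (v : NTerm E M) (i : M) : (copy v i).lab = .inl i := by
  rw [copy, NTerm.lab_map, copyLabel, if_pos rfl]

/-- The copy of the value that is plugged on `i` inside the boxes `T` consists of the links of the
named term `copy v i`. -/
theorem copy_core (c : Cut A A₁ v r x S Y) (T : Set M) (i : M) (r' : E ⊕ E × M) :
    (copy v i).core (Sum.inl '' T) r' =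
      (fun h => (Sum.inl '' T ∪ copyLabel v i '' (h.1 \ S),
        h.2.map (ENode.map (copyNode v i)) (copyLabel v i))) '' v.core S x := by
  rw [NTerm.core_value (c.copy_sorted i) _ r' (copyNode v i x), ← Set.union_empty (Sum.inl '' T),
    NTerm.core_union, ← Set.image_empty (copyLabel v i), copy, NTerm.core_map]
  conv_rhs => rw [← Set.union_empty S, NTerm.core_union, Set.image_image]
  rw [Set.image_image]
  refine Set.image_congr fun l hl => ?_
  have : (S ∪ l.1) \ S = l.1 := by
    rw [Set.union_sdiff_left]
    refine sdiff_eq_left.2 (Set.disjoint_left.2 fun m hm hS => ?_)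
    rcases NTerm.boxes_of_mem_core hl m hm with h | h
    · cases h
    · exact c.val_labels_notMem m h hS
  simp only [this, relabel, Set.image_empty, Set.union_empty]

theorem copy_homes (c : Cut A A₁ v r x S Y) (T : Set M) (i : M) :
    (copy v i).homes (Sum.inl '' T) =
      (fun h => (Sum.inl '' T ∪ copyLabel v i '' (h.1 \ S), h.2.map (copyNode v i))) ''
        v.homes S := by
  rw [← Set.union_empty (Sum.inl '' T), NTerm.homes_union, ← Set.image_empty (copyLabel v i), copy,
    NTerm.homes_map]
  conv_rhs => rw [← Set.union_empty S, NTerm.homes_union, Set.image_image]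
  rw [Set.image_image]
  refine Set.image_congr fun l hl => ?_
  have : (S ∪ l.1) \ S = l.1 := by
    rw [Set.union_sdiff_left]
    refine sdiff_eq_left.2 (Set.disjoint_left.2 fun m hm hS => ?_)
    rcases NTerm.boxes_of_mem_homes hl m hm with h | h
    · cases h
    · exact c.val_labels_notMem m h hS
  simp only [this, Prod.map, Set.image_empty, Set.union_empty]

/-- What is left by the elimination of a cut against derelictions: every occurrence of the
variable is replaced by a copy of the value. -/
noncomputable def result (A₁ v : NTerm E M) (x : E) : NTerm (E ⊕ E × M) (M ⊕ M × M) :=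
  A₁.sub x Sum.inl Sum.inl (copy v)

/-- Sharing the targets of the copies preserves the set of the variables that occur, among those
that are not copied. -/
theorem occ_result_of_rest (c : Cut A A₁ v r x S Y) (hx : ENode.node x ∈ A₁.occ) {z : ENode E}
    (hzx : z ≠ .node x) (hzv : ∀ e ∈ v.nodes, z ≠ .node e) :
    z.map Sum.inl ∈ (result A₁ v x).occ ↔ z ∈ A.occ := by
  have inj : ∀ z z' : ENode E, z.map (Sum.inl (β := E × M)) = z'.map Sum.inl → z = z' := by
    rintro (_ | _) (_ | _) h <;> simp_all [ENode.map]
  have hc : ∀ (i : M) (z' : ENode E), z'.map (copyNode v i) = z.map Sum.inl ↔ z' = z := by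
    rintro i (n | e)
    · cases z <;> simp [ENode.map]
    · cases z with
      | name n => simp [ENode.map]
      | node e' =>
        simp only [ENode.map, copyNode, ENode.node.injEq]
        split_ifs with he
        · simp only [false_iff]
          rintro rfl
          exact hzv e he rfl
        · simp
  rw [result, NTerm.occ_sub, c.occ_eq]
  constructor
  · rintro (⟨z', hz', -, h⟩ | ⟨i, -, h⟩)
    · exact .inl (inj _ _ h ▸ hz')
    · rw [copy, NTerm.occ_map] at h
      obtain ⟨z', hz', h⟩ := h
      exact .inr ((hc i z').1 h ▸ hz')
  · rintro (h | h)
    · exact .inl ⟨z, h, hzx, rfl⟩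
    · obtain ⟨i, hi⟩ := NTerm.mem_occ_iff_occs.1 hx
      refine .inr ⟨i, hi, ?_⟩
      rw [copy, NTerm.occ_map]
      exact ⟨z, h, (hc i z).2 rfl⟩

/-- The copies of a variable bound in the value occur when the variable does. -/
theorem occ_result_of_val (c : Cut A A₁ v r x S Y) {i : M} (hi : i ∈ A₁.occs x) {e : E}
    (he : e ∈ v.nodes) :
    (ENode.node e).map (copyNode v i) ∈ (result A₁ v x).occ ↔ ENode.node e ∈ A.occ := by
  rw [result, NTerm.occ_sub, c.occ_eq]
  simp only [ENode.map, copyNode, if_pos he]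
  constructor
  · rintro (⟨z', -, -, h⟩ | ⟨j, -, h⟩)
    · cases z' <;> simp at h
    · rw [copy, NTerm.occ_map] at h
      obtain ⟨z', hz', h⟩ := h
      cases z' with
      | name n => cases h
      | node e' =>
        simp only [ENode.map, copyNode, ENode.node.injEq] at h
        split_ifs at h
        injection h with h; injection h with h; exact .inr (h ▸ hz')
  · rintro (h | h)
    · exact absurd h (c.val_nodes_notMem_occ he)
    · refine .inr ⟨i, hi, ?_⟩
      rw [copy, NTerm.occ_map]
      exact ⟨_, h, by simp only [ENode.map, copyNode, if_pos he]⟩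

/-- Elimination of a cut against derelictions. -/
theorem derReduct_eq (c : Cut A A₁ v r x S Y) (hx : ENode.node x ∈ A₁.occ) :
    (netOf A r Y).derReduct S (.node x) v.lab = netOf (result A₁ v x) (.inl r) Y := by
  have hrest : {l ∈ (netOf A r Y).links | l ∉ (netOf A r Y).body v.lab ∧
      l.2 ≠ .bang (.node x) v.lab ∧ ∀ i, l.2 ≠ .der i (.node x)} =
      {l ∈ A₁.core ∅ r | ∀ i, l.2 ≠ .der i (.node x)} ∪
        weakenings (A₁.homes ∅ ∪ nameHomes E M Y) A.occ := by
    -- As `x` occurs, it is not weakened, and the description of the rest applies.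
    have hw : ∀ l ∈ (netOf A r Y).links, l.2 ≠ .weak (.node x) := by
      rintro l (hl | ⟨p, -, hO, rfl⟩) h
      · exact NTerm.not_weak_mem_core
          (show (l.1, Link.weak (ENode.node x)) ∈ _ by rw [← h]; exact hl)
      · injection h with h
        exact hO (by rw [h, c.occ_eq]; exact .inl hx)
    have h := c.rest_eq
    ext l
    constructor
    · rintro ⟨hl, hb, h1, h2⟩
      have hl' : l ∈ A₁.core ∅ r ∪ weakenings (A₁.homes ∅ ∪ nameHomes E M Y) A.occ := by
        rw [← h]; exact ⟨hl, hb, h1, hw l hl⟩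
      rcases hl' with hl' | hl'
      · exact .inl ⟨hl', h2⟩
      · exact .inr hl'
    · intro hl
      have hl' : l ∈ A₁.core ∅ r ∪ weakenings (A₁.homes ∅ ∪ nameHomes E M Y) A.occ := by
        rcases hl with hl | hl
        · exact .inl hl.1
        · exact .inr hl
      rw [← h] at hl'
      refine ⟨hl'.1, hl'.2.1, hl'.2.2.1, ?_⟩
      rcases hl with hl | ⟨p, -, -, rfl⟩
      · exact hl.2
      · simp
  have hder : ∀ T i, (T, Link.der i (.node x)) ∈ (netOf A r Y).links ↔
      (T, Link.der i (.node x)) ∈ A₁.core ∅ r := by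
    intro T i
    rw [core_mem_netOf (by simp), c.core_eq]
    refine or_iff_left ?_
    rintro (h | h)
    · cases h
    · exact c.x_notMem_occ_val (NTerm.mem_occ.2 ⟨T, i, h⟩)
  have hhomes : ∀ p, p ∈ (result A₁ v x).homes ∅ ↔
      p ∈ Prod.map (Sum.inl '' ·) (ENode.map Sum.inl) '' A₁.homes ∅ ∨
      ∃ T i, (T, Link.der i (.node x)) ∈ A₁.core ∅ r ∧ p ∈ (copy v i).homes (Sum.inl '' T) := by
    intro p
    conv_lhs => rw [← Set.image_empty (Sum.inl (β := M × M)), result]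
    exact NTerm.homes_sub
  have hcore : (result A₁ v x).core ∅ (.inl r) =
      NTerm.subLinks x Sum.inl Sum.inl (copy v) (.inl r) (A₁.core ∅ r) := by
    conv_lhs => rw [← Set.image_empty (Sum.inl (β := M × M)), result]
    exact NTerm.core_sub c.copy_sorted (copy_lab v) _ _ _ _
  refine Net.mk_congr (E := E ⊕ E × M) (M := M ⊕ M × M) rfl ?_
  change relabel Sum.inl Sum.inl '' _ ∪ _ = _ ∪ _
  erw [hrest]
  rw [hcore, Set.image_union, c.body_eq]
  simp only [c.copyE_eq]
  ext l
  constructor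
  · rintro ((hl | ⟨_, ⟨p, hp, hO, rfl⟩, rfl⟩) | ⟨T, i, hT, h, hh | ⟨p, hp, hO, rfl⟩, rfl⟩)
    · exact .inl (.inl hl)
    · have h := c.notMem_of_mem_homes hp
      refine .inr ⟨(Sum.inl '' p.1, p.2.map Sum.inl), ?_, ?_, rfl⟩
      · rcases hp with hp | hp
        · exact .inl ((hhomes _).2 (.inl ⟨p, hp, rfl⟩))
        · right
          rw [← nameHomes_map (E := E) (M := M) Sum.inl Sum.inl]
          exact ⟨p, hp, rfl⟩
      · rw [c.occ_result_of_rest hx h.1 h.2.1]; exact hO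
    · refine .inl (.inr ⟨T, i, (hder T i).1 hT, ?_⟩)
      rw [c.copy_core]
      exact ⟨h, hh, rfl⟩
    · obtain ⟨e, he, h⟩ := NTerm.vars_of_mem_homes hp
      have hT := (hder T i).1 hT
      refine .inr ⟨(_, p.2.map (copyNode v i)), .inl ((hhomes _).2 (.inr ⟨T, i, hT, ?_⟩)), ?_, rfl⟩
      · rw [c.copy_homes]; exact ⟨p, hp, rfl⟩
      · change ENode.map _ p.2 ∉ _
        rw [h, c.occ_result_of_val (NTerm.mem_occs.2 ⟨T, hT⟩) (mem_nodes_of_mem_vars he), ← h]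
        exact hO
  · rintro ((hl | ⟨T, i, hT, hl⟩) | ⟨q, hq, hO, rfl⟩)
    · exact .inl (.inl hl)
    · rw [c.copy_core] at hl
      obtain ⟨h, hh, rfl⟩ := hl
      exact .inr ⟨T, i, (hder T i).2 hT, h, .inl hh, rfl⟩
    · rcases hq with hq | hq
      · rcases (hhomes q).1 hq with ⟨p, hp, rfl⟩ | ⟨T, i, hT, hq⟩
        · have h := c.notMem_of_mem_homes (.inl hp)
          refine .inl (.inr ⟨_, ⟨p, .inl hp, ?_, rfl⟩, rfl⟩)
          rw [← c.occ_result_of_rest hx h.1 h.2.1]; exact hO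
        · rw [c.copy_homes] at hq
          obtain ⟨p, hp, rfl⟩ := hq
          obtain ⟨e, he, h⟩ := NTerm.vars_of_mem_homes hp
          refine .inr ⟨T, i, (hder T i).2 hT, _, .inr ⟨p, hp, ?_, rfl⟩, rfl⟩
          change ENode.map _ p.2 ∉ _ at hO
          rw [h, c.occ_result_of_val (NTerm.mem_occs.2 ⟨T, hT⟩) (mem_nodes_of_mem_vars he),
            ← h] at hO
          exact hO
      · rw [← nameHomes_map (E := E) (M := M) Sum.inl Sum.inl] at hq
        obtain ⟨p, hp, rfl⟩ := hq
        have h := c.notMem_of_mem_homes (.inr hp)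
        refine .inl (.inr ⟨_, ⟨p, .inr hp, ?_, rfl⟩, rfl⟩)
        rw [← c.occ_result_of_rest hx h.1 h.2.1]; exact hO

end Cut

/-! ### Cuts and contexts -/

theorem Ctx.map_id (C : Ctx E M) : C.map id id = C := by
  induction C <;> simp_all [Ctx.map, NTerm.map_id]

theorem Ctx.fill_sub {x : E} {f : E → E'} {g : M → M'} {w : M → NTerm E' M'} {B : NTerm E M}
    {C : Ctx E M} (h : ENode.node x ∉ C.occ) :
    (C.fill B).sub x f g w = (C.map f g).fill (B.sub x f g w) := by
  induction C <;>
    simp_all [Ctx.fill, Ctx.map, NTerm.sub, Ctx.occ, NTerm.sub_eq_map]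

section

variable {x : E} {T v : NTerm E M} {C L : Ctx E M} {r : E} {Y : Set ℕ}

/-- An exponential redex in context is a cut. The list `L` of explicit substitutions is not affected
by its elimination, hence it belongs to the rest. -/
theorem Cut.of_fill (h : (C.fill (.es x T (L.fill (.val v)))).WF r Y) (hL : L.IsSpine) :
    Cut (C.fill (.es x T (L.fill (.val v)))) (C.fill (L.fill T)) v r x (C.boxes ∅) Y := by
  have hs := Ctx.sorted_fill h.sorted
  have hs' := Ctx.sorted_fill hs.1.2
  obtain ⟨Q, -, hQ, hcQ, -⟩ := Ctx.closed_fill h.closed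
  obtain ⟨Q', -, hQ', hcQ', -⟩ := Ctx.closed_fill hcQ.2
  refine ⟨h, ?_, hs'.1, ?_, ?_, ?_, ?_, ?_, ?_, ?_, ?_⟩
  · have h1 := hs'.2 id id T hs.1.1
    have h2 := hs.2 id id _ h1
    rwa [Ctx.map_id, Ctx.map_id] at h2
  · simp only [Ctx.core_fill, NTerm.core, hL.boxes, hL.root]
    rw [hL.core (C.boxes ∅) x (C.root r)]
    ac_rfl
  · simp only [Ctx.homes_fill, NTerm.homes, hL.boxes]
    ac_rfl
  · simp only [Ctx.occ_fill, NTerm.occ]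
    ac_rfl
  · simp only [Ctx.nodes_fill, NTerm.nodes_es, NTerm.nodes_val, Multiset.add_cons]
    congr 1; abel
  · simp only [Ctx.labels_fill, NTerm.labels]
    abel
  · intro m hm
    rcases Ctx.boxes_subset C ∅ m hm with h | h
    · cases h
    · simp [Ctx.labels_fill, h]
  · intro y hy
    simp only [Ctx.occ_fill, Set.mem_union] at hy
    simp only [Ctx.vars_fill, Multiset.mem_add]
    have hQy : y ∈ Q → y ∈ ENode.name '' Y ∨ ∃ e ∈ C.vars, y = .node e := hQ y
    rcases hy with hy | hy | hy
    · rcases Ctx.occ_subset h.closed y hy with h | ⟨e, he, h⟩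
      · exact .inr (.inl h)
      · exact .inr (.inr ⟨e, .inl he, h⟩)
    · rcases Ctx.occ_subset hcQ.2 y hy with h | ⟨e, he, h⟩
      · rcases hQy h with h | ⟨e, he, h⟩
        · exact .inr (.inl h)
        · exact .inr (.inr ⟨e, .inl he, h⟩)
      · exact .inr (.inr ⟨e, .inr (.inl he), h⟩)
    · rcases hcQ.1.occ_subset y hy with (h | h) | ⟨e, he, h⟩
      · exact .inl h
      · rcases hQy h with h | ⟨e, he, h⟩
        · exact .inr (.inl h)
        · exact .inr (.inr ⟨e, .inl he, h⟩)
      · exact .inr (.inr ⟨e, .inr (.inr he), h⟩)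
  · intro y hy
    simp only [Ctx.vars_fill, Multiset.mem_add]
    rcases NTerm.Closed.occ_subset (A := v) hcQ' y hy with h | ⟨e, he, h⟩
    · rcases hQ' y h with h | ⟨e, he, h⟩
      · rcases hQ y h with h | ⟨e, he, h⟩
        · exact .inl h
        · exact .inr ⟨e, .inl (.inl he), h⟩
      · exact .inr ⟨e, .inl (.inr (.inl he)), h⟩
    · exact .inr ⟨e, .inr he, h⟩

theorem Cut.closed_sub (h : (C.fill (.es x T (L.fill (.val v)))).WF r Y) (f : E → E')
    (g : M → M') (w : M → NTerm E' M')
    (hw : ∀ Q : Set (ENode E), v.Closed Q →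
      (∀ y ∈ Q, y ∈ ENode.name '' Y ∨ ∃ e, (e ∈ C.vars ∨ e ∈ L.vars) ∧ y = .node e) →
      ∀ i, (w i).Closed (ENode.map f '' Q)) :
    ((C.map f g).fill ((L.map f g).fill (T.sub x f g w))).Closed (ENode.name '' Y) := by
  obtain ⟨Q, -, hQ, hcQ, hfQ⟩ := Ctx.closed_fill h.closed
  obtain ⟨Q', hQQ', hQ', hcQ', hfQ'⟩ := Ctx.closed_fill hcQ.2
  rw [← name_map f]
  refine hfQ f g _ (hfQ' f g _ (NTerm.closed_sub hcQ.1 (hw Q' hcQ' fun y hy => ?_) ?_))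
  · rcases hQ' y hy with h | ⟨e, he, h⟩
    · rcases hQ y h with h | ⟨e, he, h⟩
      · exact .inl h
      · exact .inr ⟨e, .inl he, h⟩
    · exact .inr ⟨e, .inr he, h⟩
  · rintro y (hy | hy) hyx
    · exact absurd hy hyx
    · exact ⟨y, hQQ' hy, rfl⟩

theorem map_copyNode {y : ENode E} (h : ∀ e ∈ v.nodes, y ≠ .node e) (i : M) :
    y.map (Cut.copyNode v i) = y.map Sum.inl := by
  cases y with
  | name n => rfl
  | node e => simp only [ENode.map, Cut.copyNode]; rw [if_neg fun he => h e he rfl]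

theorem Cut.vars_notMem_val (h : (C.fill (.es x T (L.fill (.val v)))).WF r Y) (hL : L.IsSpine)
    {y : ENode E}
    (hy : (∃ n, y = .name n) ∨ ∃ e, (e ∈ C.vars ∨ e ∈ L.vars) ∧ y = .node e) :
    ∀ e ∈ v.nodes, y ≠ .node e := by
  have c := Cut.of_fill h hL
  rintro e he rfl
  rcases hy with ⟨_, h⟩ | ⟨e', he', h⟩
  · cases h
  · cases h
    refine c.disjoint.2.2.2.2.2.2.2 e (Cut.mem_nodes_of_mem_vars ?_) he
    simp only [Ctx.vars_fill, Multiset.mem_add]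
    tauto

theorem Cut.x_notMem_occ (h : (C.fill (.es x T (L.fill (.val v)))).WF r Y) (hL : L.IsSpine) :
    ENode.node x ∉ C.occ ∧ ENode.node x ∉ L.occ := by
  have c := Cut.of_fill h hL
  obtain ⟨Q, -, hQ, hcQ, -⟩ := Ctx.closed_fill h.closed
  have hx : ∀ e, (e ∈ C.vars ∨ e ∈ L.vars) → e ≠ x := by
    rintro e he rfl
    refine c.disjoint.2.2.2.2.1 (Cut.mem_nodes_of_mem_vars ?_)
    simp only [Ctx.vars_fill, Multiset.mem_add]
    tauto
  constructor
  · intro h'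
    rcases Ctx.occ_subset h.closed _ h' with ⟨_, _, h⟩ | ⟨e, he, h⟩
    · cases h
    · cases h; exact hx _ (.inl he) rfl
  · intro h'
    rcases Ctx.occ_subset hcQ.2 _ h' with h | ⟨e, he, h⟩
    · rcases hQ _ h with ⟨_, _, h⟩ | ⟨e, he, h⟩
      · cases h
      · cases h; exact hx _ (.inl he) rfl
    · cases h; exact hx _ (.inr he) rfl

/-- The elimination of the cut is the substitution in the body, in the same contexts. -/
theorem Cut.result_eq (h : (C.fill (.es x T (L.fill (.val v)))).WF r Y) (hL : L.IsSpine) :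
    Cut.result (C.fill (L.fill T)) v x = (C.map Sum.inl Sum.inl).fill
      ((L.map Sum.inl Sum.inl).fill (T.sub x Sum.inl Sum.inl (Cut.copy v))) := by
  have hx := Cut.x_notMem_occ h hL
  rw [Cut.result, Ctx.fill_sub hx.1, Ctx.fill_sub hx.2]

theorem Cut.nodes_copy (v : NTerm E M) (i : M) :
    (Cut.copy v i).nodes = v.nodes.map fun e => .inr (e, i) := by
  rw [Cut.copy, NTerm.nodes_map]
  exact Multiset.map_congr rfl fun e he => if_pos he

theorem Cut.labels_copy (hv : v.Sorted true) (hn : v.labels.Nodup) :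
    ∃ G : Multiset M, (∀ m ∈ G, m ∈ v.labels) ∧ G.Nodup ∧
      ∀ i, (Cut.copy v i).labels = .inl i ::ₘ G.map fun m => .inr (m, i) := by
  obtain ⟨G, hG⟩ := Multiset.exists_cons_of_mem (NTerm.lab_mem_labels hv)
  rw [hG, Multiset.nodup_cons] at hn
  refine ⟨G, fun m hm => by rw [hG]; exact Multiset.mem_cons_of_mem hm, hn.2, fun i => ?_⟩
  rw [Cut.copy, NTerm.labels_map, hG, Multiset.map_cons]
  congr 1
  · exact if_pos rfl
  · refine Multiset.map_congr rfl fun m hm => if_neg ?_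
    rintro rfl
    exact hn.1 hm

/-- Distinct copies of a multiset without repetitions have no common element. -/
theorem nodup_copies {α : Type} {O : Multiset M} (hO : O.Nodup) {G : Multiset α} (hG : G.Nodup)
    {B : Multiset α} (hB : B.Nodup) :
    (B.map Sum.inl + O.bind fun i => G.map fun e => (Sum.inr (e, i) : α ⊕ α × M)).Nodup := by
  rw [Multiset.nodup_add]
  refine ⟨hB.map Sum.inl_injective, ?_, ?_⟩
  · rw [Multiset.nodup_bind]
    refine ⟨fun i _ => hG.map fun a b h => by simpa using h, ?_⟩
    refine Multiset.Nodup.pairwise (fun i _ j _ hij => ?_) hO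
    rw [Function.onFun, Multiset.disjoint_left]
    intro z hz hz'
    obtain ⟨a, -, rfl⟩ := Multiset.mem_map.1 hz
    obtain ⟨b, -, h⟩ := Multiset.mem_map.1 hz'
    simp only [Sum.inr.injEq, Prod.mk.injEq] at h
    exact hij h.2.symm
  · rw [Multiset.disjoint_left]
    intro z hz hz'
    obtain ⟨a, -, rfl⟩ := Multiset.mem_map.1 hz
    obtain ⟨i, -, hi⟩ := Multiset.mem_bind.1 hz'
    obtain ⟨b, -, h⟩ := Multiset.mem_map.1 hi
    cases h

theorem Cut.wf_result (h : (C.fill (.es x T (L.fill (.val v)))).WF r Y) (hL : L.IsSpine) :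
    (Cut.result (C.fill (L.fill T)) v x).WF (.inl r) Y := by
  have c := Cut.of_fill h hL
  have hlab := c.wf.labels_nodup
  rw [c.labels_eq, Multiset.nodup_add] at hlab
  have hocc : ((C.fill (L.fill T)).occs x).Nodup :=
    Multiset.nodup_of_le (NTerm.occs_le_labels x _) hlab.1
  refine ⟨NTerm.sorted_sub c.copy_sorted c.sorted_rest, ?_, ?_, ?_⟩
  · rw [Cut.result_eq h hL]
    refine Cut.closed_sub h _ _ _ fun Q hQ hQY i => ?_
    have := NTerm.Closed.map (Cut.copyNode v i) (Cut.copyLabel v i) hQ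
    rwa [Set.image_congr fun y hy => map_copyNode (Cut.vars_notMem_val h hL
      ((hQY y hy).imp_left fun ⟨n, _, h⟩ => ⟨n, h.symm⟩)) i] at this
  · rw [Cut.result, NTerm.nodes_sub _ (Cut.nodes_copy v)]
    have := nodup_copies hocc c.disjoint.2.2.2.2.2.2.1
      (Multiset.nodup_cons.2 ⟨c.disjoint.1, c.disjoint.2.2.2.1⟩)
    rwa [Multiset.map_cons, Multiset.cons_add] at this
  · obtain ⟨G, -, hG, hc⟩ := Cut.labels_copy c.sorted_val hlab.2.1
    rw [Cut.result, NTerm.labels_sub _ hc]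
    exact nodup_copies hocc hG hlab.1

theorem Cut.wf_rest (h : (C.fill (.es x T (L.fill (.val v)))).WF r Y) (hL : L.IsSpine)
    (hx : ENode.node x ∉ T.occ) : (C.fill (L.fill T)).WF r Y := by
  have c := Cut.of_fill h hL
  refine ⟨c.sorted_rest, ?_, Multiset.nodup_cons.2 ⟨c.disjoint.1, c.disjoint.2.2.2.1⟩, ?_⟩
  · have := Cut.closed_sub h id id (fun _ => v) fun Q hQ _ i => by
      have := NTerm.Closed.map id id hQ
      rwa [NTerm.map_id] at this
    rwa [NTerm.sub_eq_map hx, NTerm.map_id, Ctx.map_id, Ctx.map_id] at this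
  · have := c.wf.labels_nodup
    rw [c.labels_eq, Multiset.nodup_add] at this
    exact this.1

/-- The contractum of an exponential redex in context, for any relabelling `f`, `g` and any family
`w` of copies of the value. -/
theorem Cut.rep_result (h : (C.fill (.es x T (L.fill (.val v)))).WF r Y) (hL : L.IsSpine)
    {t' t u s : Term} {ρ : ℕ → ENode E} (he : EnvExtends .name ρ C) (hp : Plugs .name t' C ρ s)
    (ht : t.Rep (scons (.node x) ρ) T) (hu : u.Rep ρ (L.fill (.val v))) (hg : Graft t u s)
    (f : E → E') (g : M → M') (w : M → NTerm E' M')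
    (hw : ∀ (ρ' : ℕ → ENode E) (v' : Val), (∀ n, ∀ e ∈ v.nodes, ρ' n ≠ .node e) → v'.Rep ρ' v →
        ∀ i, v'.Rep (fun n => (ρ' n).map f) (w i)) :
    t'.Rep .name ((C.map f g).fill ((L.map f g).fill (T.sub x f g w))) := by
  have c := Cut.of_fill h hL
  have hx := c.disjoint.2.2.2.2.1
  simp only [Ctx.nodes_fill, Multiset.mem_add, not_or] at hx
  refine hp f g _ (hg.rep hL (fun h => hx.2.2 (Cut.mem_nodes_of_mem_vars h))
    (fun h => hx.2.1 (Multiset.mem_add.2 (.inl h))) ht hu (fun n hn => ?_)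
    fun ρ' v' he' => hw ρ' v' fun n => Cut.vars_notMem_val h hL ?_)
  · rcases he n with ⟨k, hk⟩ | ⟨e, he, hk⟩
    · rw [hk] at hn; cases hn
    · rw [hk] at hn; cases hn; exact hx.1 (Multiset.mem_add.2 (.inl he))
  · rcases he' n with ⟨k, hk⟩ | ⟨e, he', hk⟩
    · rw [hk]
      rcases he k with ⟨k', hk⟩ | ⟨e, he, hk⟩
      · exact .inl ⟨k', hk⟩
      · exact .inr ⟨e, .inl he, hk⟩
    · exact .inr ⟨e, .inr he', hk⟩

/-! ### Multiplicative cuts -/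

open Classical in
/-- The merging of `b` with `r` and of `x` with `s`. -/
noncomputable def merge (r s x b : E) (e : E) : E := if e = b then r else if e = x then s else e

theorem merge_eq_self {r s x b e : E} (hx : e ≠ x) (hb : e ≠ b) : merge r s x b e = e := by
  rw [merge, if_neg hb, if_neg hx]

theorem relabel_id_image (φ : E → E) (A : NTerm E M) (S : Set M) (r : E) :
    relabel φ id '' A.core S r = (A.map φ id).core S (φ r) := by
  conv_rhs => rw [← Set.image_id S, NTerm.core_map]

theorem Mult.disjoint {s b : E} {a : M} {U : NTerm E M}
    (h : (C.fill (.app s (.lam a x b T) U)).WF r Y) :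
    (r ::ₘ (C.fill (.es x T U)).nodes).Nodup ∧ s ∉ (C.fill (.es x T U)).nodes ∧
      b ∉ (C.fill (.es x T U)).nodes ∧ s ≠ b ∧ r ≠ s ∧ r ≠ b ∧
      a ∉ (C.fill (.es x T U)).labels := by
  have h1 := h.nodup
  have e : r ::ₘ (C.fill (.app s (.lam a x b T) U)).nodes =
      s ::ₘ b ::ₘ r ::ₘ (C.fill (.es x T U)).nodes := by
    simp only [Ctx.nodes_fill, NTerm.nodes_app, NTerm.nodes_lam, NTerm.nodes_es,
      ← Multiset.singleton_add]
    abel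
  have e' : (C.fill (.app s (.lam a x b T) U)).labels = a ::ₘ (C.fill (.es x T U)).labels := by
    simp only [Ctx.labels_fill, NTerm.labels, ← Multiset.singleton_add]
    abel
  have h2 := h.labels_nodup
  rw [e, Multiset.nodup_cons, Multiset.nodup_cons] at h1
  rw [e', Multiset.nodup_cons] at h2
  simp only [Multiset.mem_cons, not_or] at h1
  exact ⟨h1.2.2, h1.1.2.2, h1.2.1.2, h1.1.1, Ne.symm h1.1.2.1, Ne.symm h1.2.1.1, h2.1⟩

/-- Although two pairs of nodes are merged, no two nodes of the contractum are identified: `b` and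
`s` are not among them. -/
theorem Mult.merge_inj {s b : E} {a : M} {U : NTerm E M}
    (h : (C.fill (.app s (.lam a x b T) U)).WF r Y) {r' : E} :
    ∀ e ∈ r ::ₘ (C.fill (.es x T U)).nodes, ∀ e' ∈ r ::ₘ (C.fill (.es x T U)).nodes,
      merge r' s x b e = merge r' s x b e' → e = e' := by
  have hd := Mult.disjoint h
  have hs : ∀ e ∈ r ::ₘ (C.fill (.es x T U)).nodes, e ≠ s ∧ e ≠ b := by
    intro e he
    rcases Multiset.mem_cons.1 he with rfl | he
    · exact ⟨hd.2.2.2.2.1, hd.2.2.2.2.2.1⟩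
    · exact ⟨fun h => hd.2.1 (h ▸ he), fun h => hd.2.2.1 (h ▸ he)⟩
  intro e he e' he' hee
  have h1 := hs e he
  have h2 := hs e' he'
  unfold merge at hee
  rw [if_neg h1.2, if_neg h2.2] at hee
  split_ifs at hee with h3 h4 h4
  · rw [h3, h4]
  · exact absurd hee.symm h2.1
  · exact absurd hee h1.1
  · exact hee

theorem Mult.wf {s b : E} {a : M} {U : NTerm E M}
    (h : (C.fill (.app s (.lam a x b T) U)).WF r Y) :
    ((C.fill (.es x T U)).map (merge (C.root r) s x b) id).WF r Y := by
  have hd := Mult.disjoint h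
  have hs := Ctx.sorted_fill h.sorted
  obtain ⟨Q, -, hQ, hcQ, hfQ⟩ := Ctx.closed_fill h.closed
  refine ⟨?_, ?_, ?_, ?_⟩
  · rw [Ctx.fill_map]
    exact hs.2 _ _ _ ((NTerm.sorted_map _ _ _ _).2 ⟨hs.1.1, hs.1.2⟩)
  · rw [Ctx.fill_map, ← name_map (merge (C.root r) s x b)]
    exact hfQ _ _ _ (NTerm.Closed.map (A := .es x T U) _ _ ⟨hcQ.1, hcQ.2⟩)
  · have hr : merge (C.root r) s x b r = r := by
      refine merge_eq_self ?_ hd.2.2.2.2.2.1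
      rintro rfl
      refine (Multiset.nodup_cons.1 hd.1).1 ?_
      simp [Ctx.nodes_fill, NTerm.nodes_es]
    have := Multiset.Nodup.map_on (Mult.merge_inj h (r' := C.root r)) hd.1
    rwa [Multiset.map_cons, hr, ← NTerm.nodes_map _ id] at this
  · have := h.labels_nodup
    rw [NTerm.labels_map, Multiset.map_id]
    simp only [Ctx.labels_fill, NTerm.labels, Multiset.cons_add, Multiset.add_cons,
      Multiset.nodup_cons] at this ⊢
    exact this.2

theorem Mult.root_ne {s b : E} {a : M} {U : NTerm E M}
    (h : (C.fill (.app s (.lam a x b T) U)).WF r Y) : C.root r ≠ x ∧ C.root r ≠ b := by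
  have hd := Mult.disjoint h
  have hm : C.root r ∈ r ::ₘ C.nodes := by
    have : ∀ (D : Ctx E M) (r : E), D.root r ∈ r ::ₘ D.nodes := by
      intro D
      induction D <;> intro r <;> simp only [Ctx.root, Ctx.nodes, Ctx.vars, Ctx.roots,
        Multiset.mem_cons, Multiset.mem_add, true_or, Multiset.cons_add] at *
      case lam b D ih => have := ih b; tauto
      case appFun b D u ih => have := ih b; tauto
      case appArg s v D ih => have := ih s; tauto
      case esBody D u ih => have := ih r; tauto
      case esArg x t D ih => have := ih x; tauto
    exact this C r
  have h1 := hd.1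
  simp only [Ctx.nodes_fill, NTerm.nodes_es, Multiset.add_cons, Multiset.nodup_cons,
    Multiset.mem_cons, Multiset.mem_add, not_or] at h1
  have h2 := hd.2.2.1
  simp only [Ctx.nodes_fill, Multiset.mem_add, not_or] at h2
  rcases Multiset.mem_cons.1 hm with h | h
  · rw [h]; exact ⟨h1.1.1, hd.2.2.2.2.2.1⟩
  · exact ⟨fun h' => h1.2.1.1 (h' ▸ h), fun h' => h2.1 (h' ▸ h)⟩

/-- Elimination of a multiplicative cut. -/
theorem Mult.multReduct_eq {s b : E} {a : M} {U : NTerm E M}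
    (h : (C.fill (.app s (.lam a x b T) U)).WF r Y) :
    (netOf (C.fill (.app s (.lam a x b T) U)) r Y).multReduct (.node (C.root r)) a (.node s)
      (.node x) (.node b) =
    netOf ((C.fill (.es x T U)).map (merge (C.root r) s x b) id) r Y := by
  classical
  have hd := Mult.disjoint h
  have hroot := Mult.root_ne h
  set φ := merge (C.root r) s x b with hφ
  have hxn : x ∈ (C.fill (.es x T U)).nodes := by simp [Ctx.nodes_fill, NTerm.nodes_es]
  have hrx : r ≠ x := fun h => (Multiset.nodup_cons.1 hd.1).1 (h ▸ hxn)
  have hr : φ r = r := merge_eq_self hrx hd.2.2.2.2.2.1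
  have hr1 : φ (C.root r) = C.root r := merge_eq_self hroot.1 hroot.2
  have hb : φ b = C.root r := if_pos rfl
  have hxb : x ≠ b := fun h => hd.2.2.1 (h ▸ hxn)
  have hx : φ x = s := by rw [hφ, merge, if_neg hxb, if_pos rfl]
  have hs : φ s = s := merge_eq_self (fun h => hd.2.1 (h ▸ hxn)) hd.2.2.2.1
  have hΦ : (fun y : ENode E => if y = .node b then .node (C.root r) else if y = .node x then
      .node s else y) = ENode.map φ := by
    funext y
    cases y with
    | name n => simp [ENode.map]
    | node e =>
      simp only [ENode.node.injEq, ENode.map, hφ, merge]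
      split_ifs <;> rfl
  -- The links of the reduct before the merging of the nodes.
  have hcore : (fun l : Set M × Link E M => (l.1 \ {a}, l.2)) ''
      {l ∈ (C.fill (.app s (.lam a x b T) U)).core ∅ r |
        l.2 ≠ .tens (.node (C.root r)) a (.node s) ∧ l.2 ≠ .par a (.node x) (.node b)} =
      C.core ∅ r ∪ (T.core (C.boxes ∅) b ∪ U.core (C.boxes ∅) s) := by
    have hne : ∀ {B : NTerm E M} {S r'} {l : Set M × Link E M}, l ∈ B.core S r' → s ∉ B.roots →
        b ∉ B.roots → l.2 ≠ .tens (.node (C.root r)) a (.node s) ∧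
          l.2 ≠ .par a (.node x) (.node b) := by
      intro B S r' l hl h1 h2
      constructor <;> intro h'
      · rcases NTerm.roots_of_mem_core hl (.node s) (by rw [h']; rfl) with ⟨i, h⟩ | ⟨e, he, h⟩
        · rw [h'] at h; cases h
        · cases h; exact h1 he
      · rcases NTerm.roots_of_mem_core hl (.node b) (by rw [h']; rfl) with ⟨i, h⟩ | ⟨e, he, h⟩
        · rw [h'] at h; cases h
        · cases h; exact h2 he
    have hnr : ∀ {e}, e ∉ (C.fill (.es x T U)).nodes → e ∉ T.roots ∧ e ∉ U.roots := by
      intro e he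
      simp only [NTerm.nodes, Ctx.roots_fill, NTerm.roots, Multiset.mem_add, not_or] at he
      tauto
    have hab : ∀ {l}, l ∈ C.core ∅ r ∪ (T.core (C.boxes ∅) b ∪ U.core (C.boxes ∅) s) →
        a ∉ l.1 := by
      have hl := hd.2.2.2.2.2.2
      simp only [Ctx.labels_fill, NTerm.labels, Multiset.mem_add, not_or] at hl
      have hS : a ∉ C.boxes ∅ := fun h => (C.boxes_subset ∅ a h).elim (fun h => h) hl.1
      rintro l (hl' | hl' | hl') ha
      · have : l ∈ (C.fill (.es x T U)).core ∅ r := by rw [Ctx.core_fill]; exact .inl hl'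
        exact (NTerm.boxes_of_mem_core this a ha).elim (fun h => h) hd.2.2.2.2.2.2
      · exact (NTerm.boxes_of_mem_core hl' a ha).elim hS hl.2.1
      · exact (NTerm.boxes_of_mem_core hl' a ha).elim hS hl.2.2
    have hT : T.core (insert a (C.boxes ∅)) b =
        (fun l => ({a} ∪ l.1, l.2)) '' T.core (C.boxes ∅) b := by
      rw [← NTerm.core_union, Set.insert_eq]
    have hdiff : ∀ {S : Set M}, a ∉ S → S \ {a} = S := fun h => Set.sdiff_singleton_eq_self h
    ext l
    constructor
    · rintro ⟨l, ⟨hl, h1, h2⟩, rfl⟩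
      rw [Ctx.core_fill] at hl
      simp only [NTerm.core] at hl
      rcases hl with hl | (rfl | rfl | hl) | hl
      · have h3 := hab (.inl hl)
        refine .inl ?_
        simp only [hdiff h3]; exact hl
      · exact absurd rfl h1
      · exact absurd rfl h2
      · rw [hT] at hl
        obtain ⟨l, hl, rfl⟩ := hl
        refine .inr (.inl ?_)
        have h3 := hab (.inr (.inl hl))
        have : ({a} ∪ l.1) \ {a} = l.1 := by rw [Set.union_sdiff_left, hdiff h3]
        simp only [this]; exact hl
      · have h3 := hab (.inr (.inr hl))
        refine .inr (.inr ?_)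
        simp only [hdiff h3]; exact hl
    · intro hl
      have h3 := hab hl
      rcases hl with hl | hl | hl
      · have : l ∈ (C.fill (.es x T U)).core ∅ r := by rw [Ctx.core_fill]; exact .inl hl
        refine ⟨l, ⟨?_, hne this ?_ ?_⟩, by simp only [hdiff h3]⟩
        · rw [Ctx.core_fill]; exact .inl hl
        · exact fun h => hd.2.1 (Multiset.mem_add.2 (.inr h))
        · exact fun h => hd.2.2.1 (Multiset.mem_add.2 (.inr h))
      · have h4 : ({a} ∪ l.1, l.2) ∈ T.core (insert a (C.boxes ∅)) b := by
          rw [hT]; exact ⟨l, hl, rfl⟩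
        refine ⟨({a} ∪ l.1, l.2), ⟨?_, hne h4 (hnr hd.2.1).1 (hnr hd.2.2.1).1⟩, ?_⟩
        · rw [Ctx.core_fill]; exact .inr (.inl (.inr (.inr h4)))
        · have : ({a} ∪ l.1) \ {a} = l.1 := by rw [Set.union_sdiff_left, hdiff h3]
          simp only [this]
      · refine ⟨l, ⟨?_, hne hl (hnr hd.2.1).2 (hnr hd.2.2.1).2⟩, by simp only [hdiff h3]⟩
        rw [Ctx.core_fill]; exact .inr (.inr hl)
  -- Opening the box on `a` weakens `x` where the explicit substitution does.
  have hhomes : (fun p : Set M × ENode E => (p.1 \ {a}, p.2)) ''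
      (C.fill (.app s (.lam a x b T) U)).homes ∅ = (C.fill (.es x T U)).homes ∅ := by
    have hl := hd.2.2.2.2.2.2
    simp only [Ctx.labels_fill, NTerm.labels, Multiset.mem_add, not_or] at hl
    have hS : a ∉ C.boxes ∅ := fun h => (C.boxes_subset ∅ a h).elim (fun h => h) hl.1
    have hself : ∀ K : Set (Set M × ENode E), (∀ p ∈ K, a ∉ p.1) →
        (fun p : Set M × ENode E => (p.1 \ {a}, p.2)) '' K = K := by
      intro K hK
      have : ∀ p ∈ K, (fun p : Set M × ENode E => (p.1 \ {a}, p.2)) p = id p := by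
        intro p hp
        simp only [Set.sdiff_singleton_eq_self (hK p hp), id]
      rw [Set.image_congr this, Set.image_id]
    have hT : T.homes (insert a (C.boxes ∅)) =
        (fun l => ({a} ∪ l.1, l.2)) '' T.homes (C.boxes ∅) := by
      rw [← NTerm.homes_union, Set.insert_eq]
    have hT' : (fun p : Set M × ENode E => (p.1 \ {a}, p.2)) '' T.homes (insert a (C.boxes ∅)) =
        T.homes (C.boxes ∅) := by
      conv_rhs => rw [← hself (T.homes (C.boxes ∅)) fun p hp h' =>
        (NTerm.boxes_of_mem_homes hp a h').elim hS hl.2.1]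
      rw [hT, Set.image_image]
      refine Set.image_congr fun p _ => ?_
      rw [Set.union_sdiff_left]
    simp only [Ctx.homes_fill, NTerm.homes, Set.image_union, Set.image_singleton]
    rw [hT', hself (C.homes ∅), hself (U.homes _), Set.insert_sdiff_self_of_notMem hS]
    · exact fun p hp h' => (NTerm.boxes_of_mem_homes hp a h').elim hS hl.2.2
    · intro p hp h'
      have : p ∈ (C.fill (.es x T U)).homes ∅ := by rw [Ctx.homes_fill]; exact .inl hp
      exact (NTerm.boxes_of_mem_homes this a h').elim (fun h => h) hd.2.2.2.2.2.2
  have hoccs : (C.fill (.app s (.lam a x b T) U)).occ = (C.fill (.es x T U)).occ := by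
    simp only [Ctx.occ_fill, NTerm.occ]
  have hRcore : ((C.fill (.es x T U)).map φ id).core ∅ r =
      relabel φ id '' (C.core ∅ r ∪ (T.core (C.boxes ∅) b ∪ U.core (C.boxes ∅) s)) := by
    have h1 : ((C.fill (.es x T U)).map φ id).core ∅ r =
        relabel φ id '' (C.fill (.es x T U)).core ∅ r := by rw [relabel_id_image, hr]
    rw [h1, Ctx.core_fill, NTerm.core]
    simp only [Set.image_union, relabel_id_image, hb, hr1, hx, hs]
  have hw := weakenings_map (A := C.fill (.es x T U)) (Y := Y) (f := φ) (id : M → M) (by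
    have e : (C.fill (.app s (.lam a x b T) U)).vars = (C.fill (.es x T U)).vars := by
      simp only [Ctx.vars_fill, NTerm.vars, ← Multiset.singleton_add]; abel
    rw [← e, ← hoccs]
    exact h.closed.occ_subset) fun e he e' he' =>
      Mult.merge_inj h e (Multiset.mem_cons_of_mem (Cut.mem_nodes_of_mem_vars he)) e'
        (Multiset.mem_cons_of_mem (Cut.mem_nodes_of_mem_vars he'))
  refine Net.mk_congr (E := E) (M := M) ?_ ?_
  · rw [if_neg (by simpa using hd.2.2.2.2.2.1), if_neg (by simpa using hrx)]
  rw [hRcore, ← hw, ← Set.image_union, ← hcore, ← hhomes, ← hoccs]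
  rw [hΦ]
  have hsplit : ((fun l : Set M × Link E M => (l.1 \ {a}, l.2)) ''
      {l ∈ (C.fill (.app s (.lam a x b T) U)).core ∅ r |
        l.2 ≠ .tens (.node (C.root r)) a (.node s) ∧ l.2 ≠ .par a (.node x) (.node b)} ∪
      weakenings ((fun p : Set M × ENode E => (p.1 \ {a}, p.2)) ''
        (C.fill (.app s (.lam a x b T) U)).homes ∅ ∪ nameHomes E M Y)
        (C.fill (.app s (.lam a x b T) U)).occ) =
      (fun l : Set M × Link E M => (l.1 \ {a}, l.2)) ''
        {l ∈ (netOf (C.fill (.app s (.lam a x b T) U)) r Y).links |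
        l.2 ≠ .tens (.node (C.root r)) a (.node s) ∧ l.2 ≠ .par a (.node x) (.node b)} := by
    ext l
    constructor
    · rintro (⟨l, hl, rfl⟩ | ⟨_, ⟨p, hp, rfl⟩ | ⟨n, hn, rfl⟩, hO, rfl⟩)
      · exact ⟨l, ⟨.inl hl.1, hl.2⟩, rfl⟩
      · exact ⟨_, ⟨.inr ⟨p, .inl hp, hO, rfl⟩, by simp, by simp⟩, rfl⟩
      · exact ⟨_, ⟨.inr ⟨_, .inr ⟨n, hn, rfl⟩, hO, rfl⟩, by simp, by simp⟩, by simp⟩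
    · rintro ⟨l, ⟨hl | ⟨p, hp | ⟨n, hn, rfl⟩, hO, rfl⟩, h'⟩, rfl⟩
      · exact .inl ⟨l, ⟨hl, h'⟩, rfl⟩
      · exact .inr ⟨_, .inl ⟨p, hp, rfl⟩, hO, rfl⟩
      · exact .inr ⟨_, .inr ⟨n, hn, rfl⟩, hO, by simp⟩
  rw [hsplit, Set.image_image]
  refine Set.image_congr fun l _ => ?_
  simp only [relabel, Set.image_id]

end

/-! ### Finding the redex of a cut -/

/-- Every `bang`- or `tens`-link is the upper link of a subterm. The statement for values is what
the induction needs. -/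
theorem NTerm.exists_fill_of_mem_core {l : Set M × Link E M} (h₁ : ∀ i y, l.2 ≠ .der i y)
    (h₂ : ∀ i y b, l.2 ≠ .par i y b) {A : NTerm E M} : ∀ {S r}, l ∈ A.core S r →
    (A.Sorted false → ∃ (C : Ctx E M) (B : NTerm E M), A = C.fill B ∧
      ((∃ v, B = .val v ∧ l = (C.boxes S, .bang (.node (C.root r)) v.lab)) ∨
        ∃ s v u, B = .app s v u ∧ l = (C.boxes S, .tens (.node (C.root r)) v.lab (.node s)))) ∧
    (A.Sorted true → ∃ m x b t, A = .lam m x b t ∧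
      ∃ (C : Ctx E M) (B : NTerm E M), t = C.fill B ∧
      ((∃ v, B = .val v ∧ l = (C.boxes (insert m S), .bang (.node (C.root b)) v.lab)) ∨
        ∃ s v u, B = .app s v u ∧
          l = (C.boxes (insert m S), .tens (.node (C.root b)) v.lab (.node s)))) := by
  induction A with
  | var m y => rintro S r rfl; exact absurd rfl (h₁ m y)
  | lam m x b t ih =>
    rintro S r (rfl | hl)
    · exact absurd rfl (h₂ _ _ _)
    · exact ⟨fun h => (by cases h), fun h => ⟨m, x, b, t, rfl, (ih hl).1 h⟩⟩
  | val v ih =>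
    rintro S r (rfl | hl)
    · exact ⟨fun _ => ⟨.hole, _, rfl, .inl ⟨v, rfl, rfl⟩⟩, fun h => by cases h⟩
    · refine ⟨fun h => ?_, fun h => by cases h⟩
      obtain ⟨m, x, b, t, rfl, C, B, rfl, hB⟩ := (ih hl).2 h
      exact ⟨.lam m x b C, B, rfl, hB⟩
  | app s v u ih₁ ih₂ =>
    rintro S r ((rfl | hl) | hl)
    · exact ⟨fun _ => ⟨.hole, _, rfl, .inr ⟨s, v, u, rfl, rfl⟩⟩, fun h => by cases h⟩
    · refine ⟨fun h => ?_, fun h => by cases h⟩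
      obtain ⟨m, x, b, t, rfl, C, B, rfl, hB⟩ := (ih₁ hl).2 h.1
      exact ⟨.appFun s m x b C u, B, rfl, hB⟩
    · refine ⟨fun h => ?_, fun h => by cases h⟩
      obtain ⟨C, B, rfl, hB⟩ := (ih₂ hl).1 h.2
      exact ⟨.appArg s v C, B, rfl, hB⟩
  | es x t u ih₁ ih₂ =>
    rintro S r (hl | hl)
    · refine ⟨fun h => ?_, fun h => by cases h⟩
      obtain ⟨C, B, rfl, hB⟩ := (ih₁ hl).1 h.1
      exact ⟨.esBody x C u, B, rfl, hB⟩
    · refine ⟨fun h => ?_, fun h => by cases h⟩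
      obtain ⟨C, B, rfl, hB⟩ := (ih₂ hl).1 h.2
      exact ⟨.esArg x t C, B, rfl, hB⟩

/-- The root of a hole is the root of the whole, the variable of an explicit substitution, or the
root of a box or of an argument. -/
theorem Ctx.cases_root (C : Ctx E M) :
    C.IsSpine ∨
    (∃ (C' : Ctx E M) (x : E) (t : NTerm E M) (L : Ctx E M), L.IsSpine ∧
      (∀ B, C.fill B = C'.fill (.es x t (L.fill B))) ∧ (∀ S, C.boxes S = C'.boxes S) ∧
      ∀ r, C.root r = x) ∨
    ∀ r, C.root r ∈ C.roots := by
  induction C with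
  | hole => exact .inl trivial
  | lam m x b C ih =>
    rcases ih with h | ⟨C', y, t, L, hL, h, hb, hr⟩ | h
    · exact .inr (.inr fun r => by simp [Ctx.root, Ctx.roots, h.root])
    · exact .inr (.inl ⟨.lam m x b C', y, t, L, hL, fun B => by simp only [Ctx.fill, h],
        fun S => hb _, fun r => hr _⟩)
    · exact .inr (.inr fun r => by simp [Ctx.root, Ctx.roots, h])
  | appFun s m x b C u ih =>
    rcases ih with h | ⟨C', y, t, L, hL, h, hb, hr⟩ | h
    · exact .inr (.inr fun r => by simp [Ctx.root, Ctx.roots, h.root])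
    · exact .inr (.inl ⟨.appFun s m x b C' u, y, t, L, hL, fun B => by simp only [Ctx.fill, h],
        fun S => hb _, fun r => hr _⟩)
    · exact .inr (.inr fun r => by simp [Ctx.root, Ctx.roots, h])
  | appArg s v C ih =>
    rcases ih with h | ⟨C', y, t, L, hL, h, hb, hr⟩ | h
    · exact .inr (.inr fun r => by simp [Ctx.root, Ctx.roots, h.root])
    · exact .inr (.inl ⟨.appArg s v C', y, t, L, hL, fun B => by simp only [Ctx.fill, h],
        fun S => hb _, fun r => hr _⟩)
    · exact .inr (.inr fun r => by simp [Ctx.root, Ctx.roots, h])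
  | esBody x C u ih =>
    rcases ih with h | ⟨C', y, t, L, hL, h, hb, hr⟩ | h
    · exact .inl h
    · exact .inr (.inl ⟨.esBody x C' u, y, t, L, hL, fun B => by simp only [Ctx.fill, h],
        fun S => hb _, fun r => hr _⟩)
    · exact .inr (.inr fun r => by simp [Ctx.root, Ctx.roots, h])
  | esArg x s C ih =>
    rcases ih with h | ⟨C', y, t, L, hL, h, hb, hr⟩ | h
    · exact .inr (.inl ⟨.hole, x, s, C, h, fun B => rfl, fun S => h.boxes S, fun r => h.root x⟩)
    · exact .inr (.inl ⟨.esArg x s C', y, t, L, hL, fun B => by simp only [Ctx.fill, h],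
        fun S => hb _, fun r => hr _⟩)
    · exact .inr (.inr fun r => by simp [Ctx.root, Ctx.roots, h])

/-- A multiplicative cut comes from a multiplicative redex. -/
theorem NTerm.WF.exists_mult {A : NTerm E M} {r : E} {Y : Set ℕ} (h : A.WF r Y) {S S' : Set M}
    {y s x b : ENode E} {a : M} (h₁ : (S, Link.tens y a s) ∈ (netOf A r Y).links)
    (h₂ : (S', Link.par a x b) ∈ (netOf A r Y).links) :
    ∃ (C : Ctx E M) (s' x' b' : E) (T U : NTerm E M), A = C.fill (.app s' (.lam a x' b' T) U) ∧
      y = .node (C.root r) ∧ s = .node s' ∧ x = .node x' ∧ b = .node b' := by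
  rw [core_mem_netOf (by simp)] at h₁ h₂
  obtain ⟨C, B, rfl, ⟨v, rfl, hv⟩ | ⟨s', v, u, rfl, hv⟩⟩ :=
    (NTerm.exists_fill_of_mem_core (by simp) (by simp) h₁).1 h.sorted
  · simp at hv
  · simp only [Prod.mk.injEq, Link.tens.injEq] at hv
    have hs := (Ctx.sorted_fill h.sorted).1.1
    cases v with
    | var m z =>
      have h₃ : (C.boxes ∅, Link.der a z) ∈ (C.fill (.app s' (.var m z) u)).core ∅ r := by
        rw [Ctx.core_fill, hv.2.2.1]; exact .inr (.inl (.inr rfl))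
      -- The link of source `a` would be both a `par`-link and a `der`-link.
      have := NTerm.core_unique h.labels_nodup h₂ h₃ (m := a) rfl rfl
      simp at this
    | lam m x' b' T =>
      have h₃ : (C.boxes ∅, Link.par a (.node x') (.node b')) ∈
          (C.fill (.app s' (.lam m x' b' T) u)).core ∅ r := by
        rw [Ctx.core_fill, hv.2.2.1]; exact .inr (.inl (.inr (.inl rfl)))
      have := NTerm.core_unique h.labels_nodup h₂ h₃ (m := a) rfl rfl
      simp only [Prod.mk.injEq, Link.par.injEq, true_and] at this
      refine ⟨C, s', x', b', T, u, ?_, hv.2.1, hv.2.2.2, this.2.1, this.2.2⟩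
      rw [hv.2.2.1]; rfl
    | _ => cases hs

/-- An exponential cut comes from an exponential redex. -/
theorem NTerm.WF.exists_expo {A : NTerm E M} {r : E} {Y : Set ℕ} (h : A.WF r Y) {S T : Set M}
    {x : ENode E} {a : M} (h₁ : (S, Link.bang x a) ∈ (netOf A r Y).links)
    (h₂ : (T, Link.weak x) ∈ (netOf A r Y).links ∨ ∃ i, (T, Link.der i x) ∈ (netOf A r Y).links) :
    ∃ (C : Ctx E M) (x' : E) (t v : NTerm E M) (L : Ctx E M),
      A = C.fill (.es x' t (L.fill (.val v))) ∧ L.IsSpine ∧ S = C.boxes ∅ ∧ x = .node x' ∧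
      a = v.lab := by
  rw [core_mem_netOf (by simp)] at h₁
  obtain ⟨C, B, rfl, ⟨v, rfl, hv⟩ | ⟨s', v, u, rfl, hv⟩⟩ :=
    (NTerm.exists_fill_of_mem_core (by simp) (by simp) h₁).1 h.sorted
  · simp only [Prod.mk.injEq, Link.bang.injEq] at hv
    -- The source of the `bang`-link is also the target of `h₂`, hence it is a bound variable.
    have hvar : C.root r ∈ (C.fill (.val v)).vars := by
      rcases h₂ with (h₂ | ⟨p, hp | ⟨n, hn, rfl⟩, -, hpx⟩) | ⟨i, h₂⟩
      · exact absurd h₂ NTerm.not_weak_mem_core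
      · simp only [Prod.mk.injEq, Link.weak.injEq] at hpx
        obtain ⟨e, he, h⟩ := NTerm.vars_of_mem_homes hp
        rw [← hpx.2, hv.2.1] at h
        cases h; exact he
      · simp [hv.2.1] at hpx
      · rw [core_mem_netOf (by simp)] at h₂
        rcases h.closed.occ_subset x (NTerm.mem_occ.2 ⟨T, i, h₂⟩) with ⟨n, -, h⟩ | ⟨e, he, h⟩
        · rw [hv.2.1] at h; cases h
        · rw [hv.2.1] at h; cases h; exact he
    have hn := Multiset.nodup_cons.1 h.nodup
    rcases C.cases_root with hC | ⟨C', x', t, L, hL, hf, hb, hr⟩ | hC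
    · rw [hC.root] at hvar
      exact absurd (Cut.mem_nodes_of_mem_vars hvar) hn.1
    · exact ⟨C', x', t, v, L, hf _, hL, by rw [hv.1, hb], by rw [hv.2.1, hr], hv.2.2⟩
    · have := hn.2
      rw [NTerm.nodes, Multiset.nodup_add, Multiset.disjoint_left] at this
      refine absurd ?_ (this.2.2 hvar)
      rw [Ctx.roots_fill]
      exact Multiset.mem_add.2 (.inl (hC r))
  · simp at hv

/-! ### Nets that represent a term -/

/-- The net `N` is, up to the choice of the nodes, the translation of `t` with the weakenings of
the names in `Y` that are not free in `t`. -/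
def Represents (N : Net) (t : Term) (Y : Set ℕ) : Prop :=
  ∃ (E M : Type) (A : NTerm E M) (r : E), A.WF r Y ∧ t.Rep .name A ∧ N = netOf A r Y

section

variable {C L : Ctx E M} {T U v : NTerm E M} {r x s b : E} {a : M} {Y : Set ℕ}
  {ρ : ℕ → ENode E} {t u w t' : Term}

theorem Mult.contracts :
    (netOf (C.fill (.app s (.lam a x b T) U)) r Y).Contracts
      ((netOf (C.fill (.app s (.lam a x b T) U)) r Y).multReduct (.node (C.root r)) a (.node s)
        (.node x) (.node b)) := by
  refine .mult (S := C.boxes ∅) ?_ ?_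
  · rw [core_mem_netOf (by simp), Ctx.core_fill]
    exact .inr (.inl (.inl rfl))
  · rw [core_mem_netOf (by simp), Ctx.core_fill]
    exact .inr (.inl (.inr (.inl rfl)))

theorem Mult.represents (h : (C.fill (.app s (.lam a x b T) U)).WF r Y)
    (hp : Plugs .name t' C ρ (.es t u)) (ht : t.Rep (scons (.node x) ρ) T) (hu : u.Rep ρ U) :
    Represents ((netOf (C.fill (.app s (.lam a x b T) U)) r Y).multReduct (.node (C.root r)) a
      (.node s) (.node x) (.node b)) t' Y := by
  refine ⟨E, M, _, r, Mult.wf h, ?_, Mult.multReduct_eq h⟩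
  rw [Ctx.fill_map]
  exact hp _ _ _ (Term.Rep.map _ _ (.es ht hu))

theorem Cut.represents_derReduct (h : (C.fill (.es x T (L.fill (.val v)))).WF r Y)
    (hL : L.IsSpine) (he : EnvExtends .name ρ C) (hp : Plugs .name t' C ρ w)
    (ht : t.Rep (scons (.node x) ρ) T) (hu : u.Rep ρ (L.fill (.val v))) (hg : Graft t u w)
    (hx : ENode.node x ∈ (C.fill (L.fill T)).occ) :
    Represents ((netOf (C.fill (.es x T (L.fill (.val v)))) r Y).derReduct (C.boxes ∅) (.node x)
      v.lab) t' Y := by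
  refine ⟨_, _, _, _, Cut.wf_result h hL, ?_, (Cut.of_fill h hL).derReduct_eq hx⟩
  rw [Cut.result_eq h hL]
  refine Cut.rep_result h hL he hp ht hu hg _ _ _ fun ρ' v' hρ' hv' i => ?_
  have := Val.Rep.map (Cut.copyNode v i) (Cut.copyLabel v i) hv'
  rwa [funext fun n => map_copyNode (hρ' n) i] at this

theorem Cut.represents_weakReduct (h : (C.fill (.es x T (L.fill (.val v)))).WF r Y)
    (hL : L.IsSpine) (he : EnvExtends .name ρ C) (hp : Plugs .name t' C ρ w)
    (ht : t.Rep (scons (.node x) ρ) T) (hu : u.Rep ρ (L.fill (.val v))) (hg : Graft t u w)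
    (hx : ENode.node x ∉ (C.fill (L.fill T)).occ) :
    Represents ((netOf (C.fill (.es x T (L.fill (.val v)))) r Y).weakReduct (.node x) v.lab)
      t' Y := by
  have hxT : ENode.node x ∉ T.occ := fun h' => hx (by simp [Ctx.occ_fill, h'])
  refine ⟨_, _, _, _, Cut.wf_rest h hL hxT, ?_, (Cut.of_fill h hL).weakReduct_eq⟩
  have := Cut.rep_result h hL he hp ht hu hg id id (fun _ => v) fun ρ' v' _ hv' i => by
    have := Val.Rep.map id id hv'
    rwa [NTerm.map_id] at this
  rwa [NTerm.sub_eq_map hxT, NTerm.map_id, Ctx.map_id, Ctx.map_id] at this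

theorem Cut.bang_mem (h : (C.fill (.es x T (L.fill (.val v)))).WF r Y) (hL : L.IsSpine) :
    (C.boxes ∅, Link.bang (.node x) v.lab) ∈
      (netOf (C.fill (.es x T (L.fill (.val v)))) r Y).links := by
  rw [core_mem_netOf (by simp), (Cut.of_fill h hL).core_eq]
  exact .inr (.inl rfl)

theorem Cut.weak_mem (h : (C.fill (.es x T (L.fill (.val v)))).WF r Y) (hL : L.IsSpine)
    (hx : ENode.node x ∉ (C.fill (L.fill T)).occ) :
    (C.boxes ∅, Link.weak (.node x)) ∈
      (netOf (C.fill (.es x T (L.fill (.val v)))) r Y).links := by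
  have c := Cut.of_fill h hL
  refine .inr ⟨(C.boxes ∅, .node x), .inl ?_, ?_, rfl⟩
  · rw [c.homes_eq]; exact .inr (.inl rfl)
  · rw [c.occ_eq]
    rintro (h | h)
    · exact hx h
    · exact c.x_notMem_occ_val h

theorem Cut.mem_occ_of_der_mem (h : (C.fill (.es x T (L.fill (.val v)))).WF r Y)
    (hL : L.IsSpine) {S : Set M} {i : M}
    (hi : (S, Link.der i (.node x)) ∈ (netOf (C.fill (.es x T (L.fill (.val v)))) r Y).links) :
    ENode.node x ∈ (C.fill (L.fill T)).occ := by
  have c := Cut.of_fill h hL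
  rw [core_mem_netOf (by simp)] at hi
  have := NTerm.mem_occ.2 ⟨_, _, hi⟩
  rw [c.occ_eq] at this
  exact this.resolve_right c.x_notMem_occ_val

theorem Cut.notMem_occ_of_weak_mem (h : (C.fill (.es x T (L.fill (.val v)))).WF r Y)
    (hL : L.IsSpine) {S : Set M}
    (hi : (S, Link.weak (.node x)) ∈ (netOf (C.fill (.es x T (L.fill (.val v)))) r Y).links) :
    ENode.node x ∉ (C.fill (L.fill T)).occ := by
  have c := Cut.of_fill h hL
  rcases hi with hi | ⟨p, -, hO, hp⟩
  · exact absurd hi NTerm.not_weak_mem_core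
  · simp only [Prod.mk.injEq, Link.weak.injEq] at hp
    rw [← hp.2, c.occ_eq] at hO
    exact fun h => hO (.inl h)

end

/-- A step of a term is simulated by the elimination of a cut. -/
theorem Represents.exists_contracts {N : Net} {t t' : Term} {Y : Set ℕ} (h : Represents N t Y)
    (hs : t.Step t') : ∃ N', N.Contracts N' ∧ Represents N' t' Y := by
  obtain ⟨E, M, A, r, hA, hr, rfl⟩ := h
  obtain ⟨C, B, ρ, t₀, t₁, rfl, h₀, hB, he, hp⟩ := hs.locate hr
  cases h₀ with
  | mult t u =>
    cases hB with | app hl hu =>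
    cases hl with | lam ht =>
    exact ⟨_, Mult.contracts, Mult.represents hA hp ht hu⟩
  | expo hg =>
    cases hB with | es ht hu =>
    obtain ⟨L, v, hL, rfl⟩ := hg.exists_spine hu
    rename_i x T
    by_cases hx : ENode.node x ∈ (C.fill (L.fill T)).occ
    · refine ⟨_, ?_, Cut.represents_derReduct hA hL he hp ht hu hg hx⟩
      obtain ⟨S, i, hi⟩ := (NTerm.mem_occ (S := ∅) (r := r)).1 hx
      refine .der (T := S) (i := i) (Cut.bang_mem hA hL) ?_
      rw [core_mem_netOf (by simp), (Cut.of_fill hA hL).core_eq]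
      exact .inl hi
    · exact ⟨_, .weak (Cut.bang_mem hA hL) (Cut.weak_mem hA hL hx),
        Cut.represents_weakReduct hA hL he hp ht hu hg hx⟩

/-- The elimination of a cut simulates a step of a term. -/
theorem Represents.exists_step {N N' : Net} {t : Term} {Y : Set ℕ} (h : Represents N t Y)
    (hN : N.Contracts N') : ∃ t', t.Step t' ∧ Represents N' t' Y := by
  obtain ⟨E, M, A, r, hA, hr, rfl⟩ := h
  cases hN with
  | @mult _ _ _ _ _ a h₁ h₂ =>
    change M at a
    obtain ⟨C, s, x, b, T, U, rfl, rfl, rfl, rfl, rfl⟩ := hA.exists_mult h₁ h₂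
    obtain ⟨ρ, t₀, h₀, -, hs⟩ := hr.of_fill
    cases h₀ with | app hl hu =>
    cases hl with | lam ht =>
    obtain ⟨t', ht', hp⟩ := hs _ (.mult _ _)
    exact ⟨t', ht', Mult.represents hA hp ht hu⟩
  | der h₁ h₂ =>
    obtain ⟨C, x, T, v, L, rfl, hL, rfl, rfl, rfl⟩ := hA.exists_expo h₁ (.inr ⟨_, h₂⟩)
    obtain ⟨ρ, t₀, h₀, he, hs⟩ := hr.of_fill
    cases h₀ with | es ht hu =>
    obtain ⟨w, hg⟩ := exists_graft hL hu
    obtain ⟨t', ht', hp⟩ := hs _ (.expo hg)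
    exact ⟨t', ht', Cut.represents_derReduct hA hL he hp ht hu hg
      (Cut.mem_occ_of_der_mem hA hL h₂)⟩
  | weak h₁ h₂ =>
    obtain ⟨C, x, T, v, L, rfl, hL, rfl, rfl, rfl⟩ := hA.exists_expo h₁ (.inl h₂)
    obtain ⟨ρ, t₀, h₀, he, hs⟩ := hr.of_fill
    cases h₀ with | es ht hu =>
    obtain ⟨w, hg⟩ := exists_graft hL hu
    obtain ⟨t', ht', hp⟩ := hs _ (.expo hg)
    exact ⟨t', ht', Cut.represents_weakReduct hA hL he hp ht hu hg
      (Cut.notMem_occ_of_weak_mem hA hL h₂)⟩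

/-! ### Representation and isomorphism -/

namespace NTerm

theorem exists_label {A : NTerm E M} {m : M} (hm : m ∈ A.labels) :
    ∀ S r, ∃ l ∈ core S r A, m ∈ l.2.mSources := by
  induction A with
  | var k x => intro S r; exact ⟨_, rfl, Multiset.mem_singleton.1 hm⟩
  | lam k x b t ih =>
    intro S r
    rcases Multiset.mem_cons.1 hm with rfl | hm
    · exact ⟨_, .inl rfl, rfl⟩
    · obtain ⟨l, hl, h⟩ := ih hm (insert k S) b; exact ⟨l, .inr hl, h⟩
  | val v ih => intro S r; obtain ⟨l, hl, h⟩ := ih hm S r; exact ⟨l, .inr hl, h⟩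
  | app s v u ih₁ ih₂ =>
    intro S r
    rcases Multiset.mem_add.1 hm with hm | hm
    · obtain ⟨l, hl, h⟩ := ih₁ hm S r; exact ⟨l, .inl (.inr hl), h⟩
    · obtain ⟨l, hl, h⟩ := ih₂ hm S s; exact ⟨l, .inr hl, h⟩
  | es x t u ih₁ ih₂ =>
    intro S r
    rcases Multiset.mem_add.1 hm with hm | hm
    · obtain ⟨l, hl, h⟩ := ih₁ hm S r; exact ⟨l, .inl hl, h⟩
    · obtain ⟨l, hl, h⟩ := ih₂ hm S x; exact ⟨l, .inr hl, h⟩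

theorem target_labels_of_mem_core {A : NTerm E M} :
    ∀ {b S r l}, A.Sorted b → l ∈ core S r A → ∀ m ∈ l.2.mTargets, m ∈ A.labels := by
  induction A with
  | var m x => rintro b S r l - rfl k ⟨⟩
  | lam m x c t ih =>
    rintro ⟨⟩ S r l h (rfl | hl) k hk
    · cases h
    · cases h
    · cases hk
    · simp [labels, ih h hl k hk]
  | val v ih =>
    rintro ⟨⟩ S r l h (rfl | hl) k hk
    · rcases hk with rfl; exact lab_mem_labels (v := v) h
    · exact ih h hl k hk
    · cases h
    · cases h
  | app s v u ih₁ ih₂ =>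
    rintro ⟨⟩ S r l h hl k hk
    · rcases hl with (rfl | hl) | hl
      · rcases hk with rfl; simp [labels, lab_mem_labels h.1]
      · simp [labels, ih₁ h.1 hl k hk]
      · simp [labels, ih₂ h.2 hl k hk]
    · cases h
  | es x t u ih₁ ih₂ =>
    rintro ⟨⟩ S r l h hl k hk
    · rcases hl with hl | hl
      · simp [labels, ih₁ h.1 hl k hk]
      · simp [labels, ih₂ h.2 hl k hk]
    · cases h

theorem map_congr {f f' : E → E'} {g g' : M → M'} {A : NTerm E M} :
    ∀ {P : Set (ENode E)}, A.Closed P → (∀ y ∈ P, y.map f = y.map f') →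
      (∀ e ∈ A.nodes, f e = f' e) → (∀ m ∈ A.labels, g m = g' m) → A.map f g = A.map f' g' := by
  have hins : ∀ {P : Set (ENode E)} {x : E}, (∀ y ∈ P, y.map f = y.map f') → f x = f' x →
      ∀ y ∈ insert (ENode.node x) P, y.map f = y.map f' := by
    rintro P x hP hx y (rfl | hy)
    · simp only [ENode.map, hx]
    · exact hP y hy
  induction A with
  | var m x =>
    intro P h hP _ hm
    simp only [map, hP x h, hm m (by simp [labels])]
  | lam m x b t ih =>
    intro P h hP hn hm
    simp only [nodes_lam, labels, Multiset.mem_cons, forall_eq_or_imp] at hn hm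
    simp only [map, hn.1, hn.2.1, hm.1, ih h (hins hP hn.1) hn.2.2 hm.2]
  | val v ih => intro P h hP hn hm; simp only [map, ih h hP hn hm]
  | app s v u ih₁ ih₂ =>
    intro P h hP hn hm
    simp only [nodes_app, labels, Multiset.mem_cons, Multiset.mem_add, or_imp, forall_and,
      forall_eq] at hn hm
    simp only [map, hn.1, ih₁ h.1 hP hn.2.1 hm.1, ih₂ h.2 hP hn.2.2 hm.2]
  | es x t u ih₁ ih₂ =>
    intro P h hP hn hm
    simp only [nodes_es, labels, Multiset.mem_cons, Multiset.mem_add, or_imp, forall_and,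
      forall_eq] at hn hm
    simp only [map, hn.1, ih₁ h.1 (hins hP hn.1) hn.2.1 hm.1, ih₂ h.2 hP hn.2.2 hm.2]

end NTerm

theorem netOf_links_map {A : NTerm E M} {r : E} {Y : Set ℕ} {f : E → E'} (g : M → M')
    (h : A.Closed (ENode.name '' Y)) (hf : ∀ e ∈ A.vars, ∀ e' ∈ A.vars, f e = f e' → e = e') :
    (netOf (A.map f g) (f r) Y).links = relabel f g '' (netOf A r Y).links := by
  change _ ∪ _ = relabel f g '' (_ ∪ _)
  rw [Set.image_union, weakenings_map g h.occ_subset hf, ← NTerm.core_map, Set.image_empty]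

theorem NTerm.WF.eNodes_subset {A : NTerm E M} {r : E} {Y : Set ℕ} (h : A.WF r Y) :
    ∀ e ∈ (netOf A r Y).eNodes, e ∈ r ::ₘ A.nodes := by
  rintro e ⟨l, hl | ⟨p, hp, -, rfl⟩, he⟩
  · rcases he with he | he
    · rcases NTerm.source_of_mem_core h.sorted hl _ he with ⟨-, h, -⟩ | ⟨e', he', h⟩
      · cases h; exact Multiset.mem_cons_self _ _
      · cases h; exact Multiset.mem_cons_of_mem he'
    · rcases NTerm.roots_of_mem_core hl _ he with ⟨i, h'⟩ | ⟨e', he', h⟩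
      · rcases h.closed.occ_subset _ (NTerm.mem_occ.2 ⟨l.1, i, by rw [← h']; exact hl⟩) with
          ⟨n, -, h⟩ | ⟨e', he', h⟩
        · cases h
        · injection h with h
          subst h
          exact Multiset.mem_cons_of_mem (Multiset.mem_add.2 (.inl he'))
      · cases h; exact Multiset.mem_cons_of_mem (Multiset.mem_add.2 (.inr he'))
  · replace he : ENode.node e = p.2 := he.resolve_left (fun h => by cases h)
    rcases hp with hp | ⟨n, -, rfl⟩
    · obtain ⟨e', he', h⟩ := NTerm.vars_of_mem_homes hp
      rw [h] at he; cases he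
      exact Multiset.mem_cons_of_mem (Multiset.mem_add.2 (.inl he'))
    · cases he

theorem NTerm.WF.mNodes_subset {A : NTerm E M} {r : E} {Y : Set ℕ} (h : A.WF r Y) :
    ∀ m ∈ (netOf A r Y).mNodes, m ∈ A.labels := by
  rintro m ⟨l, hl | ⟨p, hp, -, rfl⟩, hm⟩
  · rcases hm with hm | hm | hm
    · exact NTerm.labels_of_mem_core hl m hm
    · exact NTerm.target_labels_of_mem_core h.sorted hl m hm
    · exact (NTerm.boxes_of_mem_core hl m hm).resolve_left (fun h => h)
  · replace hm : m ∈ p.1 := by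
      rcases hm with h | h | h
      · cases h
      · cases h
      · exact h
    rcases hp with hp | ⟨n, -, rfl⟩
    · exact (NTerm.boxes_of_mem_homes hp m hm).resolve_left (fun h => h)
    · cases hm

/-- What a net represents does not depend on the choice of its nodes. -/
theorem Represents.of_iso {N N' : Net} {t : Term} {Y : Set ℕ} (h : Represents N t Y)
    (hN : N.Iso N') : Represents N' t Y := by
  obtain ⟨E, M, A, r, hA, hr, rfl⟩ := h
  obtain ⟨f, g, hf, hg, hroot, hlinks⟩ := hN
  have hfA : ∀ e ∈ r ::ₘ A.nodes, ∀ e' ∈ r ::ₘ A.nodes, f e = f e' → e = e' := by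
    have hn : ∀ e ∈ r ::ₘ A.nodes, e ∈ (netOf A r Y).eNodes := by
      intro e he
      rcases Multiset.mem_cons.1 he with rfl | he
      · obtain ⟨l, hl, -, h⟩ := NTerm.exists_root_source (S := ∅) (r := e) hA.sorted
        exact ⟨l, .inl hl, .inl h⟩
      · obtain ⟨l, hl, h⟩ := NTerm.exists_source he (S := ∅) (r := r) hA.sorted
        exact ⟨l, .inl hl, .inl h⟩
    exact fun e he e' he' h => hf (hn e he) (hn e' he') h
  have hgA : ∀ m ∈ A.labels, ∀ m' ∈ A.labels, g m = g m' → m = m' := by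
    have hn : ∀ m ∈ A.labels, m ∈ (netOf A r Y).mNodes := by
      intro m hm
      obtain ⟨l, hl, h⟩ := NTerm.exists_label hm ∅ r
      exact ⟨l, .inl hl, .inl h⟩
    exact fun e he e' he' h => hg (hn e he) (hn e' he') h
  refine ⟨N'.E, N'.M, A.map f g, f r, ⟨?_, ?_, ?_, ?_⟩, hr.map f g, ?_⟩
  · exact (NTerm.sorted_map _ _ _ _).2 hA.sorted
  · rw [← name_map f]; exact hA.closed.map f g
  · have := Multiset.Nodup.map_on hfA hA.nodup
    rwa [Multiset.map_cons, ← NTerm.nodes_map f g] at this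
  · rw [NTerm.labels_map]; exact Multiset.Nodup.map_on hgA hA.labels_nodup
  · have hl := netOf_links_map (r := r) g hA.closed fun e he e' he' h =>
      hfA e (Multiset.mem_cons_of_mem (Cut.mem_nodes_of_mem_vars he)) e'
        (Multiset.mem_cons_of_mem (Cut.mem_nodes_of_mem_vars he')) h
    obtain ⟨E', M', r', L'⟩ := N'
    exact Net.mk_congr hroot.symm (hlinks.trans hl.symm)

/-! ### Uniqueness of the representing net -/

open Classical in
theorem map_update {f : E → E'} {x : E} {x' : E'} {y : ENode E} (h : y ≠ .node x) :
    y.map (Function.update f x x') = y.map f := by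
  cases y with
  | name n => rfl
  | node e =>
    simp only [ENode.map]
    rw [Function.update_of_ne fun he => h (congrArg _ he)]

theorem map_eq_of_fresh {f f' : E → E'} {ν : Multiset E} (hf : ∀ e ∉ ν, f e = f' e) {y : ENode E}
    (h : ∀ e ∈ ν, y ≠ .node e) : y.map f = y.map f' := by
  cases y with
  | name n => rfl
  | node e => simp only [ENode.map, hf e fun he => h e he rfl]

theorem scons_ne {x : E} {ρ : ℕ → ENode E} {ν : Multiset E} (hx : x ∉ ν)
    (h : ∀ n, ∀ e ∈ ν, ρ n ≠ .node e) : ∀ n, ∀ e ∈ ν, scons (.node x) ρ n ≠ .node e := by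
  rintro (_ | n) e he h'
  · injection h' with h'; exact hx (h' ▸ he)
  · exact h n e he h'

theorem scons_map {x : E} {x' : E'} {ρ : ℕ → ENode E} {ρ' : ℕ → ENode E'} {f : E → E'}
    (hx : f x = x') (h : ∀ n, ρ' n = (ρ n).map f) :
    ∀ n, scons (.node x') ρ' n = (scons (.node x) ρ n).map f := by
  rintro (_ | n)
  · simp only [scons_zero, ENode.map, hx]
  · exact h n

open Classical in
mutual
theorem Val.Rep.exists_map {ρ : ℕ → ENode E} {ρ' : ℕ → ENode E'} :
    ∀ {v : Val} {A : NTerm E M} {A' : NTerm E' M'}, v.Rep ρ A → v.Rep ρ' A' → A.nodes.Nodup →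
      A.labels.Nodup → ∀ (f₀ : E → E') (g₀ : M → M'), (∀ n, ∀ e ∈ A.nodes, ρ n ≠ .node e) →
      (∀ n, ρ' n = (ρ n).map f₀) → ∃ f g, (∀ e ∉ A.nodes, f e = f₀ e) ∧
        (∀ m ∉ A.labels, g m = g₀ m) ∧ A' = A.map f g
  | _, _, _, .var _ n m, .var _ _ m', _, _, f₀, g₀, _, hρ => by
    refine ⟨f₀, Function.update g₀ m m', fun _ _ => rfl, fun k hk => ?_, ?_⟩
    · exact Function.update_of_ne (by simpa [NTerm.labels] using hk) _ _
    · simp only [NTerm.map, Function.update_self, hρ]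
  | _, _, _, .lam (m := m) (x := x) (b := b) (A := B) h,
      .lam (m := m') (x := x') (b := b') (A := B') h', hn, hm, f₀, g₀, hfr, hρ => by
    simp only [NTerm.nodes_lam, NTerm.labels, Multiset.nodup_cons, Multiset.mem_cons, not_or,
      forall_eq_or_imp] at hn hm hfr ⊢
    obtain ⟨f, g, hf, hg, rfl⟩ := Term.Rep.exists_map h h' hn.2.2 hm.2
      (Function.update (Function.update f₀ b b') x x') (Function.update g₀ m m')
      (scons_ne hn.1.2 fun n => (hfr n).2.2) (scons_map (Function.update_self _ _ _) fun n => by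
        rw [map_update (hfr n).1, map_update (hfr n).2.1, hρ])
    refine ⟨f, g, fun e he => ?_, fun k hk => ?_, ?_⟩
    · rw [hf e he.2.2, Function.update_of_ne he.1, Function.update_of_ne he.2.1]
    · rw [hg k hk.2, Function.update_of_ne hk.1]
    · rw [NTerm.map, hf x hn.1.2, hf b hn.2.1, hg m hm.1, Function.update_self,
        Function.update_self, Function.update_of_ne (Ne.symm hn.1.1), Function.update_self]
/-- Two annotations of the same term differ by a relabelling of the nodes. -/
theorem Term.Rep.exists_map {ρ : ℕ → ENode E} {ρ' : ℕ → ENode E'} :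
    ∀ {t : Term} {A : NTerm E M} {A' : NTerm E' M'}, t.Rep ρ A → t.Rep ρ' A' → A.nodes.Nodup →
      A.labels.Nodup → ∀ (f₀ : E → E') (g₀ : M → M'), (∀ n, ∀ e ∈ A.nodes, ρ n ≠ .node e) →
      (∀ n, ρ' n = (ρ n).map f₀) → ∃ f g, (∀ e ∉ A.nodes, f e = f₀ e) ∧
        (∀ m ∉ A.labels, g m = g₀ m) ∧ A' = A.map f g
  | _, _, _, .val h, .val h', hn, hm, f₀, g₀, hfr, hρ => by
    obtain ⟨f, g, hf, hg, rfl⟩ := Val.Rep.exists_map h h' hn hm f₀ g₀ hfr hρ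
    exact ⟨f, g, hf, hg, rfl⟩
  | _, _, _, .app (s := s) (A := A) (B := B) h₁ h₂, .app (s := s') h₁' h₂', hn, hm, f₀, g₀,
      hfr, hρ => by
    simp only [NTerm.nodes_app, NTerm.labels, Multiset.nodup_cons, Multiset.nodup_add,
      Multiset.mem_cons, Multiset.mem_add, not_or, or_imp, forall_and, forall_eq,
      Multiset.disjoint_left] at hn hm hfr ⊢
    obtain ⟨f₁, g₁, hf₁, hg₁, rfl⟩ := Val.Rep.exists_map h₁ h₁' hn.2.1 hm.1
      (Function.update f₀ s s') g₀ hfr.2.1 fun n => by rw [map_update (hfr.1 n), hρ]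
    obtain ⟨f, g, hf, hg, rfl⟩ := Term.Rep.exists_map h₂ h₂' hn.2.2.1 hm.2.1 f₁ g₁ hfr.2.2
      fun n => by rw [map_eq_of_fresh hf₁ (hfr.2.1 n), map_update (hfr.1 n), hρ]
    refine ⟨f, g, fun e he => ?_, fun k hk => ?_, ?_⟩
    · rw [hf e he.2.2, hf₁ e he.2.1, Function.update_of_ne he.1]
    · rw [hg k hk.2, hg₁ k hk.1]
    · rw [NTerm.map, hf s hn.1.2, hf₁ s hn.1.1, Function.update_self]
      congr 1
      refine NTerm.map_congr h₁.closed ?_ (fun e he => (hf e (hn.2.2.2 he)).symm)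
        fun m h => (hg m (hm.2.2 h)).symm
      rintro _ ⟨n, -, rfl⟩
      exact (map_eq_of_fresh hf (hfr.2.2 n)).symm
  | _, _, _, .es (x := x) (A := A) (B := B) h₁ h₂, .es (x := x') h₁' h₂', hn, hm, f₀, g₀,
      hfr, hρ => by
    simp only [NTerm.nodes_es, NTerm.labels, Multiset.nodup_cons, Multiset.nodup_add,
      Multiset.mem_cons, Multiset.mem_add, not_or, or_imp, forall_and, forall_eq,
      Multiset.disjoint_left] at hn hm hfr ⊢
    obtain ⟨f₁, g₁, hf₁, hg₁, rfl⟩ := Term.Rep.exists_map h₁ h₁' hn.2.1 hm.1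
      (Function.update f₀ x x') g₀ (scons_ne hn.1.1 hfr.2.1)
      (scons_map (Function.update_self _ _ _) fun n => by rw [map_update (hfr.1 n), hρ])
    obtain ⟨f, g, hf, hg, rfl⟩ := Term.Rep.exists_map h₂ h₂' hn.2.2.1 hm.2.1 f₁ g₁ hfr.2.2
      fun n => by rw [map_eq_of_fresh hf₁ (hfr.2.1 n), map_update (hfr.1 n), hρ]
    refine ⟨f, g, fun e he => ?_, fun k hk => ?_, ?_⟩
    · rw [hf e he.2.2, hf₁ e he.2.1, Function.update_of_ne he.1]
    · rw [hg k hk.2, hg₁ k hk.1]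
    · rw [NTerm.map, hf x hn.1.2, hf₁ x hn.1.1, Function.update_self]
      congr 1
      refine NTerm.map_congr h₁.closed ?_ (fun e he => (hf e (hn.2.2.2 he)).symm)
        fun m h => (hg m (hm.2.2 h)).symm
      rintro _ ⟨n, -, rfl⟩
      exact (map_eq_of_fresh hf (scons_ne hn.1.2 hfr.2.2 n)).symm
end

/-- Nets that represent the same term are isomorphic. -/
theorem Represents.iso {N N' : Net} {t : Term} {Y : Set ℕ} (h : Represents N t Y)
    (h' : Represents N' t Y) : N.Iso N' := by
  obtain ⟨E, M, A, r, hA, hr, rfl⟩ := h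
  obtain ⟨E', M', A', r', hA', hr', rfl⟩ := h'
  have hn := Multiset.nodup_cons.1 hA.nodup
  -- Starting from the constant map to `r'`, the root is sent to the root.
  obtain ⟨f, g, hf, -, rfl⟩ := hr.exists_map hr' hn.2 hA.labels_nodup (fun _ => r')
    (fun _ => A'.lab) (fun _ _ _ => by simp) fun _ => rfl
  obtain rfl : f r = r' := hf r hn.1
  have hfA : ∀ e ∈ r ::ₘ A.nodes, ∀ e' ∈ r ::ₘ A.nodes, f e = f e' → e = e' := by
    have := hA'.nodup
    rw [NTerm.nodes_map, ← Multiset.map_cons] at this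
    exact fun e he e' he' h => Multiset.inj_on_of_nodup_map this e he e' he' h
  refine ⟨f, g, fun e he e' he' h => ?_, fun m hm m' hm' h => ?_, rfl, ?_⟩
  · exact hfA e (hA.eNodes_subset e he) e' (hA.eNodes_subset e' he') h
  · have := hA'.labels_nodup
    rw [NTerm.labels_map] at this
    exact Multiset.inj_on_of_nodup_map this m (hA.mNodes_subset m hm) m' (hA.mNodes_subset m' hm') h
  · exact netOf_links_map g hA.closed fun e he e' he' h =>
      hfA e (Multiset.mem_cons_of_mem (Cut.mem_nodes_of_mem_vars he)) e'
        (Multiset.mem_cons_of_mem (Cut.mem_nodes_of_mem_vars he')) h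

/-! ### The translation of a term represents it -/

theorem exists_scons_eq {α : Type*} {a y : α} {ρ : ℕ → α} {F : Set ℕ} (hy : y ≠ a) :
    (∃ n ∈ F, scons a ρ n = y) ↔ ∃ n, n + 1 ∈ F ∧ ρ n = y := by
  constructor
  · rintro ⟨_ | n, hn, h⟩
    · exact absurd h.symm hy
    · exact ⟨n, hn, h⟩
  · rintro ⟨n, hn, h⟩; exact ⟨n + 1, hn, h⟩

mutual
theorem Val.Rep.mem_occ_iff {y : ENode E} : ∀ {ρ : ℕ → ENode E} {v : Val} {A : NTerm E M},
    v.Rep ρ A → (∀ e ∈ A.vars, y ≠ .node e) → (y ∈ A.occ ↔ ∃ n ∈ v.fv, ρ n = y)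
  | _, _, _, .var _ n m, _ => by simp [NTerm.occ, Val.fv, eq_comm]
  | _, _, _, .lam h, hy => by
    simp only [NTerm.vars, Multiset.mem_cons, forall_eq_or_imp] at hy
    simp only [NTerm.occ, Val.fv, Term.Rep.mem_occ_iff h hy.2, exists_scons_eq hy.1,
      Set.mem_ofPred_eq]
/-- A variable not bound in the named term occurs in it when it is assigned to a free index. -/
theorem Term.Rep.mem_occ_iff {y : ENode E} : ∀ {ρ : ℕ → ENode E} {t : Term} {A : NTerm E M},
    t.Rep ρ A → (∀ e ∈ A.vars, y ≠ .node e) → (y ∈ A.occ ↔ ∃ n ∈ t.fv, ρ n = y)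
  | _, _, _, .val h, hy => (Val.Rep.mem_occ_iff h hy :)
  | _, _, _, .app h₁ h₂, hy => by
    simp only [NTerm.vars, Multiset.mem_add, or_imp, forall_and] at hy
    simp only [NTerm.occ, Term.fv, Set.mem_union, Val.Rep.mem_occ_iff h₁ hy.1,
      Term.Rep.mem_occ_iff h₂ hy.2, or_and_right, exists_or]
  | _, _, _, .es h₁ h₂, hy => by
    simp only [NTerm.vars, Multiset.mem_cons, Multiset.mem_add, or_imp, forall_and,
      forall_eq] at hy
    simp only [NTerm.occ, Term.fv, Set.mem_union, Term.Rep.mem_occ_iff h₁ hy.2.1,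
      Term.Rep.mem_occ_iff h₂ hy.2.2, exists_scons_eq hy.1, or_and_right, exists_or,
      Set.mem_ofPred_eq]
end

mutual
/-- The annotation of a value placed at position `p` by the nodes of its translation. -/
def Val.annotate (ρ : ℕ → ENode PosNode) (p : List ℕ) : Val → NTerm PosNode (List ℕ)
  | .var n => .var p (ρ n)
  | .lam t => .lam p (.bound p) (.root (0 :: p))
      (Term.annotate (scons (.node (.bound p)) ρ) (0 :: p) t)
/-- The annotation of a term placed at position `p` by the nodes of its translation. -/
def Term.annotate (ρ : ℕ → ENode PosNode) (p : List ℕ) : Term → NTerm PosNode (List ℕ)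
  | .val v => .val (Val.annotate ρ (0 :: p) v)
  | .app v s => .app (.root (1 :: p)) (Val.annotate ρ (0 :: p) v) (Term.annotate ρ (1 :: p) s)
  | .es t u => .es (.root (1 :: p))
      (Term.annotate (scons (.node (.root (1 :: p))) ρ) (0 :: p) t) (Term.annotate ρ (1 :: p) u)
end

mutual
theorem Val.rep_annotate : ∀ (v : Val) (ρ : ℕ → ENode PosNode) (p : List ℕ),
    v.Rep ρ (v.annotate ρ p)
  | .var n, ρ, p => by rw [Val.annotate]; exact .var _ _ _
  | .lam t, ρ, p => by rw [Val.annotate]; exact .lam (Term.rep_annotate t _ _)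
theorem Term.rep_annotate : ∀ (t : Term) (ρ : ℕ → ENode PosNode) (p : List ℕ),
    t.Rep ρ (t.annotate ρ p)
  | .val v, ρ, p => by rw [Term.annotate]; exact .val (Val.rep_annotate v _ _)
  | .app v s, ρ, p => by
    rw [Term.annotate]; exact .app (Val.rep_annotate v _ _) (Term.rep_annotate s _ _)
  | .es t u, ρ, p => by
    rw [Term.annotate]; exact .es (Term.rep_annotate t _ _) (Term.rep_annotate u _ _)
end

/-- The position from which a node is named. -/
def PosNode.pos : PosNode → List ℕ
  | .root p => p
  | .bound p => p

theorem cons_suffix_unique {i j : ℕ} {p q : List ℕ} (h : i :: p <:+ q) (h' : j :: p <:+ q) :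
    i = j := by
  have := (List.suffix_of_suffix_length_le h h' (by simp)).eq_of_length (by simp)
  injection this

theorem not_cons_suffix {i : ℕ} {p : List ℕ} : ¬ i :: p <:+ p := fun h => by
  have := h.length_le
  simp at this

theorem suffix_and_ne {i : ℕ} {p q : List ℕ} (h : i :: p <:+ q) : p <:+ q ∧ q ≠ p :=
  ⟨(List.suffix_cons i p).trans h, fun h' => not_cons_suffix (h' ▸ h)⟩

mutual
theorem Val.nodes_annotate : ∀ (v : Val) (ρ : ℕ → ENode PosNode) (p : List ℕ),
    ∀ e ∈ (v.annotate ρ p).nodes, p <:+ e.pos ∧ e ≠ .root p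
  | .var n, ρ, p => by simp [Val.annotate, NTerm.nodes, NTerm.vars, NTerm.roots]
  | .lam t, ρ, p => by
    intro e he
    simp only [Val.annotate, NTerm.nodes_lam, Multiset.mem_cons] at he
    rcases he with rfl | rfl | he
    · exact ⟨List.suffix_refl _, by simp⟩
    · exact ⟨List.suffix_cons 0 p, by simp⟩
    · have := suffix_and_ne (Term.nodes_annotate t _ _ e he).1
      exact ⟨this.1, fun h => this.2 (by rw [h]; rfl)⟩
/-- The nodes of a term at position `p` are named after proper extensions of `p`. -/
theorem Term.nodes_annotate : ∀ (t : Term) (ρ : ℕ → ENode PosNode) (p : List ℕ),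
    ∀ e ∈ (t.annotate ρ p).nodes, p <:+ e.pos ∧ e.pos ≠ p
  | .val v, ρ, p => by
    intro e he
    rw [Term.annotate] at he
    exact suffix_and_ne (Val.nodes_annotate v _ _ e he).1
  | .app v s, ρ, p => by
    intro e he
    simp only [Term.annotate, NTerm.nodes_app, Multiset.mem_cons, Multiset.mem_add] at he
    rcases he with rfl | he | he
    · exact suffix_and_ne (List.suffix_refl _)
    · exact suffix_and_ne (Val.nodes_annotate v _ _ e he).1
    · exact suffix_and_ne (Term.nodes_annotate s _ _ e he).1
  | .es t u, ρ, p => by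
    intro e he
    simp only [Term.annotate, NTerm.nodes_es, Multiset.mem_cons, Multiset.mem_add] at he
    rcases he with rfl | he | he
    · exact suffix_and_ne (List.suffix_refl _)
    · exact suffix_and_ne (Term.nodes_annotate t _ _ e he).1
    · exact suffix_and_ne (Term.nodes_annotate u _ _ e he).1
end

mutual
theorem Val.labels_annotate : ∀ (v : Val) (ρ : ℕ → ENode PosNode) (p : List ℕ),
    ∀ m ∈ (v.annotate ρ p).labels, p <:+ m
  | .var n, ρ, p => by simp [Val.annotate, NTerm.labels]
  | .lam t, ρ, p => by
    intro m hm
    simp only [Val.annotate, NTerm.labels, Multiset.mem_cons] at hm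
    rcases hm with rfl | hm
    · exact List.suffix_refl _
    · exact (suffix_and_ne (Term.labels_annotate t _ _ m hm)).1
theorem Term.labels_annotate : ∀ (t : Term) (ρ : ℕ → ENode PosNode) (p : List ℕ),
    ∀ m ∈ (t.annotate ρ p).labels, p <:+ m
  | .val v, ρ, p => by
    intro m hm
    rw [Term.annotate] at hm
    exact (suffix_and_ne (Val.labels_annotate v _ _ m hm)).1
  | .app v s, ρ, p => by
    intro m hm
    simp only [Term.annotate, NTerm.labels, Multiset.mem_add] at hm
    rcases hm with hm | hm
    · exact (suffix_and_ne (Val.labels_annotate v _ _ m hm)).1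
    · exact (suffix_and_ne (Term.labels_annotate s _ _ m hm)).1
  | .es t u, ρ, p => by
    intro m hm
    simp only [Term.annotate, NTerm.labels, Multiset.mem_add] at hm
    rcases hm with hm | hm
    · exact (suffix_and_ne (Term.labels_annotate t _ _ m hm)).1
    · exact (suffix_and_ne (Term.labels_annotate u _ _ m hm)).1
end

theorem not_suffix_of_ne {i j : ℕ} (h : i ≠ j) {p q : List ℕ} (hi : i :: p <:+ q) :
    ¬ j :: p <:+ q := fun hj => h (cons_suffix_unique hi hj)

theorem root_notMem_of_suffix {i j : ℕ} (h : i ≠ j) {p : List ℕ} {ν : Multiset PosNode}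
    (hν : ∀ e ∈ ν, i :: p <:+ e.pos) : PosNode.root (j :: p) ∉ ν := fun he =>
  not_suffix_of_ne h (hν _ he) (List.suffix_refl _)

mutual
theorem Val.nodup_annotate : ∀ (v : Val) (ρ : ℕ → ENode PosNode) (p : List ℕ),
    (v.annotate ρ p).nodes.Nodup ∧ (v.annotate ρ p).labels.Nodup
  | .var n, ρ, p => by simp [Val.annotate, NTerm.nodes, NTerm.vars, NTerm.roots, NTerm.labels]
  | .lam t, ρ, p => by
    have h := Term.nodup_annotate t (scons (.node (.bound p)) ρ) (0 :: p)
    have hn := Term.nodes_annotate t (scons (.node (.bound p)) ρ) (0 :: p)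
    simp only [Val.annotate, NTerm.nodes_lam, NTerm.labels, Multiset.nodup_cons,
      Multiset.mem_cons, not_or]
    exact ⟨⟨⟨by simp, fun he => not_cons_suffix (hn _ he).1⟩, fun he => (hn _ he).2 rfl, h.1⟩,
      fun hm => not_cons_suffix (Term.labels_annotate t _ _ _ hm), h.2⟩
theorem Term.nodup_annotate : ∀ (t : Term) (ρ : ℕ → ENode PosNode) (p : List ℕ),
    (t.annotate ρ p).nodes.Nodup ∧ (t.annotate ρ p).labels.Nodup
  | .val v, ρ, p => by rw [Term.annotate]; exact Val.nodup_annotate v ρ (0 :: p)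
  | .app v s, ρ, p => by
    have h₁ := Val.nodup_annotate v ρ (0 :: p)
    have h₂ := Term.nodup_annotate s ρ (1 :: p)
    have hn₁ := Val.nodes_annotate v ρ (0 :: p)
    have hn₂ := Term.nodes_annotate s ρ (1 :: p)
    simp only [Term.annotate, NTerm.nodes_app, NTerm.labels, Multiset.nodup_cons,
      Multiset.mem_add, not_or, Multiset.nodup_add, Multiset.disjoint_left]
    exact ⟨⟨⟨root_notMem_of_suffix zero_ne_one fun e he => (hn₁ e he).1,
      fun he => (hn₂ _ he).2 rfl⟩, h₁.1, h₂.1,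
      fun he he' => not_suffix_of_ne zero_ne_one (hn₁ _ he).1 (hn₂ _ he').1⟩, h₁.2, h₂.2,
      fun hm hm' => not_suffix_of_ne zero_ne_one (Val.labels_annotate v _ _ _ hm)
        (Term.labels_annotate s _ _ _ hm')⟩
  | .es t u, ρ, p => by
    have h₁ := Term.nodup_annotate t (scons (.node (.root (1 :: p))) ρ) (0 :: p)
    have h₂ := Term.nodup_annotate u ρ (1 :: p)
    have hn₁ := Term.nodes_annotate t (scons (.node (.root (1 :: p))) ρ) (0 :: p)
    have hn₂ := Term.nodes_annotate u ρ (1 :: p)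
    simp only [Term.annotate, NTerm.nodes_es, NTerm.labels, Multiset.nodup_cons,
      Multiset.mem_add, not_or, Multiset.nodup_add, Multiset.disjoint_left]
    exact ⟨⟨⟨root_notMem_of_suffix zero_ne_one fun e he => (hn₁ e he).1,
      fun he => (hn₂ _ he).2 rfl⟩, h₁.1, h₂.1,
      fun he he' => not_suffix_of_ne zero_ne_one (hn₁ _ he).1 (hn₂ _ he').1⟩, h₁.2, h₂.2,
      fun hm hm' => not_suffix_of_ne zero_ne_one (Term.labels_annotate t _ _ _ hm)
        (Term.labels_annotate u _ _ _ hm')⟩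
end

/-- No node named after an extension of the position `p` belongs to the environment. -/
def FreshAt (ρ : ℕ → ENode PosNode) (p : List ℕ) : Prop :=
  ∀ (n : ℕ) (e : PosNode), p <:+ e.pos → ρ n ≠ .node e

theorem FreshAt.cons {ρ : ℕ → ENode PosNode} {p : List ℕ} (h : FreshAt ρ p) (i : ℕ) :
    FreshAt ρ (i :: p) := fun n e he => h n e ((List.suffix_cons i p).trans he)

theorem FreshAt.scons {ρ : ℕ → ENode PosNode} {p : List ℕ} {e : PosNode} (h : FreshAt ρ p)
    (he : ¬ p <:+ e.pos) : FreshAt (scons (.node e) ρ) p := by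
  rintro (_ | n) e' he' h'
  · injection h' with h'; exact he (h' ▸ he')
  · exact h n e' he' h'

theorem weakenings_singleton (p : Set M × ENode E) (O : Set (ENode E)) :
    weakenings {p} O = {l | p.2 ∉ O ∧ l = (p.1, .weak p.2)} := by
  simp [weakenings]

theorem weakenings_occ_union {H : Set (Set M × ENode E)} {O O' : Set (ENode E)}
    (h : ∀ p ∈ H, p.2 ∉ O') : weakenings H (O ∪ O') = weakenings H O := by
  ext l
  constructor
  · rintro ⟨p, hp, hO, rfl⟩; exact ⟨p, hp, fun h => hO (.inl h), rfl⟩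
  · rintro ⟨p, hp, hO, rfl⟩; exact ⟨p, hp, fun h' => h'.elim hO (h p hp), rfl⟩

/-- A bound variable of a named term does not occur in another one whose nodes are disjoint. -/
theorem notMem_occ {A B : NTerm E M} {P : Set (ENode E)} (hB : B.Closed P)
    (hP : ∀ e ∈ A.nodes, .node e ∉ P) (hAB : ∀ e ∈ A.nodes, e ∉ B.nodes) {S : Set M} :
    ∀ p ∈ A.homes S, p.2 ∉ B.occ := by
  intro p hp hO
  obtain ⟨e, he, h⟩ := NTerm.vars_of_mem_homes hp
  rcases hB.occ_subset _ hO with h' | ⟨e', he', h'⟩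
  · exact hP e (Cut.mem_nodes_of_mem_vars he) (h ▸ h')
  · rw [h] at h'
    injection h' with h'
    exact hAB e (Cut.mem_nodes_of_mem_vars he) (h' ▸ Cut.mem_nodes_of_mem_vars he')

/-- The variable bound in `t` occurs in the annotation of `t` when the index `0` is free. -/
theorem Term.mem_occ_annotate {t : Term} {ρ : ℕ → ENode PosNode} {p : List ℕ} {e : PosNode}
    (he : e ∉ (t.annotate (scons (.node e) ρ) p).nodes) (hρ : ∀ n, ρ n ≠ .node e) :
    ENode.node e ∈ (t.annotate (scons (.node e) ρ) p).occ ↔ 0 ∈ t.fv := by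
  rw [(t.rep_annotate _ _).mem_occ_iff]
  · constructor
    · rintro ⟨_ | n, hn, h⟩
      · exact hn
      · exact absurd h (hρ n)
    · exact fun h => ⟨0, h, rfl⟩
  · rintro e' he' h
    injection h with h
    subst h
    exact he (Cut.mem_nodes_of_mem_vars he')

mutual
theorem Val.netLinks_eq : ∀ (v : Val) (ρ : ℕ → ENode PosNode) (S : Set (List ℕ)) (p : List ℕ)
    (r : PosNode), FreshAt ρ p → Val.netLinks ρ S p v =
      (v.annotate ρ p).core S r ∪ weakenings ((v.annotate ρ p).homes S) (v.annotate ρ p).occ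
  | .var n, ρ, S, p, r, _ => by
    simp [Val.netLinks, Val.annotate, NTerm.core, NTerm.homes, weakenings]
  | .lam t, ρ, S, p, r, h => by
    have hb : ¬ 0 :: p <:+ (PosNode.bound p).pos := not_cons_suffix
    rw [Val.netLinks, Val.annotate, NTerm.core, NTerm.homes, NTerm.occ, weakenings_union,
      weakenings_singleton,
      Term.netLinks_eq t _ (insert p S) (0 :: p) (.root (0 :: p)) ((h.cons 0).scons hb)]
    simp only [Term.mem_occ_annotate (fun he => hb (Term.nodes_annotate t _ _ _ he).1)
      fun n => h n (.bound p) (List.suffix_refl _)]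
    ac_rfl
/-- The translation of a term is given by the links of its annotation. -/
theorem Term.netLinks_eq : ∀ (t : Term) (ρ : ℕ → ENode PosNode) (S : Set (List ℕ)) (p : List ℕ)
    (r : PosNode), FreshAt ρ p → Term.netLinks ρ S (.node r) p t =
      (t.annotate ρ p).core S r ∪ weakenings ((t.annotate ρ p).homes S) (t.annotate ρ p).occ
  | .val v, ρ, S, p, r, h => by
    have hl : (v.annotate ρ (0 :: p)).lab = 0 :: p := by cases v <;> simp [Val.annotate, NTerm.lab]
    rw [Term.netLinks, Term.annotate, NTerm.core, NTerm.homes, NTerm.occ, hl,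
      Val.netLinks_eq v ρ S (0 :: p) r (h.cons 0)]
    ac_rfl
  | .app v s, ρ, S, p, r, h => by
    have hl : (v.annotate ρ (0 :: p)).lab = 0 :: p := by cases v <;> simp [Val.annotate, NTerm.lab]
    have hn₁ := Val.nodes_annotate v ρ (0 :: p)
    have hn₂ := Term.nodes_annotate s ρ (1 :: p)
    have h₁ := notMem_occ (S := S) (s.rep_annotate ρ (1 :: p)).closed
      (A := v.annotate ρ (0 :: p)) (by
        rintro e he ⟨n, -, hn⟩; exact h.cons 0 n e (hn₁ e he).1 hn)
      fun e he he' => not_suffix_of_ne zero_ne_one (hn₁ e he).1 (hn₂ e he').1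
    have h₂ := notMem_occ (S := S) (v.rep_annotate ρ (0 :: p)).closed
      (A := s.annotate ρ (1 :: p)) (by
        rintro e he ⟨n, -, hn⟩; exact h.cons 1 n e (hn₂ e he).1 hn)
      fun e he he' => not_suffix_of_ne zero_ne_one (hn₁ e he').1 (hn₂ e he).1
    rw [Term.netLinks, Term.annotate, NTerm.core, NTerm.homes, NTerm.occ, hl, weakenings_union,
      weakenings_occ_union h₁, Set.union_comm (v.annotate ρ (0 :: p)).occ, weakenings_occ_union h₂,
      Val.netLinks_eq v ρ S (0 :: p) r (h.cons 0),
      Term.netLinks_eq s ρ S (1 :: p) (.root (1 :: p)) (h.cons 1)]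
    ac_rfl
  | .es t u, ρ, S, p, r, h => by
    have hx : ¬ 0 :: p <:+ (PosNode.root (1 :: p)).pos := fun h' =>
      not_suffix_of_ne zero_ne_one h' (List.suffix_refl _)
    have hn₁ := Term.nodes_annotate t (scons (.node (.root (1 :: p))) ρ) (0 :: p)
    have hn₂ := Term.nodes_annotate u ρ (1 :: p)
    have h₁ := notMem_occ (S := S) (u.rep_annotate ρ (1 :: p)).closed
      (A := t.annotate (scons (.node (.root (1 :: p))) ρ) (0 :: p)) (by
        rintro e he ⟨n, -, hn⟩; exact h.cons 0 n e (hn₁ e he).1 hn)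
      fun e he he' => not_suffix_of_ne zero_ne_one (hn₁ e he).1 (hn₂ e he').1
    have h₂ := notMem_occ (S := S)
      (t.rep_annotate (scons (.node (.root (1 :: p))) ρ) (0 :: p)).closed
      (A := u.annotate ρ (1 :: p)) (by
        rintro e he ⟨_ | n, -, hn⟩
        · injection hn with hn; exact (hn₂ e he).2 (by rw [← hn]; rfl)
        · exact h.cons 1 n e (hn₂ e he).1 hn)
      fun e he he' => not_suffix_of_ne zero_ne_one (hn₁ e he').1 (hn₂ e he).1
    have h₃ : ∀ q ∈ ({(S, .node (.root (1 :: p)))} : Set (Set (List ℕ) × ENode PosNode)),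
        q.2 ∉ (u.annotate ρ (1 :: p)).occ := by
      rintro q rfl hq
      rcases (u.rep_annotate ρ (1 :: p)).closed.occ_subset _ hq with ⟨n, -, hn⟩ | ⟨e, he, h'⟩
      · exact h.cons 1 n _ (List.suffix_refl _) hn
      · injection h' with h'
        exact (hn₂ e (Cut.mem_nodes_of_mem_vars he)).2 (by rw [← h']; rfl)
    rw [Term.netLinks, Term.annotate, NTerm.core, NTerm.homes, NTerm.occ, weakenings_union,
      weakenings_union, weakenings_occ_union h₁, weakenings_occ_union h₃,
      Set.union_comm (t.annotate _ (0 :: p)).occ, weakenings_occ_union h₂, weakenings_singleton,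
      Term.netLinks_eq t _ S (0 :: p) r ((h.cons 0).scons hx),
      Term.netLinks_eq u ρ S (1 :: p) (.root (1 :: p)) (h.cons 1)]
    simp only [Term.mem_occ_annotate (fun he => hx (hn₁ _ he).1)
      fun n => h n (.root (1 :: p)) (List.suffix_cons 1 p)]
    ac_rfl
end

/-- The translation of a term represents it, the free variables of the net being those of the term
and the names in `X`. -/
theorem Term.represents_toNet (t : Term) (X : Finset ℕ) :
    Represents (t.toNet X) t (↑X ∪ t.fv) := by
  have hr := t.rep_annotate .name []
  have hn := t.nodup_annotate .name []
  refine ⟨PosNode, List ℕ, t.annotate .name [], .root [], ⟨hr.sorted, ?_, ?_, hn.2⟩, hr, ?_⟩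
  · exact hr.closed.mono (Set.image_mono Set.subset_union_right)
  · exact Multiset.nodup_cons.2 ⟨fun h => (t.nodes_annotate .name [] _ h).2 rfl, hn.1⟩
  · refine Net.mk_congr (E := PosNode) (M := List ℕ) rfl ?_
    rw [Term.netLinks_eq t .name ∅ [] (.root []) (fun _ _ _ => by simp), weakenings_union,
      ← Set.union_assoc]
    congr 1
    have hocc : ∀ y, ENode.name y ∈ (t.annotate .name []).occ ↔ y ∈ t.fv := fun y => by
      rw [hr.mem_occ_iff (by simp)]; simp
    ext l
    constructor
    · rintro ⟨y, hy, hyt, rfl⟩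
      exact ⟨_, ⟨y, .inl hy, rfl⟩, by rwa [hocc], rfl⟩
    · rintro ⟨_, ⟨y, hy, rfl⟩, hO, rfl⟩
      rw [hocc] at hO
      exact ⟨y, hy.resolve_right hO, hO, rfl⟩

/-! ### Transfer of the properties of reduction -/

theorem Net.Iso.refl (N : Net) : N.Iso N := by
  refine ⟨id, id, Set.injOn_id _, Set.injOn_id _, ?_, ?_⟩
  · cases N.root <;> rfl
  · have he : ENode.map (id : N.E → N.E) = id := by funext y; cases y <;> rfl
    have hl : ∀ l : Link N.E N.M, l.map id id = l := fun l => by cases l <;> rfl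
    simp [he, hl]

theorem Represents.exists_net_step {N : Net} {t t' : Term} {Y : Set ℕ} (h : Represents N t Y)
    (hs : t.Step t') : ∃ N', N.Step N' ∧ Represents N' t' Y := by
  obtain ⟨N', hN, h'⟩ := h.exists_contracts hs
  exact ⟨N', ⟨N', hN, .refl N'⟩, h'⟩

theorem Represents.exists_term_step {N N' : Net} {t : Term} {Y : Set ℕ} (h : Represents N t Y)
    (hN : N.Step N') : ∃ t', t.Step t' ∧ Represents N' t' Y := by
  obtain ⟨N₀, hN, hi⟩ := hN
  obtain ⟨t', ht, h'⟩ := h.exists_step hN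
  exact ⟨t', ht, h'.of_iso hi⟩

section Bisimulation

variable {α β : Type*} {r : α → α → Prop} {s : β → β → Prop} {R : α → β → Prop}

theorem exists_reflTransGen (h : ∀ {a a' b}, R a b → r a a' → ∃ b', s b b' ∧ R a' b') {a a' : α}
    {b : β} (hR : R a b) (ha : Relation.ReflTransGen r a a') :
    ∃ b', Relation.ReflTransGen s b b' ∧ R a' b' := by
  induction ha with
  | refl => exact ⟨b, .refl, hR⟩
  | tail _ hr ih =>
    obtain ⟨b', hb, hR'⟩ := ih
    obtain ⟨b'', hb', hR''⟩ := h hR' hr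
    exact ⟨b'', hb.tail hb', hR''⟩

theorem IsNormal.of_simulation (h : ∀ {a a' b}, R a b → r a a' → ∃ b', s b b' ∧ R a' b') {a : α}
    {b : β} (hR : R a b) (hb : IsNormal s b) : IsNormal r a := fun _ ha =>
  let ⟨b', hb', _⟩ := h hR ha
  hb b' hb'

theorem StronglyNormalizing.of_simulation
    (h : ∀ {a a' b}, R a b → r a a' → ∃ b', s b b' ∧ R a' b') {a : α} {b : β} (hR : R a b)
    (hb : StronglyNormalizing s b) : StronglyNormalizing r a := by
  rintro ⟨f, rfl, hf⟩
  -- The simulating sequence is built step by step along the given one.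
  choose! k hk using fun n b (hR : R (f n) b) => h hR (hf n)
  have hg : ∀ n, R (f n) (Nat.rec b (fun n b => k n b) n) := fun n => by
    induction n with
    | zero => exact hR
    | succ n ih => exact (hk n _ ih).2
  exact hb ⟨fun n => Nat.rec b (fun n b => k n b) n, rfl, fun n => (hk n _ (hg n)).1⟩

theorem WeaklyNormalizing.of_simulation
    (h : ∀ {a a' b}, R a b → r a a' → ∃ b', s b b' ∧ R a' b')
    (h' : ∀ {a b b'}, R a b → s b b' → ∃ a', r a a' ∧ R a' b') {a : α} {b : β} (hR : R a b)
    (ha : WeaklyNormalizing r a) : WeaklyNormalizing s b := by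
  obtain ⟨a', haa', ha'⟩ := ha
  obtain ⟨b', hbb', hR'⟩ := exists_reflTransGen h hR haa'
  exact ⟨b', hbb', .of_simulation (R := fun b a => R a b) h' hR' ha'⟩

theorem withoutNormalForm_iff {a : α} : WithoutNormalForm r a ↔ ¬ WeaklyNormalizing r a := by
  simp only [WithoutNormalForm, WeaklyNormalizing, not_exists, not_and]

end Bisimulation

end VKer

theorem mainTheorem4 :
    (∀ (t : VKer.Term) (X : Finset ℕ),
      (VKer.WeaklyNormalizing VKer.Term.Step t ↔
        VKer.WeaklyNormalizing VKer.Net.Step (t.toNet X)) ∧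
      (VKer.StronglyNormalizing VKer.Term.Step t ↔
        VKer.StronglyNormalizing VKer.Net.Step (t.toNet X)) ∧
      (VKer.IsNormal VKer.Term.Step t ↔ VKer.IsNormal VKer.Net.Step (t.toNet X)) ∧
      (VKer.WithoutNormalForm VKer.Term.Step t ↔
        VKer.WithoutNormalForm VKer.Net.Step (t.toNet X))) ∧
    (∀ N N₁ N₂ : VKer.Net, N.IsProofNet →
      Relation.ReflTransGen VKer.Net.Step N N₁ → Relation.ReflTransGen VKer.Net.Step N N₂ →
      ∃ N₃ N₄ : VKer.Net, Relation.ReflTransGen VKer.Net.Step N₁ N₃ ∧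
        Relation.ReflTransGen VKer.Net.Step N₂ N₄ ∧ N₃.Iso N₄) := by
  open VKer in
  constructor
  · intro t X
    have hR := t.represents_toNet X
    have fwd : ∀ {a a' : Term} {b : Net}, Represents b a (↑X ∪ t.fv) → a.Step a' →
        ∃ b', b.Step b' ∧ Represents b' a' (↑X ∪ t.fv) := fun h => h.exists_net_step
    have bwd : ∀ {b b' : Net} {a : Term}, Represents b a (↑X ∪ t.fv) → b.Step b' →
        ∃ a', a.Step a' ∧ Represents b' a' (↑X ∪ t.fv) := fun h => h.exists_term_step
    have hW : WeaklyNormalizing Term.Step t ↔ WeaklyNormalizing Net.Step (t.toNet X) :=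
      ⟨.of_simulation (R := fun a b => Represents b a (↑X ∪ t.fv)) fwd bwd hR,
        .of_simulation (R := fun b a => Represents b a (↑X ∪ t.fv)) bwd fwd hR⟩
    refine ⟨hW, ⟨?_, ?_⟩, ⟨?_, ?_⟩, ?_⟩
    · exact .of_simulation (R := fun b a => Represents b a (↑X ∪ t.fv)) bwd hR
    · exact .of_simulation (R := fun a b => Represents b a (↑X ∪ t.fv)) fwd hR
    · exact .of_simulation (R := fun b a => Represents b a (↑X ∪ t.fv)) bwd hR
    · exact .of_simulation (R := fun a b => Represents b a (↑X ∪ t.fv)) fwd hR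
    · rw [withoutNormalForm_iff, withoutNormalForm_iff, hW]
  · rintro N N₁ N₂ ⟨t, X, hN⟩ h₁ h₂
    have hR := (t.represents_toNet X).of_iso hN
    have fwd : ∀ {a a' : Term} {b : Net}, Represents b a (↑X ∪ t.fv) → a.Step a' →
        ∃ b', b.Step b' ∧ Represents b' a' (↑X ∪ t.fv) := fun h => h.exists_net_step
    have bwd : ∀ {b b' : Net} {a : Term}, Represents b a (↑X ∪ t.fv) → b.Step b' →
        ∃ a', a.Step a' ∧ Represents b' a' (↑X ∪ t.fv) := fun h => h.exists_term_step
    obtain ⟨t₁, ht₁, hR₁⟩ := exists_reflTransGen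
      (R := fun b a => Represents b a (↑X ∪ t.fv)) bwd hR h₁
    obtain ⟨t₂, ht₂, hR₂⟩ := exists_reflTransGen
      (R := fun b a => Represents b a (↑X ∪ t.fv)) bwd hR h₂
    obtain ⟨t₃, ht₁₃, ht₂₃⟩ := Term.confluent ht₁ ht₂
    obtain ⟨N₃, hN₃, hR₃⟩ := exists_reflTransGen
      (R := fun a b => Represents b a (↑X ∪ t.fv)) fwd hR₁ ht₁₃
    obtain ⟨N₄, hN₄, hR₄⟩ := exists_reflTransGen
      (R := fun a b => Represents b a (↑X ∪ t.fv)) fwd hR₂ ht₂₃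
    exact ⟨N₃, N₄, hN₃, hN₄, hR₃.iso hR₄⟩
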